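/- Let $X$ be a complex manifold (Hausdorff, second countable) of dimension $n\ge 2$, let $K\subset X$ be compact, let $1\le p\le n-1$ and $k:=n-p$. **Forms and operators.** $\mathcal E^{s}(X)_{\mathbb R}$ and $\mathcal E^{p,p}(X)_{\mathbb R}$ denote the spaces of smooth real $s$-forms and of smooth real $(p,p)$-forms on $X$, and $(\mathcal E^{a,b}\oplus\mathcal E^{b,a})(X)_{\mathbb R}$ the space of pairs $(\beta,\bar\beta)$ with $\beta$ a smooth form of type $(a,b)$; all carry the $C^\infty$ topology (uniform convergence of all derivatives on compact sets). Consider the operators $$\sigma_{2q+1}=d:\mathcal E^{p,p}(X)_{\mathbb R}\to(\mathcal E^{p+1,p}\oplus\mathcal E^{p,p+1})(X)_{\mathbb R}\qquad(q:=p-1),$$ $$\sigma_{2p-1}:(\mathcal E^{p,p-1}\oplus\mathcal E^{p-1,p})(X)_{\mathbb R}\to\mathcal E^{p,p}(X)_{\mathbb R},\quad(\beta,\bar\beta)\mapsto\bar\partial\beta+\partial\bar\beta,$$ $$\sigma_{2p}=i\partial\bar\partial:\mathcal E^{p,p}(X)_{\mathbb R}\to\mathcal E^{p+1,p+1}(X)_{\mathbb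 R},\qquad d_{2p}=d:\mathcal E^{2p}(X)_{\mathbb R}\to\mathcal E^{2p+1}(X)_{\mathbb R}.$$ A *topological homomorphism* is a continuous linear map that is open onto its image. $\sigma'$ denotes the transpose of $\sigma$, $\sigma'(S)=S\circ\sigma$, between the topological duals. **Positivity.** For $\psi_1,\dots,\psi_k\in T_x^*X$ of type $(1,0)$ put $\eta:=\psi_1\wedge\dots\wedge\psi_k$ and $\sigma_k:=i^{k^2}2^{-k}$ (a constant). A real $(p,p)$-form $\Omega$ is weakly positive at $x$ if $\Omega_x\wedge\sigma_k\,\eta\wedge\bar\eta$ is a nonnegative multiple of the volume form for all such $\psi_j$, and transverse at $x$, written $\Omega_x>0$, if it is a strictly positive multiple of it for all linearly independent $\psi_1,\dots,\psi_k$. A (compactly supported, real) current of bidimension $(p,p)$ is an element $T$ of the topological dual $\mathcal E'_{p,p}(X)_{\mathbb R}$ of $\mathcal E^{p,p}(X)_{\mathbb R}$; it is strongly positive, $T\ge0$, if $T(\Omega)\ge 0$ for every form $\Omega\in\mathcal E^{p,p}(X)_{\mathbb R}$ that is weakly positive at every point. It is also regarded as a functional on $\mathcal E^{2p}(X)_{\mathbb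 R}$ by $T(\Psi):=T(\Psi^{p,p})$, where $\Psi^{p,p}$ is the $(p,p)$-component of $\Psi$. **Theorem 8.2.** 1. Suppose $\sigma_{2q+1}$ is a topological homomorphism. Then there is a real $(p,p)$-form $\Omega$ on $X$ with $\Omega\in\ker\sigma_{2q+1}$ and $\Omega_x>0$ for all $x\in K$ if and only if there is no current $T\in\mathcal E'_{p,p}(X)_{\mathbb R}$ with $T\neq0$, $T\ge0$, $T\in\operatorname{Im}\sigma_{2q+1}'$ and $\operatorname{supp}T\subseteq K$. 2. Suppose $\sigma_{2p-1}$ and $\sigma_{2q+1}$ are topological homomorphisms and $\operatorname{Im}\sigma_{2p-1}$ has finite codimension in $\ker\sigma_{2p}$. Then there is a real $(p,p)$-form $\Omega$ on $X$ with $\Omega\in\ker\sigma_{2q+1}+\operatorname{Im}\sigma_{2p-1}$ and $\Omega_x>0$ for all $x\in K$ if and only if there is no current $T\in\mathcal E'_{p,p}(X)_{\mathbb R}$ with $T\neq0$, $T\ge0$, $T\in\ker\sigma_{2p-1}'\cap\operatorname{Im}\sigma_{2q+1}'$ and $\operatorname{supp}T\subseteq K$. 3. There is a real $2p$-form $\Psi\in\ker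 d_{2p}$ on $X$ whose component $\Omega:=\Psi^{p,p}$ satisfies $\Omega_x>0$ for all $x\in K$ if and only if there is no current $T\in\mathcal E'_{p,p}(X)_{\mathbb R}$ with $T\neq0$, $T\ge0$, $T\in\operatorname{Im}d_{2p}'$ and $\operatorname{supp}T\subseteq K$. 4. Suppose $\sigma_{2p}$ is a topological homomorphism. Then there is a real $(p,p)$-form $\Omega$ on $X$ with $\Omega\in\ker\sigma_{2p}$ and $\Omega_x>0$ for all $x\in K$ if and only if there is no current $T\in\mathcal E'_{p,p}(X)_{\mathbb R}$ with $T\neq0$, $T\ge0$, $T\in\operatorname{Im}\sigma_{2p}'$ and $\operatorname{supp}T\subseteq K$. -/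

import Mathlib

open Set Filter Topology
open scoped Manifold ContDiff ComplexConjugate

noncomputable section

namespace PKahler

/-- The model space `ℂⁿ`. -/
abbrev Cn (n : ℕ) : Type := EuclideanSpace ℂ (Fin n)

/-- Alternating `ℝ`-multilinear complex valued `k`-forms on the real vector space underlying `ℂⁿ`,
i.e. `Λᵏ` of the complexified real cotangent space. -/
abbrev AltForm (n k : ℕ) : Type := Cn n [⋀^Fin k]→L[ℝ] ℂ

section Charts

variable {n k : ℕ} {X : Type*} [TopologicalSpace X] [ChartedSpace (Cn n) X]

/-- A (not necessarily smooth) complex valued `k`-form on `X` is a function `X → AltForm n k`: as in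
Mathlib's `TangentSpace`, the fibre `T_x X` is identified with `ℂⁿ` by the preferred chart
`chartAt (Cn n) x`. `chartRep η e` is the expression of `η` in the chart `e`, that is the pullback
`(e⁻¹)^* η` (it is meaningful on `e.target`); the derivative of `e⁻¹` at `y`, read in the
identification of the fibre at `e⁻¹ y`, is the derivative of the transition map. -/
def chartRep (η : X → AltForm n k) (e : OpenPartialHomeomorph X (Cn n)) (y : Cn n) :
    AltForm n k :=
  (η (e.symm y)).compContinuousLinearMap
    (fderiv ℝ (chartAt (Cn n) (e.symm y) ∘ e.symm) y)

/-- The exterior derivative at `x`, computed in the preferred chart at `x`; by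
`chartRep_pointwiseExtDeriv` below it is given by the same formula in all charts. -/
def pointwiseExtDeriv (η : X → AltForm n k) (x : X) : AltForm n (k + 1) :=
  extDeriv (chartRep η (chartAt (Cn n) x)) (chartAt (Cn n) x x)

theorem eventually_symm_mem {n : ℕ} {X : Type*} [TopologicalSpace X]
    {e e' : OpenPartialHomeomorph X (Cn n)} {y : Cn n}
    (hy : y ∈ e.target) (hy' : e.symm y ∈ e'.source) :
    ∀ᶠ z in 𝓝 y, z ∈ e.target ∧ e.symm z ∈ e'.source := by
  have h1 := e.open_target.mem_nhds hy
  have h2 := (e.continuousAt_symm hy).preimage_mem_nhds (e'.open_source.mem_nhds hy')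
  filter_upwards [h1, h2] with z a b using ⟨a, b⟩

theorem contDiffAt_transition [IsManifold 𝓘(ℂ, Cn n) ω X]
    {e e' : OpenPartialHomeomorph X (Cn n)}
    (he : e ∈ atlas (Cn n) X) (he' : e' ∈ atlas (Cn n) X) {y : Cn n}
    (hy : y ∈ e.target) (hy' : e.symm y ∈ e'.source) :
    ContDiffAt ℂ ω (e' ∘ e.symm) y := by
  have h := HasGroupoid.compatible (G := contDiffGroupoid ω 𝓘(ℂ, Cn n)) he he'
  have h1 := (mem_groupoid_of_pregroupoid.1 h).1
  have h2 : ContDiffOn ℂ ω (e' ∘ e.symm) (e.symm.trans e').source := by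
    simpa [contDiffPregroupoid] using h1
  refine h2.contDiffAt ((e.symm.trans e').open_source.mem_nhds ?_)
  simp [hy, hy']

theorem contDiffAt_real_transition [IsManifold 𝓘(ℂ, Cn n) ω X]
    {e e' : OpenPartialHomeomorph X (Cn n)}
    (he : e ∈ atlas (Cn n) X) (he' : e' ∈ atlas (Cn n) X) {y : Cn n}
    (hy : y ∈ e.target) (hy' : e.symm y ∈ e'.source) :
    ContDiffAt ℝ ∞ (e' ∘ e.symm) y :=
  ((contDiffAt_transition he he' hy hy').of_le le_top).restrict_scalars ℝ

theorem fderiv_transition_smul [IsManifold 𝓘(ℂ, Cn n) ω X]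
    {e e' : OpenPartialHomeomorph X (Cn n)}
    (he : e ∈ atlas (Cn n) X) (he' : e' ∈ atlas (Cn n) X) {y : Cn n}
    (hy : y ∈ e.target) (hy' : e.symm y ∈ e'.source) (z : ℂ) (v : Cn n) :
    fderiv ℝ (e' ∘ e.symm) y (z • v) = z • fderiv ℝ (e' ∘ e.symm) y v := by
  have h : DifferentiableAt ℂ (e' ∘ e.symm) y :=
    (contDiffAt_transition he he' hy hy').differentiableAt (by simp)
  rw [h.fderiv_restrictScalars ℝ]
  simp

theorem chartRep_change [IsManifold 𝓘(ℂ, Cn n) ω X] (η : X → AltForm n k)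
    {e e' : OpenPartialHomeomorph X (Cn n)}
    (he : e ∈ atlas (Cn n) X) (he' : e' ∈ atlas (Cn n) X) {y : Cn n}
    (hy : y ∈ e.target) (hy' : e.symm y ∈ e'.source) :
    chartRep η e y = (chartRep η e' ((e' ∘ e.symm) y)).compContinuousLinearMap
      (fderiv ℝ (e' ∘ e.symm) y) := by
  have hx : e'.symm ((e' ∘ e.symm) y) = e.symm y := e'.left_inv hy'
  unfold chartRep
  rw [hx]
  set c := chartAt (Cn n) (e.symm y) with hc
  have hcs : e.symm y ∈ c.source := mem_chart_source _ _
  have hca : c ∈ atlas (Cn n) X := chart_mem_atlas _ _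
  have h1 : fderiv ℝ (c ∘ e.symm) y =
      (fderiv ℝ (c ∘ e'.symm) ((e' ∘ e.symm) y)).comp (fderiv ℝ (e' ∘ e.symm) y) := by
    rw [← fderiv_comp]
    · apply Filter.EventuallyEq.fderiv_eq
      filter_upwards [eventually_symm_mem hy hy'] with z hz
      simp [e'.left_inv hz.2]
    · refine (contDiffAt_real_transition he' hca (e'.map_source hy') ?_).differentiableAt
        (by simp)
      simpa [e'.left_inv hy'] using hcs
    · exact (contDiffAt_real_transition he he' hy hy').differentiableAt (by simp)
  rw [h1]
  rfl

theorem chartRep_chartAt (η : X → AltForm n k) (x : X) :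
    chartRep η (chartAt (Cn n) x) (chartAt (Cn n) x x) = η x := by
  have hx : (chartAt (Cn n) x).symm (chartAt (Cn n) x x) = x :=
    (chartAt (Cn n) x).left_inv (mem_chart_source _ _)
  unfold chartRep
  rw [hx]
  have : fderiv ℝ (chartAt (Cn n) x ∘ (chartAt (Cn n) x).symm) (chartAt (Cn n) x x)
      = ContinuousLinearMap.id ℝ (Cn n) := by
    rw [← fderiv_id (𝕜 := ℝ) (x := chartAt (Cn n) x x)]
    apply Filter.EventuallyEq.fderiv_eq
    filter_upwards [(chartAt (Cn n) x).open_target.mem_nhds (mem_chart_target _ x)] with z hz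
    simp [(chartAt (Cn n) x).right_inv hz]
  rw [this]
  ext v
  simp

theorem chartRep_pointwiseExtDeriv [IsManifold 𝓘(ℂ, Cn n) ω X] {η : X → AltForm n k}
    (hη : ∀ e ∈ atlas (Cn n) X, ContDiffOn ℝ ∞ (chartRep η e) e.target)
    {e : OpenPartialHomeomorph X (Cn n)} (he : e ∈ atlas (Cn n) X) {y : Cn n}
    (hy : y ∈ e.target) :
    chartRep (pointwiseExtDeriv η) e y = extDeriv (chartRep η e) y := by
  have hcs : e.symm y ∈ (chartAt (Cn n) (e.symm y)).source := mem_chart_source _ _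
  have hca : chartAt (Cn n) (e.symm y) ∈ atlas (Cn n) X := chart_mem_atlas _ _
  rw [chartRep, pointwiseExtDeriv]
  generalize chartAt (Cn n) (e.symm y) = c at *
  have hd : DifferentiableAt ℝ (chartRep η c) ((c ∘ e.symm) y) :=
    ((hη c hca).contDiffAt (c.open_target.mem_nhds (c.map_source hcs))).differentiableAt
      (by simp)
  have h := extDeriv_pullback hd (contDiffAt_real_transition he hca hy hcs)
    (by rw [minSmoothness_of_isRCLikeNormedField]; exact ENat.LEInfty.out)
  refine h.symm.trans (Filter.EventuallyEq.extDeriv_eq ?_)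
  filter_upwards [eventually_symm_mem hy hcs] with z hz
  exact (chartRep_change η he hca hz.1 hz.2).symm

end Charts

section Types

variable {n k : ℕ}

/-- `α` is of type `(a, b)`: multiplication by a complex scalar `z` on the vectors acts on `α` as
`z ^ a * conj z ^ b`. For `k = a + b` these are the elements of `Λ^{a,b}`, the span of the
`dz_I ∧ d(conj z)_J` with `|I| = a`, `|J| = b`; for `k ≠ a + b` only `α = 0` qualifies. -/
def IsType (a b : ℕ) (α : AltForm n k) : Prop :=
  ∀ (z : ℂ) (v : Fin k → Cn n), α (fun i => z • v i) = z ^ a * conj z ^ b * α v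

/-- The points `exp (i π j / (k + 1))` on the unit circle. -/
def rotation (k j : ℕ) : ℂ := Complex.exp (Real.pi * Complex.I * j / (k + 1))

/-- For `a + b = k`, the projection `Λᵏ → Λ^{a,b}` onto the component of type `(a, b)`: the average of
`(z ^ a * conj z ^ b)⁻¹ α(z · )` over finitely many rotations `z`, see `isType_typePart` and
`sum_typePart`. -/
def typePart (a b : ℕ) : AltForm n k →L[ℝ] AltForm n k :=
  ((k : ℂ) + 1)⁻¹ • ∑ j ∈ Finset.range (k + 1),
    (rotation k j ^ a * conj (rotation k j) ^ b)⁻¹ •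
      ContinuousAlternatingMap.compContinuousLinearMapCLM
        (rotation k j • ContinuousLinearMap.id ℝ (Cn n))

theorem typePart_apply (a b : ℕ) (α : AltForm n k) (v : Fin k → Cn n) :
    typePart a b α v = ((k : ℂ) + 1)⁻¹ * ∑ j ∈ Finset.range (k + 1),
      (rotation k j ^ a * conj (rotation k j) ^ b)⁻¹ * α (fun i => rotation k j • v i) := by
  simp [typePart, ContinuousAlternatingMap.sum_apply, Function.comp_def]

/-- Complex conjugation of forms. -/
def conjForm : AltForm n k →L[ℝ] AltForm n k :=
  ContinuousLinearMap.compContinuousAlternatingMapCLM ℝ (Cn n) ℂ ℂ (Fin k)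
    (Complex.conjCLE : ℂ →L[ℝ] ℂ)

@[simp]
theorem conjForm_apply (α : AltForm n k) (v : Fin k → Cn n) :
    conjForm α v = conj (α v) := rfl

theorem rotation_ne_zero (k j : ℕ) : rotation k j ≠ 0 := Complex.exp_ne_zero _

theorem conj_rotation (k j : ℕ) : conj (rotation k j) = (rotation k j)⁻¹ := by
  rw [rotation, ← Complex.exp_conj, ← Complex.exp_neg]
  congr 1
  simp
  ring

theorem sum_rotation {k a b m : ℕ} (hab : a + b = k) (hm : m ≤ k) :
    ((k : ℂ) + 1)⁻¹ * ∑ j ∈ Finset.range (k + 1),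
      (rotation k j ^ a * conj (rotation k j) ^ b)⁻¹ *
        (rotation k j ^ m * conj (rotation k j) ^ (k - m)) = if m = a then 1 else 0 := by
  have hk : (k : ℂ) + 1 ≠ 0 := by exact_mod_cast Nat.succ_ne_zero k
  split_ifs with h
  · subst h
    have hb : k - m = b := by omega
    rw [hb]
    have : ∀ j ∈ Finset.range (k + 1), (rotation k j ^ m * conj (rotation k j) ^ b)⁻¹ *
        (rotation k j ^ m * conj (rotation k j) ^ b) = 1 := by
      intro j _
      apply inv_mul_cancel₀
      rw [conj_rotation]
      exact mul_ne_zero (pow_ne_zero _ (rotation_ne_zero _ _))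
        (pow_ne_zero _ (inv_ne_zero (rotation_ne_zero _ _)))
    rw [Finset.sum_congr rfl this]
    simp [hk]
  · have hw := Complex.isPrimitiveRoot_exp (k + 1) (Nat.succ_ne_zero k)
    set w := Complex.exp (2 * Real.pi * Complex.I / ((k + 1 : ℕ) : ℂ)) with hwdef
    set ζ : ℂ := w ^ ((m : ℤ) - a) with hζ
    have h1 : ζ ≠ 1 := by
      intro h1
      have := (hw.zpow_eq_one_iff_dvd _).1 h1
      have h2 : ((m : ℤ) - a) = 0 := by
        apply Int.eq_zero_of_abs_lt_dvd this
        rw [abs_lt]; push_cast; omega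
      omega
    have h2 : ζ ^ (k + 1) = 1 := by
      rw [hζ, ← zpow_natCast, ← zpow_mul, mul_comm, zpow_mul, zpow_natCast, hw.pow_eq_one,
        one_zpow]
    have h3 : ∀ j ∈ Finset.range (k + 1), (rotation k j ^ a * conj (rotation k j) ^ b)⁻¹ *
        (rotation k j ^ m * conj (rotation k j) ^ (k - m)) = ζ ^ j := by
      intro j _
      have hr : rotation k j ^ (2 : ℤ) = w ^ (j : ℤ) := by
        rw [rotation, hwdef, ← Complex.exp_int_mul, ← Complex.exp_int_mul]
        congr 1
        push_cast
        ring
      have hr0 := rotation_ne_zero k j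
      have : (ζ ^ j : ℂ) = rotation k j ^ (2 * ((m : ℤ) - a)) := by
        rw [zpow_mul, hr, hζ, ← zpow_natCast, ← zpow_mul, ← zpow_mul, mul_comm]
      rw [this, conj_rotation]
      simp only [← zpow_natCast, ← zpow_neg_one, ← zpow_mul, ← zpow_add₀ hr0]
      congr 1
      push_cast [Nat.cast_sub hm]
      rw [← hab]
      push_cast
      ring
    rw [Finset.sum_congr rfl h3]
    have h4 := mul_neg_geom_sum ζ (k + 1)
    rw [h2, sub_self] at h4
    rcases mul_eq_zero.1 h4 with h5 | h5
    · exact absurd (sub_eq_zero.1 h5).symm h1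
    · rw [h5, mul_zero]

theorem average_polynomial {k a b : ℕ} (hab : a + b = k) (c : ℕ → ℂ) :
    ((k : ℂ) + 1)⁻¹ * ∑ j ∈ Finset.range (k + 1),
      (rotation k j ^ a * conj (rotation k j) ^ b)⁻¹ *
        ∑ m ∈ Finset.range (k + 1), c m * (rotation k j ^ m * conj (rotation k j) ^ (k - m))
      = c a := by
  have h : ∀ j, (rotation k j ^ a * conj (rotation k j) ^ b)⁻¹ *
        ∑ m ∈ Finset.range (k + 1), c m * (rotation k j ^ m * conj (rotation k j) ^ (k - m))
      = ∑ m ∈ Finset.range (k + 1), c m * ((rotation k j ^ a * conj (rotation k j) ^ b)⁻¹ *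
        (rotation k j ^ m * conj (rotation k j) ^ (k - m))) := by
    intro j
    rw [Finset.mul_sum]
    exact Finset.sum_congr rfl fun m _ => by ring
  simp only [h]
  rw [Finset.sum_comm, Finset.mul_sum]
  have h2 : ∀ m ∈ Finset.range (k + 1), ((k : ℂ) + 1)⁻¹ * ∑ j ∈ Finset.range (k + 1),
      c m * ((rotation k j ^ a * conj (rotation k j) ^ b)⁻¹ *
        (rotation k j ^ m * conj (rotation k j) ^ (k - m))) = if m = a then c a else 0 := by
    intro m hm
    rw [← Finset.mul_sum, mul_left_comm,
      sum_rotation hab (Nat.lt_succ_iff.1 (Finset.mem_range.1 hm))]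
    split_ifs with h
    · rw [h, mul_one]
    · rw [mul_zero]
  rw [Finset.sum_congr rfl h2, Finset.sum_ite_eq' , if_pos (Finset.mem_range.2 (by omega))]

theorem re_im_smul (z : ℂ) (v : Cn n) :
    z • v = z.re • v + z.im • (Complex.I • v) := by
  ext i
  have h := Complex.re_add_im z
  simp only [PiLp.smul_apply, PiLp.add_apply, smul_eq_mul, Complex.real_smul]
  conv_lhs => rw [← h]
  ring

theorem exists_expansion : ∀ {k : ℕ} (f : MultilinearMap ℝ (fun _ : Fin k => Cn n) ℂ)
    (v : Fin k → Cn n), ∃ c : ℕ → ℂ, ∀ z : ℂ, f (fun i => z • v i) =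
      ∑ m ∈ Finset.range (k + 1), c m * (z ^ m * conj z ^ (k - m)) := by
  intro k
  induction k with
  | zero =>
    intro f v
    refine ⟨fun _ => f v, fun z => ?_⟩
    simp only [zero_add, Finset.range_one, Finset.sum_singleton, pow_zero, Nat.sub_zero, mul_one]
    congr 1
    exact Subsingleton.elim _ _
  | succ k ih =>
    intro f v
    obtain ⟨c, hc⟩ := ih (f.curryLeft (v 0)) (fun i => v i.succ)
    obtain ⟨c', hc'⟩ := ih (f.curryLeft (Complex.I • v 0)) (fun i => v i.succ)
    set A : ℕ → ℂ := fun m => (c m - Complex.I * c' m) / 2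
    set B : ℕ → ℂ := fun m => (c m + Complex.I * c' m) / 2
    refine ⟨fun m => (if m = 0 then 0 else A (m - 1)) + (if m = k + 1 then 0 else B m),
      fun z => ?_⟩
    have h0 : (fun i => z • v i) = Fin.cons (z • v 0) (fun i : Fin k => z • v i.succ) := by
      funext i
      refine Fin.cases ?_ (fun j => ?_) i <;> simp
    rw [h0, ← MultilinearMap.curryLeft_apply, re_im_smul z (v 0), map_add, map_smul, map_smul,
      add_apply, smul_apply, smul_apply, hc, hc']
    simp only [add_mul, Finset.sum_add_distrib]
    rw [Finset.sum_range_succ' _ (k + 1)]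
    rw [Finset.sum_range_succ (fun m => (if m = k + 1 then 0 else B m) * _) (k + 1)]
    simp only [if_true, zero_mul, add_zero, Nat.succ_ne_zero, if_false, Nat.add_sub_cancel,
      Complex.real_smul]
    have e1 : ∀ m ∈ Finset.range (k + 1), A m * (z ^ (m + 1) * conj z ^ (k + 1 - (m + 1))) =
        z * (A m * (z ^ m * conj z ^ (k - m))) := by
      intro m _
      rw [Nat.add_sub_add_right]
      ring
    have e2 : ∀ m ∈ Finset.range (k + 1),
        (if m = k + 1 then 0 else B m) * (z ^ m * conj z ^ (k + 1 - m)) =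
        conj z * (B m * (z ^ m * conj z ^ (k - m))) := by
      intro m hm
      have hm' := Finset.mem_range.1 hm
      rw [if_neg (by omega), show k + 1 - m = (k - m) + 1 by omega]
      ring
    rw [Finset.sum_congr rfl e1, Finset.sum_congr rfl e2]
    simp only [Finset.mul_sum, ← Finset.sum_add_distrib]
    refine Finset.sum_congr rfl fun m _ => ?_
    have hz1 : (z.re : ℂ) = (z + conj z) / 2 := by
      rw [Complex.add_conj]; push_cast; ring
    have hz2 : (z.im : ℂ) = -Complex.I * (z - conj z) / 2 := by
      rw [Complex.sub_conj]; push_cast; ring_nf; rw [Complex.I_sq]; ring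
    rw [hz1, hz2]
    simp only [A, B]
    ring

theorem typePart_apply_of_expansion {a b : ℕ} (hab : a + b = k) {α : AltForm n k}
    {v : Fin k → Cn n} {c : ℕ → ℂ} (hc : ∀ z : ℂ, α (fun i => z • v i) =
      ∑ m ∈ Finset.range (k + 1), c m * (z ^ m * conj z ^ (k - m))) :
    typePart a b α v = c a := by
  rw [typePart_apply]
  simp only [hc]
  exact average_polynomial hab c

theorem isType_typePart {a b : ℕ} (hab : a + b = k) (α : AltForm n k) :
    IsType a b (typePart a b α) := by
  intro z v
  obtain ⟨c, hc⟩ := exists_expansion α.toMultilinearMap v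
  have hc : ∀ z : ℂ, α (fun i => z • v i) =
      ∑ m ∈ Finset.range (k + 1), c m * (z ^ m * conj z ^ (k - m)) := hc
  rw [typePart_apply_of_expansion hab hc,
    typePart_apply_of_expansion (c := fun m => c m * (z ^ m * conj z ^ (k - m))) hab]
  · rw [show k - a = b by omega]
    ring
  · intro w
    simp only [smul_smul, hc, map_mul, mul_pow]
    exact Finset.sum_congr rfl fun m _ => by ring

theorem sum_typePart (α : AltForm n k) :
    ∑ a ∈ Finset.range (k + 1), typePart a (k - a) α = α := by
  ext v
  obtain ⟨c, hc⟩ := exists_expansion α.toMultilinearMap v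
  have hc : ∀ z : ℂ, α (fun i => z • v i) =
      ∑ m ∈ Finset.range (k + 1), c m * (z ^ m * conj z ^ (k - m)) := hc
  have h1 := hc 1
  simp only [one_smul, one_pow, map_one, mul_one] at h1
  rw [ContinuousAlternatingMap.sum_apply]
  refine Eq.trans (Finset.sum_congr rfl fun a ha => ?_) h1.symm
  exact typePart_apply_of_expansion
    (Nat.add_sub_cancel' (Nat.lt_succ_iff.1 (Finset.mem_range.1 ha))) hc

theorem conjForm_typePart (a b : ℕ) (α : AltForm n k) :
    conjForm (typePart a b α) = typePart b a (conjForm α) := by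
  ext v
  simp only [conjForm_apply, typePart_apply, map_mul, map_sum, map_inv₀, map_pow, map_add,
    map_one, map_natCast, Complex.conj_conj]
  congr 1
  exact Finset.sum_congr rfl fun j _ => by rw [mul_comm (conj _ ^ a)]

theorem isType_iff_forall {a b : ℕ} {α : AltForm n k} : IsType a b α ↔ ∀ z : ℂ,
    (ContinuousAlternatingMap.compContinuousLinearMapCLM
        (z • ContinuousLinearMap.id ℝ (Cn n)) - (z ^ a * conj z ^ b) •
        ContinuousLinearMap.id ℝ (AltForm n k) : AltForm n k →L[ℝ] AltForm n k) α = 0 := by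
  refine forall_congr' fun z => ?_
  rw [ContinuousAlternatingMap.ext_iff]
  refine forall_congr' fun v => ?_
  simp [sub_eq_zero, Function.comp_def]

theorem isType_fderiv {a b : ℕ} {f : Cn n → AltForm n k} {y : Cn n}
    (hf : DifferentiableAt ℝ f y) (ht : ∀ᶠ z in 𝓝 y, IsType a b (f z)) (u : Cn n) :
    IsType a b (fderiv ℝ f y u) := by
  rw [isType_iff_forall]
  intro z
  generalize hL : (ContinuousAlternatingMap.compContinuousLinearMapCLM
        (z • ContinuousLinearMap.id ℝ (Cn n)) - (z ^ a * conj z ^ b) •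
        ContinuousLinearMap.id ℝ (AltForm n k) : AltForm n k →L[ℝ] AltForm n k) = L
  have h1 : fderiv ℝ (fun x => L (f x)) y = L.comp (fderiv ℝ f y) :=
    (L.hasFDerivAt.comp y hf.hasFDerivAt).fderiv
  have h2 : (fun x => L (f x)) =ᶠ[𝓝 y] fun _ => 0 := by
    filter_upwards [ht] with x hx
    rw [← hL]
    exact isType_iff_forall.1 hx z
  rw [h2.fderiv_eq] at h1
  simpa using (congrArg (fun M => M u) h1).symm

theorem extDeriv_expansion {a b : ℕ} {f : Cn n → AltForm n k} {y : Cn n}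
    (hf : DifferentiableAt ℝ f y) (ht : ∀ᶠ z in 𝓝 y, IsType a b (f z))
    (v : Fin (k + 1) → Cn n) : ∃ C D : ℂ, ∀ z : ℂ,
      extDeriv f y (fun i => z • v i) =
        C * (z ^ (a + 1) * conj z ^ b) + D * (z ^ a * conj z ^ (b + 1)) := by
  set A : ℂ := ∑ i : Fin (k + 1), (-1) ^ i.val • fderiv ℝ f y (v i) (i.removeNth v)
  set B : ℂ := ∑ i : Fin (k + 1), (-1) ^ i.val •
    fderiv ℝ f y (Complex.I • v i) (i.removeNth v)
  refine ⟨(A - Complex.I * B) / 2, (A + Complex.I * B) / 2, fun z => ?_⟩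
  have h : ∀ i : Fin (k + 1), (-1) ^ i.val • fderiv ℝ f y (z • v i)
      (i.removeNth fun j => z • v j) = z ^ a * conj z ^ b *
        (z.re * ((-1) ^ i.val • fderiv ℝ f y (v i) (i.removeNth v)) +
          z.im * ((-1) ^ i.val • fderiv ℝ f y (Complex.I • v i) (i.removeNth v))) := by
    intro i
    have h1 : (i.removeNth fun j => z • v j) = fun j => z • (i.removeNth v) j := rfl
    rw [h1, isType_fderiv hf ht (z • v i) z, re_im_smul z (v i), map_add, map_smul, map_smul,
      ContinuousAlternatingMap.add_apply, ContinuousAlternatingMap.smul_apply,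
      ContinuousAlternatingMap.smul_apply, Complex.real_smul, Complex.real_smul]
    simp only [zsmul_eq_mul]
    ring
  have hz1 : (z.re : ℂ) = (z + conj z) / 2 := by
    rw [Complex.add_conj]; push_cast; ring
  have hz2 : (z.im : ℂ) = -Complex.I * (z - conj z) / 2 := by
    rw [Complex.sub_conj]; push_cast; ring_nf; rw [Complex.I_sq]; ring
  rw [extDeriv, ContinuousAlternatingMap.alternatizeUncurryFin_apply,
    Finset.sum_congr rfl fun i _ => h i, ← Finset.mul_sum, Finset.sum_add_distrib,
    ← Finset.mul_sum, ← Finset.mul_sum, hz1, hz2]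
  change z ^ a * conj z ^ b * ((z + conj z) / 2 * A +
    -Complex.I * (z - conj z) / 2 * B) = _
  ring

theorem extDeriv_eq_add {a b : ℕ} (hab : a + b = k) {f : Cn n → AltForm n k} {y : Cn n}
    (hf : DifferentiableAt ℝ f y) (ht : ∀ᶠ z in 𝓝 y, IsType a b (f z)) :
    extDeriv f y = typePart (a + 1) b (extDeriv f y) + typePart a (b + 1) (extDeriv f y) := by
  ext v
  obtain ⟨C, D, h⟩ := extDeriv_expansion hf ht v
  set c : ℕ → ℂ := fun m => if m = a + 1 then C else if m = a then D else 0 with hcdef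
  have hc : ∀ z : ℂ, extDeriv f y (fun i => z • v i) =
      ∑ m ∈ Finset.range (k + 1 + 1), c m * (z ^ m * conj z ^ (k + 1 - m)) := by
    intro z
    have hm : ∀ m ∈ Finset.range (k + 1 + 1), c m * (z ^ m * conj z ^ (k + 1 - m)) =
        (if m = a + 1 then C * (z ^ (a + 1) * conj z ^ b) else 0) +
          (if m = a then D * (z ^ a * conj z ^ (b + 1)) else 0) := by
      intro m _
      simp only [hcdef]
      by_cases h1 : m = a + 1
      · subst h1
        rw [if_pos rfl, if_pos rfl, if_neg (by omega), show k + 1 - (a + 1) = b by omega,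
          add_zero]
      · rw [if_neg h1, if_neg h1]
        by_cases h2 : m = a
        · subst h2
          rw [if_pos rfl, if_pos rfl, show k + 1 - m = b + 1 by omega, zero_add]
        · rw [if_neg h2, if_neg h2, zero_mul, add_zero]
    rw [h, Finset.sum_congr rfl hm, Finset.sum_add_distrib, Finset.sum_ite_eq',
      Finset.sum_ite_eq', if_pos (Finset.mem_range.2 (by omega)),
      if_pos (Finset.mem_range.2 (by omega))]
  have e1 : c (a + 1) = C := if_pos rfl
  have e2 : c a = D := by simp [hcdef]
  have e3 := h 1
  simp only [one_smul, one_pow, map_one, mul_one] at e3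
  rw [ContinuousAlternatingMap.add_apply, typePart_apply_of_expansion (by omega) hc,
    typePart_apply_of_expansion (by omega) hc, e1, e2, e3]

end Types

section Positivity

variable {n k l : ℕ}

/-- The wedge product of complex valued alternating forms (sum over shuffles, so that
`(α ∧ β)(v, w) = α v * β w - α w * β v` for one-forms). -/
def wedge (α : Cn n [⋀^Fin k]→ₗ[ℝ] ℂ) (β : Cn n [⋀^Fin l]→ₗ[ℝ] ℂ) :
    Cn n [⋀^Fin (k + l)]→ₗ[ℝ] ℂ :=
  ((LinearMap.mul' ℝ ℂ).compAlternatingMap (α.domCoprod β)).domDomCongr finSumFinEquiv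

/-- The simple `(k, 0)`-form `ψ₁ ∧ … ∧ ψ_k`. -/
def wedgeCovectors (ψ : Fin k → (Cn n →ₗ[ℂ] ℂ)) : Cn n [⋀^Fin k]→ₗ[ℝ] ℂ :=
  { (Matrix.detRowAlternating.compLinearMap
      (LinearMap.pi ψ)).toMultilinearMap.restrictScalars ℝ with
    map_eq_zero_of_eq' := fun v _ _ h hij =>
      (Matrix.detRowAlternating.compLinearMap (LinearMap.pi ψ)).map_eq_zero_of_eq v h hij }

theorem wedgeCovectors_apply (ψ : Fin k → (Cn n →ₗ[ℂ] ℂ)) (v : Fin k → Cn n) :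
    wedgeCovectors ψ v = Matrix.det (Matrix.of fun i j => ψ j (v i)) := rfl

/-- The form `σ_k η ∧ conj η` with `η = ψ₁ ∧ … ∧ ψ_k` and `σ_k = i^{k²} 2^{-k}`. -/
def simplePositive (ψ : Fin k → (Cn n →ₗ[ℂ] ℂ)) : Cn n [⋀^Fin (k + k)]→ₗ[ℝ] ℂ :=
  (Complex.I ^ (k ^ 2) * (2 ^ k)⁻¹) •
    wedge (wedgeCovectors ψ) (Complex.conjAe.toLinearMap.compAlternatingMap (wedgeCovectors ψ))

/-- The volume form `(i/2 dz₁ ∧ d(conj z₁)) ∧ … ∧ (i/2 dz_n ∧ d(conj z_n))`, written as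
`σ_n φ ∧ conj φ` with `φ = dz₁ ∧ … ∧ dz_n`. -/
def volumeForm (n : ℕ) : Cn n [⋀^Fin (n + n)]→ₗ[ℝ] ℂ :=
  simplePositive fun j => (EuclideanSpace.proj j : Cn n →L[ℂ] ℂ).toLinearMap

/-- A real `(p, p)`-form `α` is weakly positive if, with `k = n - p`, for all `ψ₁, …, ψ_k` in `E^*` the
top form `α ∧ σ_k ψ₁ ∧ … ∧ ψ_k ∧ conj (ψ₁ ∧ … ∧ ψ_k)` is a nonnegative multiple of the volume form. -/
def IsWeaklyPositive {p : ℕ} (α : AltForm n (2 * p)) : Prop :=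
  ∀ (k : ℕ) (h : 2 * p + (k + k) = n + n) (ψ : Fin k → (Cn n →ₗ[ℂ] ℂ)),
    ∃ c : ℝ, 0 ≤ c ∧ (wedge α.toAlternatingMap (simplePositive ψ)).domDomCongr (finCongr h) =
      c • volumeForm n

/-- A real `(p, p)`-form `α` is transverse (strictly weakly positive) if, with `k = n - p`, for all
linearly independent `ψ₁, …, ψ_k` in `E^*` the top form
`α ∧ σ_k ψ₁ ∧ … ∧ ψ_k ∧ conj (ψ₁ ∧ … ∧ ψ_k)` is a positive multiple of the volume form. -/
def IsTransverse {p : ℕ} (α : AltForm n (2 * p)) : Prop :=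
  ∀ (k : ℕ) (h : 2 * p + (k + k) = n + n) (ψ : Fin k → (Cn n →ₗ[ℂ] ℂ)),
    LinearIndependent ℂ ψ →
    ∃ c : ℝ, 0 < c ∧ (wedge α.toAlternatingMap (simplePositive ψ)).domDomCongr (finCongr h) =
      c • volumeForm n

end Positivity

section Forms

/-- The space of smooth complex valued `k`-forms on `X`. -/
structure SmoothForm (n : ℕ) (X : Type*) [TopologicalSpace X] [ChartedSpace (Cn n) X]
    (k : ℕ) where
  toFun : X → AltForm n k
  contDiffOn' : ∀ e ∈ atlas (Cn n) X, ContDiffOn ℝ ∞ (chartRep toFun e) e.target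

variable {n : ℕ} {X : Type*} [TopologicalSpace X] [ChartedSpace (Cn n) X] {k : ℕ}

namespace SmoothForm

instance : CoeFun (SmoothForm n X k) fun _ => X → AltForm n k := ⟨SmoothForm.toFun⟩

theorem coe_injective :
    Function.Injective (SmoothForm.toFun : SmoothForm n X k → X → AltForm n k) := by
  rintro ⟨_, _⟩ ⟨_, _⟩ h
  simpa using h

@[ext]
theorem ext {η θ : SmoothForm n X k} (h : ∀ x, η x = θ x) : η = θ :=
  coe_injective (funext h)

theorem contDiffOn (η : SmoothForm n X k) {e : OpenPartialHomeomorph X (Cn n)}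
    (he : e ∈ atlas (Cn n) X) : ContDiffOn ℝ ∞ (chartRep η e) e.target := η.contDiffOn' e he

instance : Zero (SmoothForm n X k) := ⟨⟨0, fun e _ => by
  have h : chartRep (0 : X → AltForm n k) e = fun _ => 0 := rfl
  rw [h]; exact contDiffOn_const⟩⟩

instance : Add (SmoothForm n X k) :=
  ⟨fun η θ => ⟨η.toFun + θ.toFun, fun _ he => (η.contDiffOn he).add (θ.contDiffOn he)⟩⟩

instance : Neg (SmoothForm n X k) :=
  ⟨fun η => ⟨-η.toFun, fun _ he => (η.contDiffOn he).neg⟩⟩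

instance : Sub (SmoothForm n X k) :=
  ⟨fun η θ => ⟨η.toFun - θ.toFun, fun _ he => (η.contDiffOn he).sub (θ.contDiffOn he)⟩⟩

instance : SMul ℕ (SmoothForm n X k) :=
  ⟨fun c η => ⟨c • η.toFun, fun _ he => (η.contDiffOn he).const_smul c⟩⟩

instance : SMul ℤ (SmoothForm n X k) :=
  ⟨fun c η => ⟨c • η.toFun, fun _ he => (η.contDiffOn he).const_smul c⟩⟩

instance : SMul ℂ (SmoothForm n X k) :=
  ⟨fun c η => ⟨c • η.toFun, fun _ he => (η.contDiffOn he).const_smul c⟩⟩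

instance : AddCommGroup (SmoothForm n X k) :=
  coe_injective.addCommGroup SmoothForm.toFun rfl (fun _ _ => rfl) (fun _ => rfl)
    (fun _ _ => rfl) (fun _ _ => rfl) (fun _ _ => rfl)

instance : Module ℂ (SmoothForm n X k) :=
  coe_injective.module ℂ ⟨⟨SmoothForm.toFun, rfl⟩, fun _ _ => rfl⟩ fun _ _ => rfl

/-- The `C^∞` topology on forms: uniform convergence of all derivatives of the chart expressions on
compact subsets of the chart targets. -/
instance : TopologicalSpace (SmoothForm n X k) :=
  ⨅ (e : atlas (Cn n) X) (m : ℕ), TopologicalSpace.induced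
    (fun η : SmoothForm n X k =>
      UniformOnFun.ofFun {L : Set e.1.target | IsCompact L}
        fun y => iteratedFDeriv ℝ m (chartRep η e.1) y)
    inferInstance

@[simp]
theorem add_apply (η θ : SmoothForm n X k) (x : X) : (η + θ) x = η x + θ x := rfl

@[simp]
theorem zero_apply (x : X) : (0 : SmoothForm n X k) x = 0 := rfl

@[simp]
theorem smul_apply (c : ℂ) (η : SmoothForm n X k) (x : X) : (c • η) x = c • η x := rfl

@[simp]
theorem real_smul_apply (c : ℝ) (η : SmoothForm n X k) (x : X) :
    (c • η) x = c • η x := by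
  change (c : ℂ) • η x = c • η x
  ext v
  simp

theorem differentiableAt (η : SmoothForm n X k) (x : X) :
    DifferentiableAt ℝ (chartRep η (chartAt (Cn n) x)) (chartAt (Cn n) x x) :=
  ((η.contDiffOn (chart_mem_atlas _ x)).contDiffAt
    ((chartAt (Cn n) x).open_target.mem_nhds (mem_chart_target _ x))).differentiableAt (by simp)

end SmoothForm

end Forms

section Operators

variable {n : ℕ} {X : Type*} [TopologicalSpace X] [ChartedSpace (Cn n) X] {k : ℕ}

/-- The exterior derivative `d`. -/
def d [IsManifold 𝓘(ℂ, Cn n) ω X] : SmoothForm n X k →ₗ[ℂ] SmoothForm n X (k + 1) where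
  toFun η := ⟨pointwiseExtDeriv η, fun e he => by
    have h : ContDiffOn ℝ ∞ (extDeriv (chartRep η e)) e.target := by
      have h1 := (η.contDiffOn he).fderiv_of_isOpen (m := ∞) e.open_target (by simp)
      exact (ContinuousAlternatingMap.alternatizeUncurryFinCLM ℝ (Cn n) ℂ).contDiff.comp_contDiffOn
        h1
    exact h.congr fun y hy => chartRep_pointwiseExtDeriv η.contDiffOn' he hy⟩
  map_add' η θ := by
    ext1 x
    exact extDeriv_add (η.differentiableAt x) (θ.differentiableAt x)
  map_smul' c η := by
    ext1 x
    change ContinuousAlternatingMap.alternatizeUncurryFin (fderiv ℝ (c • chartRep η _) _) = _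
    rw [fderiv_const_smul (η.differentiableAt x),
      ContinuousAlternatingMap.alternatizeUncurryFin_smul]
    rfl

theorem d_apply [IsManifold 𝓘(ℂ, Cn n) ω X] (η : SmoothForm n X k) (x : X) :
    d η x = extDeriv (chartRep η (chartAt (Cn n) x)) (chartAt (Cn n) x x) := rfl

theorem d_d [IsManifold 𝓘(ℂ, Cn n) ω X] (η : SmoothForm n X k) : d (d η) = 0 := by
  ext1 x
  rw [d_apply]
  set c := chartAt (Cn n) x
  have hc : c ∈ atlas (Cn n) X := chart_mem_atlas _ x
  have h : chartRep (d η) c =ᶠ[𝓝 (c x)] extDeriv (chartRep η c) := by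
    filter_upwards [c.open_target.mem_nhds (mem_chart_target _ x)] with y hy
    exact chartRep_pointwiseExtDeriv η.contDiffOn' hc hy
  rw [h.extDeriv_eq]
  exact extDeriv_extDeriv_apply (r := ∞) ((η.contDiffOn hc).contDiffAt
    (c.open_target.mem_nhds (mem_chart_target _ x)))
    (by rw [minSmoothness_of_isRCLikeNormedField]; exact ENat.LEInfty.out)

/-- Complex conjugation of smooth forms. -/
def conjugate : SmoothForm n X k →ₗ[ℝ] SmoothForm n X k where
  toFun η := ⟨fun x => conjForm (η x), fun e he =>
    conjForm.contDiff.comp_contDiffOn (η.contDiffOn he)⟩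
  map_add' η θ := by ext1 x; exact map_add conjForm _ _
  map_smul' c η := by
    ext1 x
    rw [SmoothForm.real_smul_apply]
    exact map_smul conjForm c (η x)

theorem conjugate_apply (η : SmoothForm n X k) (x : X) : conjugate η x = conjForm (η x) := rfl

theorem chartRep_typePart [IsManifold 𝓘(ℂ, Cn n) ω X] (a b : ℕ) (η : X → AltForm n k)
    {e : OpenPartialHomeomorph X (Cn n)} (he : e ∈ atlas (Cn n) X) {y : Cn n}
    (hy : y ∈ e.target) :
    chartRep (fun x => typePart a b (η x)) e y = typePart a b (chartRep η e y) := by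
  ext v
  simp only [chartRep, ContinuousAlternatingMap.compContinuousLinearMap_apply, typePart_apply,
    Function.comp_def]
  simp only [← Function.comp_def (chartAt (Cn n) (e.symm y)) e.symm,
    fderiv_transition_smul he (chart_mem_atlas _ _) hy (mem_chart_source (Cn n) (e.symm y))]

/-- For `a + b = k`, the component `η ↦ η^{a,b}` of type `(a, b)` of a `k`-form. -/
def component [IsManifold 𝓘(ℂ, Cn n) ω X] (a b : ℕ) :
    SmoothForm n X k →ₗ[ℂ] SmoothForm n X k where
  toFun η := ⟨fun x => typePart a b (η x), fun e he =>
    ((typePart a b).contDiff.comp_contDiffOn (η.contDiffOn he)).congr fun y hy =>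
      chartRep_typePart a b η he hy⟩
  map_add' η θ := by ext1 x; exact map_add (typePart a b) _ _
  map_smul' c η := by
    ext x v
    simp only [RingHom.id_apply, SmoothForm.smul_apply]
    change typePart a b (c • η x) v = c • typePart a b (η x) v
    simp only [typePart_apply, ContinuousAlternatingMap.smul_apply, smul_eq_mul, Finset.mul_sum]
    exact Finset.sum_congr rfl fun j _ => by ring

theorem component_apply [IsManifold 𝓘(ℂ, Cn n) ω X] (a b : ℕ) (η : SmoothForm n X k) (x : X) :
    component a b η x = typePart a b (η x) := rfl

/-- The operator `∂ : ℰ^{a,b} → ℰ^{a+1,b}`, the component of type `(a + 1, b)` of `d`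
(to be applied to forms of type `(a, b)`). -/
def del [IsManifold 𝓘(ℂ, Cn n) ω X] (a b : ℕ) :
    SmoothForm n X k →ₗ[ℂ] SmoothForm n X (k + 1) :=
  component (a + 1) b ∘ₗ d

/-- The operator `∂̄ : ℰ^{a,b} → ℰ^{a,b+1}`, the component of type `(a, b + 1)` of `d`
(to be applied to forms of type `(a, b)`). -/
def delBar [IsManifold 𝓘(ℂ, Cn n) ω X] (a b : ℕ) :
    SmoothForm n X k →ₗ[ℂ] SmoothForm n X (k + 1) :=
  component a (b + 1) ∘ₗ d

theorem conjugate_smul (c : ℂ) (η : SmoothForm n X k) :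
    conjugate (c • η) = conj c • conjugate η := by
  ext x v
  simp [conjugate_apply]

theorem conjugate_component [IsManifold 𝓘(ℂ, Cn n) ω X] (a b : ℕ) (η : SmoothForm n X k) :
    conjugate (component a b η) = component b a (conjugate η) := by
  ext1 x
  exact conjForm_typePart a b (η x)

theorem conjugate_d [IsManifold 𝓘(ℂ, Cn n) ω X] (η : SmoothForm n X k) :
    conjugate (d η) = d (conjugate η) := by
  ext x v
  have h : fderiv ℝ (chartRep (conjugate η) (chartAt (Cn n) x)) (chartAt (Cn n) x x) =
      conjForm.comp (fderiv ℝ (chartRep η (chartAt (Cn n) x)) (chartAt (Cn n) x x)) :=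
    (conjForm.hasFDerivAt.comp _ (η.differentiableAt x).hasFDerivAt).fderiv
  rw [conjugate_apply, d_apply, d_apply, extDeriv, extDeriv, h, conjForm_apply,
    ContinuousAlternatingMap.alternatizeUncurryFin_apply,
    ContinuousAlternatingMap.alternatizeUncurryFin_apply, map_sum]
  refine Finset.sum_congr rfl fun i _ => ?_
  simp

/-- The space `ℰ^{a,b}(X)`, as a subspace of the space of `k`-forms, `k = a + b`. -/
def typeForms (n : ℕ) (X : Type*) [TopologicalSpace X] [ChartedSpace (Cn n) X] (k a b : ℕ) :
    Submodule ℝ (SmoothForm n X k) where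
  carrier := {η | ∀ x, IsType a b (η x)}
  add_mem' {η θ} hη hθ x z v := by
    simp [hη x z v, hθ x z v, mul_add]
  zero_mem' x z v := by simp
  smul_mem' c η hη x z v := by
    simp [hη x z v]
    ring

/-- The space `ℰ^k(X)_ℝ` of real `k`-forms. -/
def realForms (n : ℕ) (X : Type*) [TopologicalSpace X] [ChartedSpace (Cn n) X] (k : ℕ) :
    Submodule ℝ (SmoothForm n X k) where
  carrier := {η | conjugate η = η}
  add_mem' {η θ} hη hθ := by
    rw [Set.mem_ofPred_eq] at *
    rw [map_add, hη, hθ]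
  zero_mem' := map_zero _
  smul_mem' c η hη := by
    rw [Set.mem_ofPred_eq] at *
    rw [map_smul, hη]

/-- The space `ℰ^{p,p}(X)_ℝ` of real `(p, p)`-forms. -/
abbrev RealForm (n : ℕ) (X : Type*) [TopologicalSpace X] [ChartedSpace (Cn n) X] (p : ℕ) :
    Submodule ℝ (SmoothForm n X (2 * p)) :=
  realForms n X (2 * p) ⊓ typeForms n X (2 * p) p p

/-- The space `(ℰ^{q+1,q} ⊕ ℰ^{q,q+1})(X)_ℝ`: real `(2q+1)`-forms `β + conj β` with `β` of type
`(q + 1, q)`. -/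
abbrev RealFormPair (n : ℕ) (X : Type*) [TopologicalSpace X] [ChartedSpace (Cn n) X] (q : ℕ) :
    Submodule ℝ (SmoothForm n X (2 * q + 1)) :=
  realForms n X (2 * q + 1) ⊓
    (typeForms n X (2 * q + 1) (q + 1) q ⊔ typeForms n X (2 * q + 1) q (q + 1))

theorem conjugate_del [IsManifold 𝓘(ℂ, Cn n) ω X] (a b : ℕ) (η : SmoothForm n X k) :
    conjugate (del a b η) = delBar b a (conjugate η) := by
  simp [del, delBar, conjugate_component, conjugate_d]

theorem conjugate_delBar [IsManifold 𝓘(ℂ, Cn n) ω X] (a b : ℕ) (η : SmoothForm n X k) :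
    conjugate (delBar a b η) = del b a (conjugate η) := by
  simp [del, delBar, conjugate_component, conjugate_d]

theorem component_mem_typeForms [IsManifold 𝓘(ℂ, Cn n) ω X] {a b : ℕ} (hab : a + b = k)
    (η : SmoothForm n X k) : component a b η ∈ typeForms n X k a b :=
  fun x => isType_typePart hab (η x)

theorem d_eq_del_add_delBar [IsManifold 𝓘(ℂ, Cn n) ω X] {a b : ℕ} (hab : a + b = k)
    {η : SmoothForm n X k} (hη : η ∈ typeForms n X k a b) :
    d η = del a b η + delBar a b η := by
  ext1 x
  refine extDeriv_eq_add hab (η.differentiableAt x) ?_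
  filter_upwards [(chartAt (Cn n) x).open_target.mem_nhds (mem_chart_target _ x)] with y hy z v
  have h := hη ((chartAt (Cn n) x).symm y) z (fun i => fderiv ℝ (chartAt (Cn n)
    ((chartAt (Cn n) x).symm y) ∘ (chartAt (Cn n) x).symm) y (v i))
  simp only [chartRep, ContinuousAlternatingMap.compContinuousLinearMap_apply]
  rw [← Function.comp_def (fderiv ℝ _ y) v] at h
  rw [← h]
  congr 1
  funext i
  exact fderiv_transition_smul (chart_mem_atlas _ _) (chart_mem_atlas _ _) hy
    (mem_chart_source _ _) z (v i)

theorem del_delBar_add [IsManifold 𝓘(ℂ, Cn n) ω X] {a b : ℕ} (hab : a + b = k)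
    {η : SmoothForm n X k} (hη : η ∈ typeForms n X k a b) :
    del a (b + 1) (delBar a b η) + delBar (a + 1) b (del a b η) = 0 := by
  have h := d_d η
  rw [d_eq_del_add_delBar hab hη, map_add] at h
  have h' := congrArg (component (a + 1) (b + 1)) h
  rw [map_add, map_zero] at h'
  exact (add_comm _ _).trans h'

/-- For `p = q + 1`, the operator `σ_{2q+1} = d : ℰ^{p,p}(X)_ℝ → (ℰ^{p+1,p} ⊕ ℰ^{p,p+1})(X)_ℝ`. -/
def dRealForm [IsManifold 𝓘(ℂ, Cn n) ω X] (p : ℕ) : RealForm n X p →ₗ[ℝ] RealFormPair n X p :=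
  (d.restrictScalars ℝ).restrict fun η hη => by
    refine ⟨?_, ?_⟩
    · change conjugate (d η) = d η
      rw [conjugate_d, hη.1]
    · change d η ∈ _
      rw [d_eq_del_add_delBar (by omega) hη.2]
      exact Submodule.add_mem_sup (component_mem_typeForms (by omega) _)
        (component_mem_typeForms (by omega) _)

/-- The operator `σ_{2p} = i ∂ ∂̄ : ℰ^{p,p}(X)_ℝ → ℰ^{p+1,p+1}(X)_ℝ`. -/
def iDelDelBar [IsManifold 𝓘(ℂ, Cn n) ω X] (p : ℕ) : RealForm n X p →ₗ[ℝ] RealForm n X (p + 1) :=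
  ((Complex.I • (del p (p + 1) ∘ₗ delBar p p)).restrictScalars ℝ).restrict fun η hη => by
    change Complex.I • del p (p + 1) (delBar p p η) ∈ RealForm n X (p + 1)
    refine ⟨?_, ?_⟩
    · change conjugate (Complex.I • del p (p + 1) (delBar p p η)) =
        Complex.I • del p (p + 1) (delBar p p η)
      have h := del_delBar_add (by omega) hη.2
      rw [conjugate_smul, conjugate_del, conjugate_delBar, hη.1, Complex.conj_I, neg_smul,
        eq_neg_of_add_eq_zero_left h, smul_neg]
    · intro x z v
      have h := component_mem_typeForms (k := 2 * p + 1 + 1) (a := p + 1) (b := p + 1) (by omega)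
        (d (delBar p p η)) x z v
      change Complex.I * del p (p + 1) (delBar p p η) x (fun i => z • v i) =
        _ * (Complex.I * del p (p + 1) (delBar p p η) x v)
      rw [mul_left_comm]
      exact congrArg (Complex.I * ·) h

/-- For `p = q + 1`, the operator `σ_{2p-1} : (ℰ^{p,p-1} ⊕ ℰ^{p-1,p})(X)_ℝ → ℰ^{p,p}(X)_ℝ`,
`(β, conj β) ↦ ∂̄ β + ∂ (conj β)`. -/
def delBarAddDel [IsManifold 𝓘(ℂ, Cn n) ω X] (q : ℕ) :
    RealFormPair n X q →ₗ[ℝ] RealForm n X (q + 1) :=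
  ((delBar (q + 1) q ∘ₗ component (q + 1) q +
    del q (q + 1) ∘ₗ component q (q + 1)).restrictScalars ℝ).restrict fun η hη => by
    change delBar (q + 1) q (component (q + 1) q η) + del q (q + 1) (component q (q + 1) η) ∈
      RealForm n X (q + 1)
    refine ⟨?_, ?_⟩
    · change conjugate (delBar (q + 1) q (component (q + 1) q η) +
        del q (q + 1) (component q (q + 1) η)) = _
      rw [map_add, conjugate_del, conjugate_delBar, conjugate_component, conjugate_component,
        hη.1]
      exact add_comm _ _
    · exact Submodule.add_mem _ (component_mem_typeForms (by omega) _)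
        (component_mem_typeForms (by omega) _)

/-- The component of type `(p, p)` of a real `2p`-form, `Ψ ↦ Ψ^{p,p}`. -/
def ppPart [IsManifold 𝓘(ℂ, Cn n) ω X] (p : ℕ) :
    realForms n X (2 * p) →ₗ[ℝ] RealForm n X p :=
  ((component p p).restrictScalars ℝ).restrict fun η hη => by
    refine ⟨?_, component_mem_typeForms (by omega) _⟩
    change conjugate (component p p η) = component p p η
    rw [conjugate_component, hη]

/-- The exterior derivative on real forms, `d_k : ℰ^k(X)_ℝ → ℰ^{k+1}(X)_ℝ`. -/
def dReal (n : ℕ) (X : Type*) [TopologicalSpace X] [ChartedSpace (Cn n) X]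
    [IsManifold 𝓘(ℂ, Cn n) ω X] (k : ℕ) :
    realForms n X k →ₗ[ℝ] realForms n X (k + 1) :=
  (d.restrictScalars ℝ).restrict fun η hη => by
    change conjugate (d η) = d η
    rw [conjugate_d, hη]

end Operators

section Currents

variable {n : ℕ} {X : Type*} [TopologicalSpace X] [ChartedSpace (Cn n) X]

/-- The space `ℰ'_{p,p}(X)_ℝ` of compactly supported real currents of bidimension `(p, p)`: the
topological dual of `ℰ^{p,p}(X)_ℝ`. -/
abbrev Current (n : ℕ) (X : Type*) [TopologicalSpace X] [ChartedSpace (Cn n) X] (p : ℕ) :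
    Type _ := RealForm n X p →L[ℝ] ℝ

/-- `T ≥ 0`: the current `T` is nonnegative on all weakly positive real `(p, p)`-forms. -/
def IsStronglyPositive {p : ℕ} (T : Current n X p) : Prop :=
  ∀ Ω : RealForm n X p, (∀ x, IsWeaklyPositive (Ω.1 x)) → 0 ≤ T Ω

/-- The support of a current: the complement of the union of all open sets `U` such that `T`
vanishes on the forms with compact support in `U`. -/
def Current.support {p : ℕ} (T : Current n X p) : Set X :=
  (⋃₀ {U : Set X | IsOpen U ∧ ∀ α : RealForm n X p,
    HasCompactSupport (fun x => α.1 x) → tsupport (fun x => α.1 x) ⊆ U → T α = 0})ᶜ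

end Currents

section Duality

variable {V W : Type*} [AddCommGroup V] [Module ℝ V] [TopologicalSpace V]
  [AddCommGroup W] [Module ℝ W] [TopologicalSpace W]

/-- `T` is in the range of the transpose `S ↦ S ∘ σ` (from `W'` to `V'`) of the operator `σ`. -/
def InRangeTranspose (σ : V →ₗ[ℝ] W) (T : V →L[ℝ] ℝ) : Prop :=
  ∃ S : W →L[ℝ] ℝ, ∀ v, T v = S (σ v)

/-- `T` is in the kernel of the transpose `T ↦ T ∘ σ` (from `W'` to `V'`) of the operator `σ`. -/
def InKerTranspose (σ : V →ₗ[ℝ] W) (T : W →L[ℝ] ℝ) : Prop :=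
  ∀ v, T (σ v) = 0

end Duality

end PKahler

end

open PKahler

/-!
Each part is a duality between a subspace `A` of the real `(p, p)`-forms (the kernel of an operator,
the sum of a kernel and a range, or the `(p, p)`-parts of the closed `2p`-forms) and the strongly
positive currents that annihilate it, followed by an identification of this annihilator.

*Duality* (`exists_transverse_iff`). The forms that are transverse on `K` are a convex set, which is
open because `K` is compact. If `A` does not meet it, the Hahn–Banach theorem separates the two; the
separating functional vanishes on `A`, is strongly positive, because every weakly positive form is a
limit of transverse ones, and is supported on `K`, because transversality on `K` is not affected by
changes off `K` (`exists_current_of_disjoint`). It is not zero, as transverse forms exist.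
Conversely, let `T` be strongly positive with support in `K`, and let `T Ω = 0` for a form `Ω` that is
transverse on `K`. Multiplying by cutoff functions, one sees that `T` is nonnegative on every form
that is transverse on `K`, in particular on `Ω + t α` for every form `α` and small `t > 0`; so `T α ≥ 0`
for all `α`, and `T = 0` (`eq_zero_of_apply_eq_zero`).

*Transversality.* A form is transverse if its wedge products with the forms `σ_k η ∧ conj η` are
positive, for `η = ψ₁ ∧ … ∧ ψ_k ≠ 0`. Wedge products of covectors are determinants (`covectorDet`,
`wedge_covectorDet`), so that `σ_k η ∧ conj η` is multiplied by `|det B|²` when a matrix `B` is applied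
to the `ψ_j` (`simplePositive_matrix`). Hence it suffices to consider orthonormal frames, which form a
compact set, and transversality is an open condition (`exists_isOpen_iff_isTransverse`). An example of
a transverse form is the sum of the forms `σ_p dz_J ∧ conj dz_J` (`exists_isTransverse`).

*Annihilators of kernels* (`inRangeTranspose_iff`). If `σ` is a topological homomorphism, a functional
that vanishes on `ker σ` factors through a continuous functional on the range of `σ`, which extends
by the Hahn–Banach theorem.

*Annihilators of the closed forms* (`exists_eq_comp_dReal`). For the exterior derivative nothing has
to be assumed: a continuous functional that vanishes on the closed forms is of the form `R ∘ d`.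
Such a functional is a cycle in the complex of currents with compact support, and it has to be shown
that it is a boundary if it is orthogonal to all closed forms. There is a cover by open sets whose
finite intersections are convex in some chart (`exists_isGoodCover`), and for currents with compact
support in such an intersection the Poincaré lemma holds: the transpose of the cone operator, cut
off by a function that is `1` near the support, solves the equation (`exists_boundary_eq`,
`exists_boundary_eq_of_apply_one`). With a partition of unity this makes the double complex of Čech
chains of currents exact in both directions, and a cycle is a boundary if and only if its Čech
class, a chain of the nerve of the cover, is a boundary there (`IsCechComplex.exists_bd_eq`,
`IsCechComplex.cechClass_bd_mem`). If it is not, some linear functional on the chains of the nerve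
vanishes on the boundaries, but not on the class. The functional that it induces on the currents is
the pairing with a smooth form, as a locally finite sum of such pairings is one again; this form
pairs to zero with all boundaries, hence is closed, but does not pair to zero with the given cycle
(`IsCechComplex.exists_bd_eq_of_annihilated`).
-/

noncomputable section

namespace PKahler

/-! ### The `C^∞` topology on forms and its seminorms -/

section Topology

variable {n : ℕ} {X : Type*} [TopologicalSpace X] [ChartedSpace (Cn n) X] {k : ℕ}

theorem chartRep_add (η θ : SmoothForm n X k) (e : OpenPartialHomeomorph X (Cn n)) :
    chartRep (η + θ) e = chartRep η e + chartRep θ e := rfl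

theorem chartRep_real_smul (c : ℝ) (η : SmoothForm n X k)
    (e : OpenPartialHomeomorph X (Cn n)) : chartRep (c • η) e = c • chartRep η e := by
  funext y
  change ((c • η) (e.symm y)).compContinuousLinearMap _ = _
  rw [SmoothForm.real_smul_apply]
  rfl

theorem SmoothForm.contDiffAt (η : SmoothForm n X k) {e : OpenPartialHomeomorph X (Cn n)}
    (he : e ∈ atlas (Cn n) X) {y : Cn n} (hy : y ∈ e.target) :
    ContDiffAt ℝ ∞ (chartRep η e) y :=
  (η.contDiffOn he).contDiffAt (e.open_target.mem_nhds hy)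

theorem SmoothForm.continuousOn_jet (η : SmoothForm n X k)
    {e : OpenPartialHomeomorph X (Cn n)} (he : e ∈ atlas (Cn n) X) (m : ℕ) :
    ContinuousOn (iteratedFDeriv ℝ m (chartRep η e)) e.target := by
  refine ((η.contDiffOn he).continuousOn_iteratedFDerivWithin (m := m) (by exact_mod_cast le_top)
    e.open_target.uniqueDiffOn).congr fun y hy => ?_
  exact (iteratedFDerivWithin_of_isOpen m e.open_target hy).symm

theorem jet_add (η θ : SmoothForm n X k) {e : OpenPartialHomeomorph X (Cn n)}
    (he : e ∈ atlas (Cn n) X) (m : ℕ) {y : Cn n} (hy : y ∈ e.target) :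
    iteratedFDeriv ℝ m (chartRep (η + θ) e) y =
      iteratedFDeriv ℝ m (chartRep η e) y + iteratedFDeriv ℝ m (chartRep θ e) y := by
  rw [chartRep_add]
  exact iteratedFDeriv_add_apply ((η.contDiffAt he hy).of_le (by exact_mod_cast le_top))
    ((θ.contDiffAt he hy).of_le (by exact_mod_cast le_top))

theorem jet_smul (c : ℝ) (η : SmoothForm n X k) {e : OpenPartialHomeomorph X (Cn n)}
    (he : e ∈ atlas (Cn n) X) (m : ℕ) {y : Cn n} (hy : y ∈ e.target) :
    iteratedFDeriv ℝ m (chartRep (c • η) e) y = c • iteratedFDeriv ℝ m (chartRep η e) y := by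
  rw [chartRep_real_smul]
  exact iteratedFDeriv_const_smul_apply ((η.contDiffAt he hy).of_le (by exact_mod_cast le_top))

/-- The index set of the defining seminorms of the `C^∞` topology: a chart of the atlas, an order of
differentiation and a compact subset of the chart target. -/
structure JetIndex (n : ℕ) (X : Type*) [TopologicalSpace X] [ChartedSpace (Cn n) X] where
  chart : OpenPartialHomeomorph X (Cn n)
  chart_mem : chart ∈ atlas (Cn n) X
  order : ℕ
  carrier : Set (Cn n)
  isCompact : IsCompact carrier
  subset : carrier ⊆ chart.target

theorem bddAbove_jet (η : SmoothForm n X k) (j : JetIndex n X) :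
    BddAbove (range fun y : j.carrier => ‖iteratedFDeriv ℝ j.order (chartRep η j.chart) y‖) := by
  have h := (j.isCompact.image_of_continuousOn
    ((η.continuousOn_jet j.chart_mem j.order).mono j.subset).norm).bddAbove
  rwa [image_eq_range] at h

/-- The seminorm `η ↦ sup_L ‖D^m η‖` in a chart. -/
def jetSeminorm (k : ℕ) (j : JetIndex n X) : Seminorm ℝ (SmoothForm n X k) :=
  Seminorm.of (fun η => ⨆ y : j.carrier, ‖iteratedFDeriv ℝ j.order (chartRep η j.chart) y‖)
    (fun η θ => by
      refine Real.iSup_le (fun y => ?_) (add_nonneg (Real.iSup_nonneg fun _ => norm_nonneg _)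
        (Real.iSup_nonneg fun _ => norm_nonneg _))
      rw [jet_add η θ j.chart_mem _ (j.subset y.2)]
      exact (norm_add_le _ _).trans (add_le_add (le_ciSup (bddAbove_jet η j) y)
        (le_ciSup (bddAbove_jet θ j) y)))
    (fun c η => by
      rw [Real.mul_iSup_of_nonneg (norm_nonneg _)]
      congr 1
      funext y
      rw [jet_smul c η j.chart_mem _ (j.subset y.2), norm_smul])

theorem le_jetSeminorm (η : SmoothForm n X k) (j : JetIndex n X) {y : Cn n}
    (hy : y ∈ j.carrier) :
    ‖iteratedFDeriv ℝ j.order (chartRep η j.chart) y‖ ≤ jetSeminorm k j η :=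
  le_ciSup (bddAbove_jet η j) (⟨y, hy⟩ : j.carrier)

theorem jetSeminorm_le {η : SmoothForm n X k} {j : JetIndex n X} {c : ℝ} (hc : 0 ≤ c)
    (h : ∀ y ∈ j.carrier, ‖iteratedFDeriv ℝ j.order (chartRep η j.chart) y‖ ≤ c) :
    jetSeminorm k j η ≤ c :=
  Real.iSup_le (fun y => h y y.2) hc

/-- The jets of order `m` of a form in the chart `e`, as an additive map into the space of
functions with uniform convergence on compact sets. -/
def jetHom (k : ℕ) (e : atlas (Cn n) X) (m : ℕ) : SmoothForm n X k →+
    UniformOnFun e.1.target (ContinuousMultilinearMap ℝ (fun _ : Fin m => Cn n) (AltForm n k))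
      {L : Set e.1.target | IsCompact L} where
  toFun η := UniformOnFun.ofFun {L : Set e.1.target | IsCompact L}
        fun y => iteratedFDeriv ℝ m (chartRep η e.1) y
  map_zero' := by
    apply (UniformOnFun.toFun _).injective
    funext y
    change iteratedFDeriv ℝ m (0 : Cn n → AltForm n k) y = 0
    simp
  map_add' η θ := by
    apply (UniformOnFun.toFun _).injective
    funext y
    exact jet_add η θ e.2 m y.2

theorem topology_eq : (SmoothForm.instTopologicalSpace : TopologicalSpace (SmoothForm n X k)) =
    ⨅ (e : atlas (Cn n) X) (m : ℕ), TopologicalSpace.induced (jetHom k e m) inferInstance := rfl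

instance : IsTopologicalAddGroup (SmoothForm n X k) := by
  rw [topology_eq]
  exact topologicalAddGroup_iInf fun e => topologicalAddGroup_iInf fun m =>
    topologicalAddGroup_induced (jetHom k e m)

theorem withSeminorms_jet : WithSeminorms (jetSeminorm k : JetIndex n X → _) := by
  rw [SeminormFamily.withSeminorms_iff_nhds_eq_iInf]
  apply le_antisymm
  · refine le_iInf fun j => ?_
    rw [← tendsto_iff_comap]
    have h1 : Tendsto (jetHom k ⟨j.chart, j.chart_mem⟩ j.order) (𝓝 (0 : SmoothForm n X k))
        (𝓝 (jetHom k ⟨j.chart, j.chart_mem⟩ j.order 0)) := by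
      refine Continuous.tendsto (continuous_iff_le_induced.2 ?_) _
      rw [topology_eq]
      exact (iInf_le _ _).trans (iInf_le _ _)
    rw [UniformOnFun.tendsto_iff_tendstoUniformlyOn] at h1
    have hc : IsCompact ((↑) ⁻¹' j.carrier : Set j.chart.target) :=
      Topology.IsInducing.subtypeVal.isCompact_preimage' j.isCompact (by simpa using j.subset)
    have h2 := (Metric.tendstoUniformlyOn_iff
      (α := ContinuousMultilinearMap ℝ (fun _ : Fin j.order => Cn n) (AltForm n k))).1 (h1 _ hc)
    rw [Metric.tendsto_nhds]
    intro ε hε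
    filter_upwards [h2 (ε / 2) (half_pos hε)] with η hη
    rw [Real.dist_eq, sub_zero, abs_of_nonneg (apply_nonneg _ _)]
    refine lt_of_le_of_lt (jetSeminorm_le (half_pos hε).le fun y hy => ?_) (half_lt_self hε)
    have h3 := (hη ⟨y, j.subset hy⟩ hy).le
    rw [map_zero] at h3
    exact (dist_zero_left (iteratedFDeriv ℝ j.order (chartRep η j.chart) y)).symm.trans_le h3
  · rw [topology_eq]
    simp only [nhds_iInf, nhds_induced]
    refine le_iInf fun e => le_iInf fun m => ?_
    rw [← tendsto_iff_comap, UniformOnFun.tendsto_iff_tendstoUniformlyOn]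
    intro L hL
    refine (Metric.tendstoUniformlyOn_iff
      (α := ContinuousMultilinearMap ℝ (fun _ : Fin m => Cn n) (AltForm n k))).2 fun ε hε => ?_
    let j : JetIndex n X := ⟨e.1, e.2, m, (↑) '' L, hL.image continuous_subtype_val, by
      rintro _ ⟨y, _, rfl⟩; exact y.2⟩
    have h1 : Tendsto (jetSeminorm k j) (⨅ i : JetIndex n X, comap (jetSeminorm k i) (𝓝 0))
        (𝓝 0) := tendsto_comap.mono_left (iInf_le _ j)
    filter_upwards [h1.eventually (gt_mem_nhds hε)] with η hη y hy
    rw [map_zero]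
    exact (dist_zero_left (iteratedFDeriv ℝ m (chartRep η e.1) y)).trans_lt
      (lt_of_le_of_lt (le_jetSeminorm η j ⟨y, hy, rfl⟩) hη)

instance : ContinuousSMul ℝ (SmoothForm n X k) := withSeminorms_jet.continuousSMul

instance : PolynormableSpace ℝ (SmoothForm n X k) := withSeminorms_jet.toPolynormableSpace

theorem continuous_jetSeminorm (j : JetIndex n X) : Continuous (jetSeminorm k j) :=
  withSeminorms_jet.continuous_seminorm j

/-- The seminorm `η ↦ ∑_{i ≤ m} sup_L ‖D^i η‖` in a chart. -/
def jetSum (k : ℕ) (j : JetIndex n X) : Seminorm ℝ (SmoothForm n X k) :=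
  ∑ i ∈ Finset.range (j.order + 1), jetSeminorm k { j with order := i }

theorem jetSum_apply (j : JetIndex n X) (η : SmoothForm n X k) : jetSum k j η =
    ∑ i ∈ Finset.range (j.order + 1), jetSeminorm k { j with order := i } η := by
  simp [jetSum]

theorem continuous_jetSum (j : JetIndex n X) : Continuous (jetSum k j) := by
  have : (jetSum k j : SmoothForm n X k → ℝ) = fun η =>
      ∑ i ∈ Finset.range (j.order + 1), jetSeminorm k { j with order := i } η :=
    funext (jetSum_apply j)
  rw [this]
  exact continuous_finsetSum _ fun i _ => continuous_jetSeminorm _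

theorem sum_jet_le_jetSum (η : SmoothForm n X k) (j : JetIndex n X) {y : Cn n}
    (hy : y ∈ j.carrier) :
    ∑ i ∈ Finset.range (j.order + 1), ‖iteratedFDeriv ℝ i (chartRep η j.chart) y‖ ≤
      jetSum k j η := by
  rw [jetSum_apply]
  exact Finset.sum_le_sum fun i _ => le_jetSeminorm η { j with order := i } hy

section Criteria

variable {V : Type*} [AddCommGroup V] [Module ℝ V] [TopologicalSpace V]
  [IsTopologicalAddGroup V]

/-- A linear map into a space of forms is continuous if all jets of its values are bounded, on
compact sets, by continuous seminorms of the argument. -/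
theorem continuous_of_jet_le [ContinuousSMul ℝ V] (P : V →ₗ[ℝ] SmoothForm n X k)
    (h : ∀ j : JetIndex n X, ∃ q : V → ℝ, Continuous q ∧ q 0 = 0 ∧ ∀ v, ∀ y ∈ j.carrier,
      ‖iteratedFDeriv ℝ j.order (chartRep (P v) j.chart) y‖ ≤ q v) : Continuous P := by
  refine continuous_of_continuousAt_zero P ?_
  rw [ContinuousAt, map_zero, withSeminorms_jet.tendsto_nhds]
  intro j ε hε
  obtain ⟨q, hq, hq0, hle⟩ := h j
  have h1 : ∀ᶠ v in 𝓝 (0 : V), q v < ε := by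
    have := hq.tendsto 0
    rw [hq0] at this
    exact this.eventually (gt_mem_nhds hε)
  filter_upwards [h1] with v hv
  rw [sub_zero]
  refine lt_of_le_of_lt (jetSeminorm_le (c := max (q v) 0) (le_max_right _ _) fun y hy =>
    (hle v y hy).trans (le_max_left _ _)) (max_lt hv hε)

/-- A linear functional is continuous if it is bounded by a continuous function vanishing at `0`. -/
theorem continuous_of_norm_le {F : Type*} [SeminormedAddCommGroup F] [Module ℝ F]
    (T : V →ₗ[ℝ] F) (q : V → ℝ)
    (hq : Continuous q) (hq0 : q 0 = 0) (h : ∀ v, ‖T v‖ ≤ q v) : Continuous T := by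
  refine continuous_of_continuousAt_zero T ?_
  rw [ContinuousAt, map_zero]
  have := hq.tendsto 0
  rw [hq0] at this
  exact squeeze_zero_norm h this

end Criteria

/-- Two forms that agree near `x` have the same jets at the point corresponding to `x`. -/
theorem jet_eq_zero_of_eventuallyEq {η : SmoothForm n X k} {e : OpenPartialHomeomorph X (Cn n)}
    {y : Cn n} (hy : y ∈ e.target) (h : ∀ᶠ x in 𝓝 (e.symm y), η x = 0) (m : ℕ) :
    iteratedFDeriv ℝ m (chartRep η e) y = 0 := by
  have h1 : chartRep η e =ᶠ[𝓝 y] (0 : Cn n → AltForm n k) := by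
    filter_upwards [(e.continuousAt_symm hy).eventually h] with z hz
    rw [chartRep, hz]
    rfl
  rw [(h1.iteratedFDeriv ℝ m).eq_of_nhds]
  simp

/-- A continuous functional on the space of forms has compact support: it vanishes on the forms that
vanish near a certain compact set. -/
theorem exists_compact_support {F : Type*} [SeminormedAddCommGroup F] [NormedSpace ℝ F]
    (T : SmoothForm n X k →L[ℝ] F) : ∃ L : Set X, IsCompact L ∧
      ∀ η : SmoothForm n X k, (∀ x ∈ L, ∀ᶠ z in 𝓝 x, η z = 0) → ‖T η‖ = 0 := by
  obtain ⟨s, C, -, hs⟩ := Seminorm.bound_of_continuous withSeminorms_jet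
    ((normSeminorm ℝ F).comp (T : SmoothForm n X k →ₗ[ℝ] F)) (by
      exact T.continuous.norm)
  refine ⟨⋃ j ∈ s, j.chart.symm '' j.carrier, s.isCompact_biUnion fun j _ =>
    j.isCompact.image_of_continuousOn (j.chart.continuousOn_symm.mono j.subset), fun η hη => ?_⟩
  have h1 : s.sup (jetSeminorm k) η ≤ 0 := by
    refine Seminorm.finset_sup_apply_le le_rfl fun j hj => jetSeminorm_le le_rfl fun y hy => ?_
    rw [jet_eq_zero_of_eventuallyEq (j.subset hy)
      (hη _ (mem_biUnion hj (mem_image_of_mem _ hy))), norm_zero]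
  have h2 := hs η
  have h3 : ‖T η‖ ≤ C * s.sup (jetSeminorm k) η := h2
  have h4 : s.sup (jetSeminorm k) η = 0 := le_antisymm h1 (apply_nonneg _ _)
  rw [h4, mul_zero] at h3
  exact le_antisymm h3 (norm_nonneg _)

end Topology

/-! ### Bounds on the derivatives of `y ↦ A y (f (τ y))` -/

section Bounds

variable {E E' F G : Type*} [NormedAddCommGroup E] [NormedSpace ℝ E]
  [NormedAddCommGroup E'] [NormedSpace ℝ E'] [NormedAddCommGroup F] [NormedSpace ℝ F]
  [NormedAddCommGroup G] [NormedSpace ℝ G]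

theorem ContDiffOn.exists_bound_jet {g : E → F} {O M : Set E} (hg : ContDiffOn ℝ ∞ g O)
    (hO : IsOpen O) (hM : IsCompact M) (hMO : M ⊆ O) (m : ℕ) :
    ∃ C : ℝ, 1 ≤ C ∧ ∀ i ≤ m, ∀ y ∈ M, ‖iteratedFDerivWithin ℝ i g O y‖ ≤ C := by
  have h : ∀ i : ℕ, ∃ C : ℝ, ∀ y ∈ M, ‖iteratedFDerivWithin ℝ i g O y‖ ≤ C := fun i =>
    hM.exists_bound_of_continuousOn ((hg.continuousOn_iteratedFDerivWithin (m := i)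
      (by exact_mod_cast le_top) hO.uniqueDiffOn).mono hMO)
  choose C hC using h
  refine ⟨1 + ∑ i ∈ Finset.range (m + 1), |C i|, ?_, fun i hi y hy => ?_⟩
  · have := Finset.sum_nonneg fun i (_ : i ∈ Finset.range (m + 1)) => abs_nonneg (C i)
    linarith
  · have := Finset.single_le_sum (f := fun i => |C i|) (fun i _ => abs_nonneg (C i))
      (Finset.mem_range.2 (Nat.lt_succ_of_le hi))
    linarith [hC i y hy, le_abs_self (C i)]

/-- Linear differential operators of order `0` and changes of variables are bounded in the `C^m`
norms on compact sets, with constants that do not depend on the function `f`. -/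
theorem exists_bound_jet_clm_comp {A : E → F →L[ℝ] G} {τ : E → E'} {O M : Set E} {Ω : Set E'}
    (hA : ContDiffOn ℝ ∞ A O) (hτ : ContDiffOn ℝ ∞ τ O) (hO : IsOpen O) (hΩ : IsOpen Ω)
    (hmap : MapsTo τ O Ω) (hM : IsCompact M) (hMO : M ⊆ O) (m : ℕ) :
    ∃ C : ℝ, 0 ≤ C ∧ ∀ f : E' → F, ContDiffOn ℝ ∞ f Ω → ∀ y ∈ M,
      ‖iteratedFDeriv ℝ m (fun y => A y (f (τ y))) y‖ ≤
        C * ∑ i ∈ Finset.range (m + 1), ‖iteratedFDeriv ℝ i f (τ y)‖ := by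
  obtain ⟨CA, hCA1, hCA⟩ := ContDiffOn.exists_bound_jet hA hO hM hMO m
  obtain ⟨D, hD1, hD⟩ := ContDiffOn.exists_bound_jet hτ hO hM hMO m
  set B : (F →L[ℝ] G) →L[ℝ] F →L[ℝ] G := ContinuousLinearMap.id ℝ _
  refine ⟨‖B‖ * ∑ i ∈ Finset.range (m + 1), (m.choose i : ℝ) * CA * (m.factorial * D ^ m),
    by positivity, fun f hf y hy => ?_⟩
  set S := ∑ i ∈ Finset.range (m + 1), ‖iteratedFDeriv ℝ i f (τ y)‖ with hS
  have hS0 : 0 ≤ S := Finset.sum_nonneg fun _ _ => norm_nonneg _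
  have hyO := hMO hy
  have hcomp : ∀ i ≤ m, ‖iteratedFDerivWithin ℝ i (f ∘ τ) O y‖ ≤ m.factorial * D ^ m * S := by
    intro i hi
    have h := norm_iteratedFDerivWithin_comp_le (n := i) hf hτ (by exact_mod_cast le_top)
      hΩ.uniqueDiffOn hO.uniqueDiffOn hmap hyO (C := S) (D := D) (fun j hj => by
        rw [iteratedFDerivWithin_of_isOpen j hΩ (hmap hyO)]
        exact Finset.single_le_sum (f := fun i => ‖iteratedFDeriv ℝ i f (τ y)‖)
          (fun i _ => norm_nonneg _) (Finset.mem_range.2 (by omega)))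
      (fun j hj1 hj2 => (hD j (by omega) y hy).trans (le_self_pow₀ hD1 (by omega)))
    refine h.trans ?_
    have h1 : (i.factorial : ℝ) ≤ m.factorial := by exact_mod_cast Nat.factorial_le hi
    have h2 : D ^ i ≤ D ^ m := pow_le_pow_right₀ hD1 hi
    calc (i.factorial : ℝ) * S * D ^ i ≤ m.factorial * S * D ^ m := by gcongr
      _ = _ := by ring
  rw [← iteratedFDerivWithin_of_isOpen m hO hyO]
  have h := B.norm_iteratedFDerivWithin_le_of_bilinear (n := m) hA (hf.comp hτ hmap)
    hO.uniqueDiffOn hyO (by exact_mod_cast le_top)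
  refine h.trans ?_
  rw [mul_assoc, Finset.sum_mul]
  refine mul_le_mul_of_nonneg_left (Finset.sum_le_sum fun i hi => ?_) (norm_nonneg _)
  have hi' := Finset.mem_range.1 hi
  calc (m.choose i : ℝ) * ‖iteratedFDerivWithin ℝ i A O y‖ *
        ‖iteratedFDerivWithin ℝ (m - i) (f ∘ τ) O y‖
      ≤ (m.choose i : ℝ) * CA * (m.factorial * D ^ m * S) := by
        gcongr
        · exact hCA i (by omega) y hy
        · exact hcomp (m - i) (by omega)
    _ = _ := by ring

theorem exists_bound_jet_clm (A : F →L[ℝ] G) {Ω M : Set E} (hΩ : IsOpen Ω)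
    (hM : IsCompact M) (hMΩ : M ⊆ Ω) (m : ℕ) :
    ∃ C : ℝ, 0 ≤ C ∧ ∀ f : E → F, ContDiffOn ℝ ∞ f Ω → ∀ y ∈ M,
      ‖iteratedFDeriv ℝ m (fun y => A (f y)) y‖ ≤
        C * ∑ i ∈ Finset.range (m + 1), ‖iteratedFDeriv ℝ i f y‖ :=
  exists_bound_jet_clm_comp (A := fun _ => A) (τ := id) contDiffOn_const contDiffOn_id hΩ hΩ
    (fun _ hy => hy) hM hMΩ m

theorem contDiffOn_smul_clm {f : E → ℝ} {A : E → F →L[ℝ] G} {s : Set E}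
    (hf : ContDiffOn ℝ ∞ f s) (hA : ContDiffOn ℝ ∞ A s) :
    ContDiffOn ℝ ∞ (fun y => f y • A y) s := hf.smul hA

end Bounds

section AltForm

variable {n k : ℕ}

instance : FiniteDimensional ℝ (AltForm n k) :=
  Module.Finite.of_injective (M := AltForm n k)
    (N := MultilinearMap ℝ (fun _ : Fin k => Cn n) ℂ)
    ({ toFun := fun α => α.toMultilinearMap
       map_add' := fun _ _ => rfl
       map_smul' := fun _ _ => rfl } : AltForm n k →ₗ[ℝ] _)
    fun α β h => by
      ext v
      exact congrArg (fun f : MultilinearMap ℝ (fun _ : Fin k => Cn n) ℂ => f v) h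

instance : FiniteDimensional ℝ (ContinuousMultilinearMap ℝ (fun _ : Fin k => Cn n) ℂ) :=
  Module.Finite.of_injective (N := MultilinearMap ℝ (fun _ : Fin k => Cn n) ℂ)
    ({ toFun := fun α => α.toMultilinearMap
       map_add' := fun _ _ => rfl
       map_smul' := fun _ _ => rfl } :
      ContinuousMultilinearMap ℝ (fun _ : Fin k => Cn n) ℂ →ₗ[ℝ] _)
    ContinuousMultilinearMap.toMultilinearMap_injective

/-- The pullback of forms along a linear map depends smoothly on that map. -/
theorem contDiff_compContinuousLinearMapCLM : ContDiff ℝ ∞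
    (ContinuousAlternatingMap.compContinuousLinearMapCLM :
      (Cn n →L[ℝ] Cn n) → AltForm n k →L[ℝ] AltForm n k) := by
  rw [contDiff_clm_apply_iff]
  intro α
  let J : AltForm n k →L[ℝ] ContinuousMultilinearMap ℝ (fun _ : Fin k => Cn n) ℂ :=
    ContinuousAlternatingMap.toContinuousMultilinearMapCLM ℝ
  obtain ⟨P, hP⟩ := J.toLinearMap.exists_leftInverse_of_injective
    (LinearMap.ker_eq_bot.2 fun α β h =>
      ContinuousAlternatingMap.toContinuousMultilinearMap_injective h)
  have h1 : ∀ β, P (J β) = β := fun β => LinearMap.congr_fun hP β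
  have h2 : (fun g : Cn n →L[ℝ] Cn n =>
      ContinuousAlternatingMap.compContinuousLinearMapCLM g α) = fun g =>
      P.toContinuousLinearMap (ContinuousMultilinearMap.compContinuousLinearMapContinuousMultilinear
        ℝ (fun _ : Fin k => Cn n) (fun _ => Cn n) ℂ (fun _ => g) (J α)) := by
    funext g
    rw [← h1 (ContinuousAlternatingMap.compContinuousLinearMapCLM g α)]
    rfl
  rw [h2]
  refine P.toContinuousLinearMap.contDiff.comp ?_
  refine ContDiff.clm_apply ?_ contDiff_const
  refine ContDiff.comp (ContinuousMultilinearMap.contDiff _) ?_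
  exact contDiff_pi.2 fun _ => contDiff_id

end AltForm

/-! ### Continuity of the basic operators, and forms supported in a chart -/

section Operators

variable {n : ℕ} {X : Type*} [TopologicalSpace X] [ChartedSpace (Cn n) X] {k l : ℕ}

/-- An operator that is multiplication by a smooth coefficient in every chart is continuous. -/
theorem continuous_of_chartRep_eq (P : SmoothForm n X k →ₗ[ℝ] SmoothForm n X l)
    (h : ∀ e ∈ atlas (Cn n) X, ∃ A : Cn n → AltForm n k →L[ℝ] AltForm n l,
      ContDiffOn ℝ ∞ A e.target ∧
      ∀ η, ∀ y ∈ e.target, chartRep (P η) e y = A y (chartRep η e y)) : Continuous P := by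
  refine continuous_of_jet_le P fun j => ?_
  obtain ⟨A, hA, hPA⟩ := h j.chart j.chart_mem
  obtain ⟨C, hC0, hC⟩ := exists_bound_jet_clm_comp hA contDiffOn_id j.chart.open_target
    j.chart.open_target (fun y hy => hy) j.isCompact j.subset j.order
  refine ⟨fun η => C * jetSum k j η, continuous_const.mul (continuous_jetSum j), by simp,
    fun η y hy => ?_⟩
  have h1 : chartRep (P η) j.chart =ᶠ[𝓝 y] fun y => A y (chartRep η j.chart y) := by
    filter_upwards [j.chart.open_target.mem_nhds (j.subset hy)] with z hz using hPA η z hz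
  rw [(h1.iteratedFDeriv ℝ j.order).eq_of_nhds]
  exact (hC _ (η.contDiffOn j.chart_mem) y hy).trans
    (mul_le_mul_of_nonneg_left (sum_jet_le_jetSum η j hy) hC0)

theorem continuous_conjugate : Continuous (conjugate : SmoothForm n X k →ₗ[ℝ] _) :=
  continuous_of_chartRep_eq _ fun _ _ => ⟨fun _ => conjForm, contDiffOn_const, fun _ _ _ => rfl⟩

theorem continuous_component [IsManifold 𝓘(ℂ, Cn n) ω X] (a b : ℕ) :
    Continuous (component a b : SmoothForm n X k →ₗ[ℂ] _) :=
  continuous_of_chartRep_eq ((component a b).restrictScalars ℝ) fun _ he =>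
    ⟨fun _ => typePart a b, contDiffOn_const, fun η _ hy => chartRep_typePart a b η he hy⟩

theorem continuous_d [IsManifold 𝓘(ℂ, Cn n) ω X] :
    Continuous (d : SmoothForm n X k →ₗ[ℂ] SmoothForm n X (k + 1)) := by
  refine continuous_of_jet_le (d.restrictScalars ℝ) fun j => ?_
  obtain ⟨C, hC0, hC⟩ := exists_bound_jet_clm (E := Cn n)
    (F := Cn n →L[ℝ] AltForm n k) (G := AltForm n (k + 1))
    (ContinuousAlternatingMap.alternatizeUncurryFinCLM ℝ (Cn n) ℂ (n := k))
    j.chart.open_target j.isCompact j.subset j.order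
  refine ⟨fun η => C * ∑ i ∈ Finset.range (j.order + 1),
    jetSeminorm k { j with order := i + 1 } η,
    continuous_const.mul (continuous_finsetSum _ fun i _ => continuous_jetSeminorm _), by simp,
    fun η y hy => ?_⟩
  have h1 : chartRep (d η) j.chart =ᶠ[𝓝 y] fun y =>
      ContinuousAlternatingMap.alternatizeUncurryFinCLM ℝ (Cn n) ℂ
        (fderiv ℝ (chartRep η j.chart) y) := by
    filter_upwards [j.chart.open_target.mem_nhds (j.subset hy)] with z hz using
      chartRep_pointwiseExtDeriv η.contDiffOn' j.chart_mem hz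
  change ‖iteratedFDeriv ℝ j.order (chartRep (d η) j.chart) y‖ ≤ _
  rw [(h1.iteratedFDeriv ℝ j.order).eq_of_nhds]
  refine (hC _ ((η.contDiffOn j.chart_mem).fderiv_of_isOpen (m := ∞) j.chart.open_target
    (by simp)) y hy).trans (mul_le_mul_of_nonneg_left (Finset.sum_le_sum fun i _ => ?_) hC0)
  rw [norm_iteratedFDeriv_fderiv]
  exact le_jetSeminorm η { j with order := i + 1 } hy

theorem chartRep_d [IsManifold 𝓘(ℂ, Cn n) ω X] (η : SmoothForm n X k)
    {e : OpenPartialHomeomorph X (Cn n)} (he : e ∈ atlas (Cn n) X) {y : Cn n}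
    (hy : y ∈ e.target) : chartRep (d η) e y = extDeriv (chartRep η e) y :=
  chartRep_pointwiseExtDeriv η.contDiffOn' he hy

/-- A form that vanishes near `x` has exterior derivative zero near `x`. -/
theorem eventually_d_eq_zero [IsManifold 𝓘(ℂ, Cn n) ω X] {η : SmoothForm n X k} {x : X}
    (h : ∀ᶠ z in 𝓝 x, η z = 0) : ∀ᶠ z in 𝓝 x, d η z = 0 := by
  filter_upwards [h.eventually_nhds] with z hz
  rw [d_apply]
  have h1 : chartRep η (chartAt (Cn n) z) =ᶠ[𝓝 (chartAt (Cn n) z z)]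
      (0 : Cn n → AltForm n k) := by
    have h2 : Tendsto (chartAt (Cn n) z).symm (𝓝 (chartAt (Cn n) z z)) (𝓝 z) := by
      have := (chartAt (Cn n) z).continuousAt_symm (mem_chart_target _ z)
      rwa [ContinuousAt, (chartAt (Cn n) z).left_inv (mem_chart_source _ z)] at this
    filter_upwards [h2.eventually hz] with y hy
    rw [chartRep, hy]
    rfl
  rw [h1.extDeriv_eq, extDeriv, fderiv_zero]
  exact map_zero (ContinuousAlternatingMap.alternatizeUncurryFinCLM ℝ (Cn n) ℂ)

/-- Forms are equal at a point if their expressions in some chart are. -/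
theorem eq_of_chartRep_eq [IsManifold 𝓘(ℂ, Cn n) ω X] {η θ : X → AltForm n k}
    {e : OpenPartialHomeomorph X (Cn n)} (he : e ∈ atlas (Cn n) X) {x : X} (hx : x ∈ e.source)
    (h : chartRep η e (e x) = chartRep θ e (e x)) : η x = θ x := by
  have hy := (chartAt (Cn n) x).left_inv (mem_chart_source (Cn n) x)
  have h1 : ((e ∘ (chartAt (Cn n) x).symm) (chartAt (Cn n) x x)) = e x := by simp [hy]
  rw [← chartRep_chartAt η x, ← chartRep_chartAt θ x,
    chartRep_change η (chart_mem_atlas _ x) he (mem_chart_target _ x) (by rwa [hy]),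
    chartRep_change θ (chart_mem_atlas _ x) he (mem_chart_target _ x) (by rwa [hy]), h1, h]

/-- Evaluation of a form at a point on fixed tangent vectors. -/
def evalForm (x : X) (v : Fin k → Cn n) : SmoothForm n X k →L[ℂ] ℂ where
  toFun η := η x v
  map_add' _ _ := rfl
  map_smul' _ _ := rfl
  cont := by
    let T : SmoothForm n X k →ₗ[ℝ] ℂ :=
      { toFun := fun η => η x v
        map_add' := fun _ _ => rfl
        map_smul' := fun c η => by
          rw [SmoothForm.real_smul_apply]
          rfl }
    let j : JetIndex n X := ⟨chartAt (Cn n) x, chart_mem_atlas _ x, 0, {chartAt (Cn n) x x},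
      isCompact_singleton, by simp⟩
    refine continuous_of_norm_le T (fun η => jetSeminorm k j η * ∏ i, ‖v i‖)
      ((continuous_jetSeminorm j).mul continuous_const) (by simp) fun η => ?_
    refine ((η x).le_opNorm v).trans ?_
    gcongr
    have := le_jetSeminorm η j (mem_singleton _)
    rwa [norm_iteratedFDeriv_zero, chartRep_chartAt] at this

@[simp]
theorem evalForm_apply (x : X) (v : Fin k → Cn n) (η : SmoothForm n X k) :
    evalForm x v η = η x v := rfl

end Operators

section SmoothFunctions

/-- Smooth real valued functions on `X`: functions that are smooth in all charts of the atlas. -/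
def SmoothFun (n : ℕ) (X : Type*) [TopologicalSpace X] [ChartedSpace (Cn n) X] : Type _ :=
  {f : X → ℝ // ∀ e ∈ atlas (Cn n) X, ContDiffOn ℝ ∞ (f ∘ e.symm) e.target}

variable {n : ℕ} {X : Type*} [TopologicalSpace X] [ChartedSpace (Cn n) X] {k : ℕ}

instance : CoeFun (SmoothFun n X) fun _ => X → ℝ := ⟨Subtype.val⟩

/-- Multiplication of forms by a smooth function. -/
def mulForm (f : SmoothFun n X) : SmoothForm n X k →ₗ[ℂ] SmoothForm n X k where
  toFun η := ⟨fun x => f x • η x, fun e he => (f.2 e he).smul (η.contDiffOn he)⟩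
  map_add' η θ := by
    ext1 x
    exact smul_add _ _ _
  map_smul' c η := by
    ext1 x
    exact smul_comm (f x) c (η x)

@[simp]
theorem mulForm_apply (f : SmoothFun n X) (η : SmoothForm n X k) (x : X) :
    mulForm f η x = f x • η x := rfl

theorem continuous_mulForm (f : SmoothFun n X) :
    Continuous (mulForm f : SmoothForm n X k →ₗ[ℂ] _) :=
  continuous_of_chartRep_eq ((mulForm f).restrictScalars ℝ) fun e he =>
    ⟨fun y => f (e.symm y) • ContinuousLinearMap.id ℝ _, contDiffOn_smul_clm (f.2 e he) contDiffOn_const,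
      fun _ _ _ => rfl⟩

/-- The function `z` as a form of degree `0`. -/
def funForm (f : X → ℂ) (hf : ∀ e ∈ atlas (Cn n) X, ContDiffOn ℝ ∞ (f ∘ e.symm) e.target) :
    SmoothForm n X 0 :=
  ⟨fun x => ContinuousAlternatingMap.constOfIsEmpty ℝ (Cn n) (Fin 0) (f x), fun e he =>
    (ContinuousAlternatingMap.constOfIsEmptyLIE ℝ (Cn n) ℂ (Fin 0)).contDiff.comp_contDiffOn
      (hf e he)⟩

end SmoothFunctions

section ChartForms

variable {n : ℕ} {X : Type*} [TopologicalSpace X] [ChartedSpace (Cn n) X]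
  [IsManifold 𝓘(ℂ, Cn n) ω X] {k : ℕ}

theorem fderiv_transition_comp {e e' c : OpenPartialHomeomorph X (Cn n)}
    (he : e ∈ atlas (Cn n) X) (he' : e' ∈ atlas (Cn n) X) (hc : c ∈ atlas (Cn n) X) {y : Cn n}
    (hy : y ∈ e'.target) (hye : e'.symm y ∈ e.source) (hyc : e'.symm y ∈ c.source) :
    fderiv ℝ (e ∘ e'.symm) y = (fderiv ℝ (e ∘ c.symm) (c (e'.symm y))).comp
      (fderiv ℝ (c ∘ e'.symm) y) := by
  have h0 : c (e'.symm y) = (c ∘ e'.symm) y := rfl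
  rw [h0, ← fderiv_comp]
  · apply Filter.EventuallyEq.fderiv_eq
    filter_upwards [eventually_symm_mem hy hyc] with z hz
    simp [c.left_inv hz.2]
  · refine (contDiffAt_real_transition hc he (c.map_source hyc) ?_).differentiableAt (by simp)
    simpa [c.left_inv hyc] using hye
  · exact (contDiffAt_real_transition he' hc hy hyc).differentiableAt (by simp)

/-- The form `χ · e^* f` on `X`, for a form `f` on the target of the chart `e` and a function `χ`
with support in the domain of `e`. -/
def chartPull (e : OpenPartialHomeomorph X (Cn n)) (χ : X → ℝ) (f : Cn n → AltForm n k) (x : X) :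
    AltForm n k :=
  χ x • (f (e x)).compContinuousLinearMap
    (fderiv ℝ (e ∘ (chartAt (Cn n) x).symm) (chartAt (Cn n) x x))

omit [IsManifold 𝓘(ℂ, Cn n) ω X] in
theorem chartPull_eq_zero {e : OpenPartialHomeomorph X (Cn n)} {χ : X → ℝ}
    {f : Cn n → AltForm n k} {x : X} (hx : χ x = 0) : chartPull e χ f x = 0 := by
  ext v
  simp [chartPull, hx]

theorem chartRep_chartPull {e e' : OpenPartialHomeomorph X (Cn n)} (he : e ∈ atlas (Cn n) X)
    (he' : e' ∈ atlas (Cn n) X) (χ : X → ℝ) (f : Cn n → AltForm n k) {y : Cn n}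
    (hy : y ∈ e'.target) (hye : e'.symm y ∈ e.source) :
    chartRep (chartPull e χ f) e' y = (χ (e'.symm y) •
      ContinuousAlternatingMap.compContinuousLinearMapCLM (fderiv ℝ (e ∘ e'.symm) y) :
        AltForm n k →L[ℝ] AltForm n k) (f ((e ∘ e'.symm) y)) := by
  rw [fderiv_transition_comp he he' (chart_mem_atlas _ (e'.symm y)) hy hye
    (mem_chart_source _ _)]
  rfl

theorem chartRep_chartPull_self {e : OpenPartialHomeomorph X (Cn n)} (he : e ∈ atlas (Cn n) X)
    (χ : X → ℝ) (f : Cn n → AltForm n k) {y : Cn n} (hy : y ∈ e.target) :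
    chartRep (chartPull e χ f) e y = χ (e.symm y) • f y := by
  rw [chartRep_chartPull he he χ f hy (e.map_target hy)]
  have h1 : fderiv ℝ (e ∘ e.symm) y = ContinuousLinearMap.id ℝ (Cn n) := by
    rw [← fderiv_id (𝕜 := ℝ) (x := y)]
    apply Filter.EventuallyEq.fderiv_eq
    filter_upwards [e.open_target.mem_nhds hy] with z hz
    simp [e.right_inv hz]
  rw [h1, Function.comp_apply, e.right_inv hy]
  rfl

theorem contDiffOn_transition_coeff {e e' : OpenPartialHomeomorph X (Cn n)}
    (he : e ∈ atlas (Cn n) X) (he' : e' ∈ atlas (Cn n) X) (χ : SmoothFun n X) :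
    ContDiffOn ℝ ∞ (fun y => (χ (e'.symm y) •
      ContinuousAlternatingMap.compContinuousLinearMapCLM (fderiv ℝ (e ∘ e'.symm) y) :
        AltForm n k →L[ℝ] AltForm n k)) (e'.target ∩ e'.symm ⁻¹' e.source) := by
  refine contDiffOn_smul_clm ((χ.2 e' he').mono inter_subset_left) ?_
  refine contDiff_compContinuousLinearMapCLM.comp_contDiffOn fun y hy => ?_
  exact ((contDiffAt_real_transition he' he hy.1 hy.2).fderiv_right
    (m := ∞) (by simp)).contDiffWithinAt

theorem contDiffOn_transition {e e' : OpenPartialHomeomorph X (Cn n)}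
    (he : e ∈ atlas (Cn n) X) (he' : e' ∈ atlas (Cn n) X) :
    ContDiffOn ℝ ∞ (e ∘ e'.symm) (e'.target ∩ e'.symm ⁻¹' e.source) := fun _ hy =>
  (contDiffAt_real_transition he' he hy.1 hy.2).contDiffWithinAt

variable {e : OpenPartialHomeomorph X (Cn n)} {Ω : Set (Cn n)} {χ : SmoothFun n X}

/-- `chartPull` as a smooth form, for `χ` with support in `e⁻¹(Ω)` and `f` smooth on `Ω`. -/
def chartForm (he : e ∈ atlas (Cn n) X) (hΩ : IsOpen Ω)
    (hχ : tsupport χ ⊆ e.source ∩ e ⁻¹' Ω) {f : Cn n → AltForm n k} (hf : ContDiffOn ℝ ∞ f Ω) :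
    SmoothForm n X k where
  toFun := chartPull e χ f
  contDiffOn' e' he' y hy := by
    refine ContDiffAt.contDiffWithinAt ?_
    by_cases hx : e'.symm y ∈ tsupport χ
    · have hO : IsOpen (e'.target ∩ e'.symm ⁻¹' (e.source ∩ e ⁻¹' Ω)) :=
        e'.isOpen_inter_preimage_symm (e.isOpen_inter_preimage hΩ)
      have h1 : ContDiffOn ℝ ∞ (fun y => (χ (e'.symm y) •
          ContinuousAlternatingMap.compContinuousLinearMapCLM (fderiv ℝ (e ∘ e'.symm) y) :
            AltForm n k →L[ℝ] AltForm n k) (f ((e ∘ e'.symm) y)))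
          (e'.target ∩ e'.symm ⁻¹' (e.source ∩ e ⁻¹' Ω)) :=
        ContDiffOn.clm_apply ((contDiffOn_transition_coeff he he' χ).mono
          fun z hz => ⟨hz.1, hz.2.1⟩)
          (hf.comp ((contDiffOn_transition he he').mono fun z hz => ⟨hz.1, hz.2.1⟩)
            fun z hz => hz.2.2)
      have h2 := hO.mem_nhds (show y ∈ _ from ⟨hy, hχ hx⟩)
      refine (h1.contDiffAt h2).congr_of_eventuallyEq ?_
      filter_upwards [h2] with z hz
      exact chartRep_chartPull he he' χ f hz.1 hz.2.1
    · have h1 : chartRep (chartPull e χ f) e' =ᶠ[𝓝 y] fun _ => 0 := by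
        have h2 := (e'.continuousAt_symm hy).eventually (notMem_tsupport_iff_eventuallyEq.1 hx)
        filter_upwards [h2] with z hz
        rw [chartRep, chartPull_eq_zero hz]
        rfl
      exact contDiffAt_const.congr_of_eventuallyEq h1

/-- The jets of `chartForm` on a compact set are bounded by the jets of `f` on a compact set. -/
theorem exists_bound_chartForm [T2Space X] (he : e ∈ atlas (Cn n) X) (hΩ : IsOpen Ω)
    (hχ : tsupport χ ⊆ e.source ∩ e ⁻¹' Ω) (j : JetIndex n X) :
    ∃ C : ℝ, 0 ≤ C ∧ ∃ L : Set (Cn n), IsCompact L ∧ L ⊆ Ω ∧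
      ∀ (f : Cn n → AltForm n k) (hf : ContDiffOn ℝ ∞ f Ω) (B : ℝ), 0 ≤ B →
        (∀ z ∈ L, ∑ i ∈ Finset.range (j.order + 1), ‖iteratedFDeriv ℝ i f z‖ ≤ B) →
        ∀ y ∈ j.carrier,
          ‖iteratedFDeriv ℝ j.order (chartRep (chartForm he hΩ hχ hf) j.chart) y‖ ≤ C * B := by
  set e' := j.chart with he'def
  have he' := j.chart_mem
  rw [← he'def] at he'
  have hO : IsOpen (e'.target ∩ e'.symm ⁻¹' (e.source ∩ e ⁻¹' Ω)) :=
    e'.isOpen_inter_preimage_symm (e.isOpen_inter_preimage hΩ)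
  set O := e'.target ∩ e'.symm ⁻¹' (e.source ∩ e ⁻¹' Ω) with hOdef
  set M := j.carrier ∩ e'.symm ⁻¹' tsupport χ with hMdef
  have hM : IsCompact M := j.isCompact.of_isClosed_subset
    ((e'.continuousOn_symm.mono j.subset).preimage_isClosed_of_isClosed j.isCompact.isClosed
      (isClosed_tsupport _)) inter_subset_left
  have hMO : M ⊆ O := fun y hy => ⟨j.subset hy.1, hχ hy.2⟩
  have hτ : ContDiffOn ℝ ∞ (e ∘ e'.symm) O :=
    (contDiffOn_transition he he').mono fun z hz => ⟨hz.1, hz.2.1⟩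
  obtain ⟨C, hC0, hC⟩ := exists_bound_jet_clm_comp
    ((contDiffOn_transition_coeff (k := k) he he' χ).mono fun z hz => ⟨hz.1, hz.2.1⟩)
    hτ hO hΩ (fun z hz => hz.2.2) hM hMO j.order
  refine ⟨C, hC0, (e ∘ e'.symm) '' M, hM.image_of_continuousOn (hτ.continuousOn.mono hMO), ?_,
    fun f hf B hB hfB y hy => ?_⟩
  · rintro _ ⟨y, hy, rfl⟩
    exact (hMO hy).2.2
  · by_cases hx : e'.symm y ∈ tsupport χ
    · have hyM : y ∈ M := ⟨hy, hx⟩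
      have h1 : chartRep (chartForm he hΩ hχ hf) e' =ᶠ[𝓝 y] fun y => (χ (e'.symm y) •
          ContinuousAlternatingMap.compContinuousLinearMapCLM (fderiv ℝ (e ∘ e'.symm) y) :
            AltForm n k →L[ℝ] AltForm n k) (f ((e ∘ e'.symm) y)) := by
        filter_upwards [hO.mem_nhds (hMO hyM)] with z hz
        exact chartRep_chartPull he he' χ f hz.1 hz.2.1
      rw [(h1.iteratedFDeriv ℝ j.order).eq_of_nhds]
      exact (hC f hf y hyM).trans
        (mul_le_mul_of_nonneg_left (hfB _ (mem_image_of_mem _ hyM)) hC0)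
    · rw [jet_eq_zero_of_eventuallyEq (j.subset hy), norm_zero]
      · positivity
      · filter_upwards [notMem_tsupport_iff_eventuallyEq.1 hx] with z hz
        exact chartPull_eq_zero hz

end ChartForms

/-! ### Smoothness of parametric integrals -/

section Parametric

variable {E F : Type} [NormedAddCommGroup E] [NormedSpace ℝ E] [FiniteDimensional ℝ E]
  [NormedAddCommGroup F] [NormedSpace ℝ F] {g : ℝ × E → F} {O : Set (ℝ × E)} {Ω : Set E}

omit [NormedSpace ℝ E] [FiniteDimensional ℝ E] in
theorem continuousOn_slice {G : Type} [TopologicalSpace G] {h : ℝ × E → G}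
    (hh : ContinuousOn h O) (hsub : Icc (0 : ℝ) 1 ×ˢ Ω ⊆ O) {x : E} (hx : x ∈ Ω) :
    ContinuousOn (fun t : ℝ => h (t, x)) (uIcc 0 1) := by
  rw [uIcc_of_le zero_le_one]
  exact hh.comp (by fun_prop) fun t ht => hsub ⟨ht, hx⟩

omit [NormedSpace ℝ E] [FiniteDimensional ℝ E] [NormedSpace ℝ F] in
theorem intervalIntegrable_slice (hg : ContinuousOn g O) (hsub : Icc (0 : ℝ) 1 ×ˢ Ω ⊆ O) {x : E}
    (hx : x ∈ Ω) : IntervalIntegrable (fun t => g (t, x)) MeasureTheory.volume 0 1 :=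
  (continuousOn_slice hg hsub hx).intervalIntegrable

theorem hasFDerivAt_integral_slice (hg : ContDiffOn ℝ ∞ g O) (hO : IsOpen O) (hΩ : IsOpen Ω)
    (hsub : Icc (0 : ℝ) 1 ×ˢ Ω ⊆ O) {x : E} (hx : x ∈ Ω) :
    HasFDerivAt (fun x => ∫ t in (0 : ℝ)..1, g (t, x))
      (∫ t in (0 : ℝ)..1, (fderiv ℝ g (t, x)).comp (ContinuousLinearMap.inr ℝ ℝ E)) x := by
  obtain ⟨ε, hε, hball⟩ := Metric.nhds_basis_closedBall.mem_iff.1 (hΩ.mem_nhds hx)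
  have hd : ContinuousOn (fun p => (fderiv ℝ g p).comp (ContinuousLinearMap.inr ℝ ℝ E)) O :=
    (hg.continuousOn_fderiv_of_isOpen hO (by simp)).clm_comp continuousOn_const
  have hK : IsCompact (Icc (0 : ℝ) 1 ×ˢ Metric.closedBall x ε) :=
    isCompact_Icc.prod (isCompact_closedBall x ε)
  obtain ⟨C, hC⟩ := hK.exists_bound_of_continuousOn
    (hd.mono ((prod_mono_right hball).trans hsub))
  have hI : ∀ {t : ℝ}, t ∈ uIoc (0 : ℝ) 1 → t ∈ Icc (0 : ℝ) 1 := fun ht =>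
    Ioc_subset_Icc_self (by rwa [uIoc_of_le zero_le_one] at ht)
  have hmeas : ∀ {G : Type} [NormedAddCommGroup G] {h : ℝ → G}, ContinuousOn h (uIcc 0 1) →
      MeasureTheory.AEStronglyMeasurable h
        (MeasureTheory.volume.restrict (uIoc (0 : ℝ) 1)) := fun hh =>
    hh.intervalIntegrable.aestronglyMeasurable_restrict_uIoc
  refine intervalIntegral.hasFDerivAt_integral_of_dominated_of_fderiv_le
    (F := fun x t => g (t, x))
    (F' := fun x t => (fderiv ℝ g (t, x)).comp (ContinuousLinearMap.inr ℝ ℝ E))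
    (bound := fun _ => C) (Metric.ball_mem_nhds x hε) ?_ ?_ ?_ ?_ ?_ ?_
  · filter_upwards [hΩ.mem_nhds hx] with z hz
    exact hmeas (continuousOn_slice hg.continuousOn hsub hz)
  · exact (continuousOn_slice hg.continuousOn hsub hx).intervalIntegrable
  · exact hmeas (continuousOn_slice hd hsub hx)
  · exact Eventually.of_forall fun t ht z hz => hC (t, z) ⟨hI ht, Metric.ball_subset_closedBall hz⟩
  · exact intervalIntegrable_const
  · refine Eventually.of_forall fun t ht z hz => ?_
    have h1 : (t, z) ∈ O := hsub ⟨hI ht, hball (Metric.ball_subset_closedBall hz)⟩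
    have h2 : HasFDerivAt g (fderiv ℝ g (t, z)) (t, z) :=
      ((hg.contDiffAt (hO.mem_nhds h1)).differentiableAt (by simp)).hasFDerivAt
    exact h2.comp z (hasFDerivAt_prodMk_right t z)

/-- Integrals of smooth functions over a compact interval depend smoothly on parameters, and their
derivatives are bounded by those of the integrand. -/
theorem contDiffOn_integral_slice (m : ℕ) :
    ∀ {F : Type} [NormedAddCommGroup F] [NormedSpace ℝ F] {g : ℝ × E → F},
    ContDiffOn ℝ ∞ g O → IsOpen O → IsOpen Ω → Icc (0 : ℝ) 1 ×ˢ Ω ⊆ O →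
      ContDiffOn ℝ m (fun x => ∫ t in (0 : ℝ)..1, g (t, x)) Ω ∧
      ∀ x ∈ Ω, ∀ B : ℝ, (∀ t ∈ Icc (0 : ℝ) 1, ‖iteratedFDeriv ℝ m g (t, x)‖ ≤ B) →
        ‖iteratedFDeriv ℝ m (fun x => ∫ t in (0 : ℝ)..1, g (t, x)) x‖ ≤ B := by
  induction m with
  | zero =>
    intro F _ _ g hg hO hΩ hsub
    refine ⟨contDiffOn_zero.2 fun x hx => (hasFDerivAt_integral_slice hg hO hΩ hsub
      hx).continuousAt.continuousWithinAt, fun x hx B hB => ?_⟩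
    rw [norm_iteratedFDeriv_zero]
    have h := intervalIntegral.norm_integral_le_of_norm_le_const (a := (0 : ℝ)) (b := 1)
      (f := fun t => g (t, x)) (C := B) fun t ht => by
        have := hB t (Ioc_subset_Icc_self (by rwa [uIoc_of_le zero_le_one] at ht))
        rwa [norm_iteratedFDeriv_zero] at this
    simpa using h
  | succ m ih =>
    intro F _ _ g hg hO hΩ hsub
    set P : (ℝ × E →L[ℝ] F) →L[ℝ] (E →L[ℝ] F) :=
      (ContinuousLinearMap.compL ℝ E (ℝ × E) F).flip (ContinuousLinearMap.inr ℝ ℝ E) with hP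
    have hPn : ‖P‖ ≤ 1 := by
      refine ContinuousLinearMap.opNorm_le_bound _ zero_le_one fun T => ?_
      rw [one_mul]
      refine (ContinuousLinearMap.opNorm_comp_le T (ContinuousLinearMap.inr ℝ ℝ E)).trans ?_
      exact mul_le_of_le_one_right (norm_nonneg _)
        (ContinuousLinearMap.norm_inr_le_one ℝ ℝ E)
    have hg1 : ContDiffOn ℝ ∞ (fun p => P (fderiv ℝ g p)) O :=
      P.contDiff.comp_contDiffOn (hg.fderiv_of_isOpen hO (by simp))
    obtain ⟨h1, h2⟩ := ih hg1 hO hΩ hsub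
    have hfd : EqOn (fderiv ℝ fun x => ∫ t in (0 : ℝ)..1, g (t, x))
        (fun x => ∫ t in (0 : ℝ)..1, P (fderiv ℝ g (t, x))) Ω := fun x hx =>
      (hasFDerivAt_integral_slice hg hO hΩ hsub hx).fderiv
    refine ⟨?_, fun x hx B hB => ?_⟩
    · have : ((m + 1 : ℕ) : ℕ∞ω) = (m : ℕ∞ω) + 1 := by norm_cast
      rw [this, contDiffOn_succ_iff_fderiv_of_isOpen hΩ]
      refine ⟨fun x hx => (hasFDerivAt_integral_slice hg hO hΩ hsub
        hx).differentiableAt.differentiableWithinAt, fun h => ?_, h1.congr hfd⟩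
      exact absurd h (by simp)
    · rw [← norm_iteratedFDeriv_fderiv,
        ((hfd.eventuallyEq_of_mem (hΩ.mem_nhds hx)).iteratedFDeriv ℝ m).eq_of_nhds]
      refine h2 x hx B fun t ht => ?_
      have hp := hsub (mk_mem_prod ht hx)
      have h3 := P.iteratedFDeriv_comp_left (n := ∞) (f := fderiv ℝ g) (x := (t, x)) (i := m)
        ((hg.contDiffAt (hO.mem_nhds hp)).fderiv_right (by simp)) (by exact_mod_cast le_top)
      change ‖iteratedFDeriv ℝ m (P ∘ fderiv ℝ g) (t, x)‖ ≤ B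
      rw [h3]
      refine (P.norm_compContinuousMultilinearMap_le _).trans ?_
      rw [norm_iteratedFDeriv_fderiv]
      exact (mul_le_of_le_one_left (norm_nonneg _) hPn).trans (hB t ht)

section Generic

variable {E F G : Type*} [NormedAddCommGroup E] [NormedSpace ℝ E]
  [NormedAddCommGroup F] [NormedSpace ℝ F] [NormedAddCommGroup G] [NormedSpace ℝ G]

theorem contDiff_clm_snd_sub (L : E →L[ℝ] G) (x₀ : E) :
    ContDiff ℝ ∞ fun p : ℝ × E => L (p.2 - x₀) :=
  L.contDiff.comp (contDiff_snd.sub contDiff_const)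

theorem hasFDerivAt_contraction (L : E →L[ℝ] F →L[ℝ] G) {f : E → F} {x₀ x : E} {t : ℝ} (k : ℕ)
    {D : E →L[ℝ] F} (hf : HasFDerivAt f D (x₀ + t • (x - x₀))) :
    HasFDerivAt (fun z => (t ^ k • L (z - x₀)) (f (x₀ + t • (z - x₀))))
      (t ^ k • L.flip (f (x₀ + t • (x - x₀))) + t ^ (k + 1) • (L (x - x₀)).comp D) x := by
  have h1 : HasFDerivAt (fun z => t ^ k • L (z - x₀)) (t ^ k • L) x :=
    (L.hasFDerivAt.comp x ((hasFDerivAt_id x).sub_const x₀)).const_smul (t ^ k)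
  have h2 : HasFDerivAt (fun z => x₀ + t • (z - x₀)) (t • ContinuousLinearMap.id ℝ E) x :=
    (((hasFDerivAt_id x).sub_const x₀).const_smul t).const_add x₀
  refine (h1.clm_apply (hf.comp x h2)).congr_fderiv ?_
  ext u
  simp [pow_succ', smul_smul, add_comm]

theorem integral_clm_comp [CompleteSpace F] [CompleteSpace G] (L : F →L[ℝ] G) {h : ℝ → F}
    (hh : IntervalIntegrable h MeasureTheory.volume 0 1) :
    ∫ t in (0 : ℝ)..1, L (h t) = L (∫ t in (0 : ℝ)..1, h t) :=
  L.intervalIntegral_comp_comm hh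

theorem hasDerivAt_pow_smul_contraction {f : E → F} {x₀ v : E} {t : ℝ} (k : ℕ)
    {D : E →L[ℝ] F} (hf : HasFDerivAt f D (x₀ + t • v)) :
    HasDerivAt (fun t : ℝ => t ^ (k + 1) • f (x₀ + t • v))
      (t ^ (k + 1) • D v + ((k + 1 : ℝ) * t ^ k) • f (x₀ + t • v)) t := by
  have h1 : HasDerivAt (fun t : ℝ => x₀ + t • v) v t := by
    simpa using ((hasDerivAt_id t).smul_const v).const_add x₀
  refine ((hasDerivAt_pow (k + 1) t).smul (hf.comp_hasDerivAt t h1)).congr_deriv ?_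
  simp

theorem hasDerivAt_contraction {f : E → F} {x₀ v : E} {t : ℝ}
    {D : E →L[ℝ] F} (hf : HasFDerivAt f D (x₀ + t • v)) :
    HasDerivAt (fun t : ℝ => f (x₀ + t • v)) (D v) t := by
  have h1 : HasDerivAt (fun t : ℝ => x₀ + t • v) v t := by
    simpa using ((hasDerivAt_id t).smul_const v).const_add x₀
  exact hf.comp_hasDerivAt t h1

end Generic

end Parametric

/-! ### The Poincaré lemma with bounds -/

section Cone

variable {n k : ℕ}

/-- Interior multiplication, `v ↦ (α ↦ ι_v α)`. -/
def interior (n k : ℕ) : Cn n →L[ℝ] AltForm n (k + 1) →L[ℝ] AltForm n k :=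
  (ContinuousAlternatingMap.curryLeftLI (𝕜 := ℝ) (E := Cn n) (F := ℂ)
    (n := k)).toContinuousLinearMap.flip

theorem interior_apply (v : Cn n) (α : AltForm n (k + 1)) :
    interior n k v α = α.curryLeft v := rfl

/-- The integrand of the homotopy operator: for `p = (t, x)`, the form
`t^k • ι_{x - x₀} f (x₀ + t (x - x₀))`. -/
def coneIntegrand (x₀ : Cn n) (f : Cn n → AltForm n (k + 1)) (p : ℝ × Cn n) : AltForm n k :=
  (p.1 ^ k • interior n k (p.2 - x₀)) (f (x₀ + p.1 • (p.2 - x₀)))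

/-- The homotopy operator of the Poincaré lemma, for the contraction to the point `x₀`. -/
def cone (x₀ : Cn n) (f : Cn n → AltForm n (k + 1)) (x : Cn n) : AltForm n k :=
  ∫ t in (0 : ℝ)..1, coneIntegrand x₀ f (t, x)

theorem contDiff_coneCoeff (x₀ : Cn n) :
    ContDiff ℝ ∞ fun p : ℝ × Cn n => p.1 ^ k • interior n k (p.2 - x₀) := by
  rw [← contDiffOn_univ]
  refine contDiffOn_smul_clm ?_ ?_
  · exact (contDiff_fst.pow k).contDiffOn
  · exact (contDiff_clm_snd_sub (E := Cn n) (G := AltForm n (k + 1) →L[ℝ] AltForm n k)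
      (interior n k) x₀).contDiffOn

theorem contDiff_contraction (x₀ : Cn n) :
    ContDiff ℝ ∞ fun p : ℝ × Cn n => x₀ + p.1 • (p.2 - x₀) := by
  fun_prop

variable {Ω : Set (Cn n)} {x₀ : Cn n}

theorem prod_subset_contraction (hc : Convex ℝ Ω) (hx₀ : x₀ ∈ Ω) :
    Icc (0 : ℝ) 1 ×ˢ Ω ⊆ (fun p : ℝ × Cn n => x₀ + p.1 • (p.2 - x₀)) ⁻¹' Ω := fun _ hp =>
  hc.add_smul_sub_mem hx₀ hp.2 hp.1

theorem contDiffOn_coneIntegrand {f : Cn n → AltForm n (k + 1)} (hf : ContDiffOn ℝ ∞ f Ω) :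
    ContDiffOn ℝ ∞ (coneIntegrand x₀ f)
      ((fun p : ℝ × Cn n => x₀ + p.1 • (p.2 - x₀)) ⁻¹' Ω) :=
  (contDiff_coneCoeff x₀).contDiffOn.clm_apply
    (hf.comp (contDiff_contraction x₀).contDiffOn fun _ hp => hp)

theorem contDiffOn_cone (hΩ : IsOpen Ω) (hc : Convex ℝ Ω) (hx₀ : x₀ ∈ Ω)
    {f : Cn n → AltForm n (k + 1)} (hf : ContDiffOn ℝ ∞ f Ω) : ContDiffOn ℝ ∞ (cone x₀ f) Ω :=
  contDiffOn_infty.2 fun m => (contDiffOn_integral_slice m (contDiffOn_coneIntegrand hf)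
    (hΩ.preimage (contDiff_contraction x₀).continuous) hΩ (prod_subset_contraction hc hx₀)).1

/-- On compact sets, the derivatives of `cone x₀ f` are bounded by those of `f`. -/
theorem exists_bound_cone (hΩ : IsOpen Ω) (hc : Convex ℝ Ω) (hx₀ : x₀ ∈ Ω) {L : Set (Cn n)}
    (hL : IsCompact L) (hLΩ : L ⊆ Ω) (m : ℕ) :
    ∃ C : ℝ, 0 ≤ C ∧ ∃ L' : Set (Cn n), IsCompact L' ∧ L' ⊆ Ω ∧
      ∀ f : Cn n → AltForm n (k + 1), ContDiffOn ℝ ∞ f Ω → ∀ B : ℝ, 0 ≤ B →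
        (∀ z ∈ L', ∑ i ∈ Finset.range (m + 1), ‖iteratedFDeriv ℝ i f z‖ ≤ B) →
        ∀ y ∈ L, ‖iteratedFDeriv ℝ m (cone x₀ f) y‖ ≤ C * B := by
  have hO : IsOpen ((fun p : ℝ × Cn n => x₀ + p.1 • (p.2 - x₀)) ⁻¹' Ω) :=
    hΩ.preimage (contDiff_contraction x₀).continuous
  have hM : IsCompact (Icc (0 : ℝ) 1 ×ˢ L) := isCompact_Icc.prod hL
  have hMO : Icc (0 : ℝ) 1 ×ˢ L ⊆ (fun p : ℝ × Cn n => x₀ + p.1 • (p.2 - x₀)) ⁻¹' Ω :=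
    (prod_mono_right hLΩ).trans (prod_subset_contraction hc hx₀)
  obtain ⟨C, hC0, hC⟩ := exists_bound_jet_clm_comp (E := ℝ × Cn n) (E' := Cn n)
    (F := AltForm n (k + 1)) (G := AltForm n k)
    (contDiff_coneCoeff (k := k) x₀).contDiffOn (contDiff_contraction x₀).contDiffOn hO hΩ
    (fun _ hp => hp) hM hMO m
  refine ⟨C, hC0, (fun p : ℝ × Cn n => x₀ + p.1 • (p.2 - x₀)) '' (Icc (0 : ℝ) 1 ×ˢ L),
    hM.image (contDiff_contraction x₀).continuous, ?_, fun f hf B hB hfB y hy => ?_⟩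
  · rintro _ ⟨p, hp, rfl⟩
    exact hMO hp
  · refine (contDiffOn_integral_slice m (contDiffOn_coneIntegrand hf) hO hΩ
      (prod_subset_contraction hc hx₀)).2 y (hLΩ hy) _ fun t ht => ?_
    exact (hC f hf (t, y) ⟨ht, hy⟩).trans (mul_le_mul_of_nonneg_left
      (hfB _ (mem_image_of_mem _ (mk_mem_prod ht hy))) hC0)

/-- The pointwise Cartan formula `ι_v d = ∇_v - d ι_v`, for a linear map `D` in place of the
derivative of a form. -/
theorem alternatizeUncurryFin_curryLeft_vecCons (D : Cn n →L[ℝ] AltForm n (k + 1)) (v : Cn n) :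
    (ContinuousAlternatingMap.alternatizeUncurryFin D).curryLeft v =
      D v - ContinuousAlternatingMap.alternatizeUncurryFin ((interior n k v).comp D) := by
  ext w
  simp only [ContinuousAlternatingMap.curryLeft_apply_apply,
    ContinuousAlternatingMap.alternatizeUncurryFin_apply, ContinuousAlternatingMap.sub_apply]
  rw [Fin.sum_univ_succ, sub_eq_add_neg, ← Finset.sum_neg_distrib]
  congr 1
  · simp [Matrix.vecCons]
  · refine Finset.sum_congr rfl fun i _ => ?_
    have h1 : Fin.removeNth i.succ (Matrix.vecCons v w) =
        Matrix.vecCons v (Fin.removeNth i w) := by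
      funext j
      refine Fin.cases ?_ (fun j => ?_) j <;> simp [Fin.removeNth, Matrix.vecCons]
    rw [h1]
    simp [pow_succ, interior_apply]

/-- The homotopy formula of the Poincaré lemma: by the Cartan formula, the integrand of the left-hand
side is the derivative of `t ↦ t ^ (k + 1) • f (x₀ + t • (x - x₀))`. -/
theorem extDeriv_cone_add_cone_extDeriv (hΩ : IsOpen Ω) (hc : Convex ℝ Ω) (hx₀ : x₀ ∈ Ω)
    {f : Cn n → AltForm n (k + 1)} (hf : ContDiffOn ℝ ∞ f Ω) {x : Cn n} (hx : x ∈ Ω) :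
    extDeriv (cone x₀ f) x + cone x₀ (extDeriv f) x = f x := by
  have hO : IsOpen ((fun p : ℝ × Cn n => x₀ + p.1 • (p.2 - x₀)) ⁻¹' Ω) :=
    hΩ.preimage (contDiff_contraction x₀).continuous
  have hsub := prod_subset_contraction hc hx₀
  have hg := contDiffOn_coneIntegrand (x₀ := x₀) hf
  have hI : ∀ {t : ℝ}, t ∈ uIcc (0 : ℝ) 1 → t ∈ Icc (0 : ℝ) 1 := fun ht => by
    rwa [uIcc_of_le zero_le_one] at ht
  have hD : ∀ {t : ℝ}, t ∈ Icc (0 : ℝ) 1 → HasFDerivAt f (fderiv ℝ f (x₀ + t • (x - x₀)))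
      (x₀ + t • (x - x₀)) := fun ht =>
    ((hf.contDiffAt (hΩ.mem_nhds (hsub (mk_mem_prod ht hx)))).differentiableAt
      (by simp)).hasFDerivAt
  set alt := ContinuousAlternatingMap.alternatizeUncurryFinCLM ℝ (Cn n) ℂ (n := k) with halt
  have hdf : ContDiffOn ℝ ∞ (extDeriv f) Ω :=
    (ContinuousAlternatingMap.alternatizeUncurryFinCLM ℝ (Cn n) ℂ).contDiff.comp_contDiffOn
      (hf.fderiv_of_isOpen hΩ (by simp))
  have hc1 : ContinuousOn (fun p => (fderiv ℝ (coneIntegrand x₀ f) p).comp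
      (ContinuousLinearMap.inr ℝ ℝ (Cn n)))
      ((fun p : ℝ × Cn n => x₀ + p.1 • (p.2 - x₀)) ⁻¹' Ω) :=
    (hg.continuousOn_fderiv_of_isOpen hO (by simp)).clm_comp continuousOn_const
  have hi1 := intervalIntegrable_slice (F := Cn n →L[ℝ] AltForm n k) hc1 hsub hx
  have hi2 : IntervalIntegrable (fun t => alt ((fderiv ℝ (coneIntegrand x₀ f) (t, x)).comp
      (ContinuousLinearMap.inr ℝ ℝ (Cn n)))) MeasureTheory.volume 0 1 :=
    intervalIntegrable_slice (F := AltForm n (k + 1)) (alt.continuous.comp_continuousOn hc1) hsub hx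
  have hi3 := intervalIntegrable_slice (F := AltForm n (k + 1))
    (contDiffOn_coneIntegrand (x₀ := x₀) hdf).continuousOn hsub hx
  have h1 : extDeriv (cone x₀ f) x = ∫ t in (0 : ℝ)..1,
      alt ((fderiv ℝ (coneIntegrand x₀ f) (t, x)).comp (ContinuousLinearMap.inr ℝ ℝ (Cn n))) := by
    refine Eq.trans ?_ (integral_clm_comp (F := Cn n →L[ℝ] AltForm n k)
      (G := AltForm n (k + 1)) alt hi1).symm
    rw [← (hasFDerivAt_integral_slice hg hO hΩ hsub hx).fderiv]
    rfl
  have h2 : cone x₀ (extDeriv f) x = ∫ t in (0 : ℝ)..1, coneIntegrand x₀ (extDeriv f) (t, x) := rfl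
  rw [h1, h2, ← intervalIntegral.integral_add hi2 hi3]
  have h3 : ∀ t ∈ uIcc (0 : ℝ) 1, HasDerivAt
      (fun t : ℝ => t ^ (k + 1) • f (x₀ + t • (x - x₀)))
      (alt ((fderiv ℝ (coneIntegrand x₀ f) (t, x)).comp (ContinuousLinearMap.inr ℝ ℝ (Cn n))) +
        coneIntegrand x₀ (extDeriv f) (t, x)) t := fun t ht => by
    refine (hasDerivAt_pow_smul_contraction k (hD (hI ht))).congr_deriv ?_
    have h4 : HasFDerivAt (fun z => coneIntegrand x₀ f (t, z))
        ((fderiv ℝ (coneIntegrand x₀ f) (t, x)).comp (ContinuousLinearMap.inr ℝ ℝ (Cn n))) x :=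
      (((hg.contDiffAt (hO.mem_nhds (hsub (mk_mem_prod (hI ht) hx)))).differentiableAt
        (by simp)).hasFDerivAt).comp x (hasFDerivAt_prodMk_right t x)
    have h5 := hasFDerivAt_contraction (E := Cn n) (F := AltForm n (k + 1)) (G := AltForm n k)
      (interior n k) k (hD (hI ht))
    rw [h4.unique h5]
    have h6 := alternatizeUncurryFin_curryLeft_vecCons
      (fderiv ℝ f (x₀ + t • (x - x₀))) (x - x₀)
    have h7 : coneIntegrand x₀ (extDeriv f) (t, x) = t ^ (k + 1) •
      (fderiv ℝ f (x₀ + t • (x - x₀)) (x - x₀) - alt ((interior n k (x - x₀)).comp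
        (fderiv ℝ f (x₀ + t • (x - x₀))))) := by
      rw [halt]
      exact congrArg (t ^ (k + 1) • ·) h6
    have h8 : alt ((interior n k).flip (f (x₀ + t • (x - x₀)))) =
        ((k : ℝ) + 1) • f (x₀ + t • (x - x₀)) := by
      refine (ContinuousAlternatingMap.alternatizeUncurryFin_curryLeft _).trans ?_
      ext v
      simp
    rw [h7, map_add]
    erw [map_smul alt (t ^ k), map_smul alt (t ^ (k + 1)), h8]
    ext v
    simp
    ring
  rw [intervalIntegral.integral_eq_sub_of_hasDerivAt h3 (hi2.add hi3)]
  ext v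
  simp

theorem cone_extDeriv_zero (hΩ : IsOpen Ω) (hc : Convex ℝ Ω) (hx₀ : x₀ ∈ Ω)
    {f : Cn n → AltForm n 0} (hf : ContDiffOn ℝ ∞ f Ω) {x : Cn n} (hx : x ∈ Ω) :
    cone x₀ (extDeriv f) x = f x - f x₀ := by
  have hsub := prod_subset_contraction hc hx₀
  have hdf : ContDiffOn ℝ ∞ (extDeriv f) Ω :=
    (ContinuousAlternatingMap.alternatizeUncurryFinCLM ℝ (Cn n) ℂ).contDiff.comp_contDiffOn
      (hf.fderiv_of_isOpen hΩ (by simp))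
  have hi3 := intervalIntegrable_slice (F := AltForm n 0)
    (contDiffOn_coneIntegrand (x₀ := x₀) hdf).continuousOn hsub hx
  have h3 : ∀ t ∈ uIcc (0 : ℝ) 1, HasDerivAt (fun t : ℝ => f (x₀ + t • (x - x₀)))
      (coneIntegrand x₀ (extDeriv f) (t, x)) t := fun t ht => by
    have ht' : t ∈ Icc (0 : ℝ) 1 := by rwa [uIcc_of_le zero_le_one] at ht
    refine (hasDerivAt_contraction (((hf.contDiffAt (hΩ.mem_nhds (hsub
      (mk_mem_prod ht' hx)))).differentiableAt (by simp)).hasFDerivAt)).congr_deriv ?_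
    ext v
    simp only [coneIntegrand, pow_zero, one_smul, interior_apply, extDeriv,
      ContinuousAlternatingMap.curryLeft_apply_apply,
      ContinuousAlternatingMap.alternatizeUncurryFin_apply]
    simp
  rw [cone, intervalIntegral.integral_eq_sub_of_hasDerivAt h3 hi3]
  simp

end Cone

/-! ### Cutoff functions and partitions of unity -/

theorem locallyCompactSpace_of_charts (n : ℕ) (X : Type*) [TopologicalSpace X]
    [ChartedSpace (Cn n) X] : LocallyCompactSpace X :=
  ChartedSpace.locallyCompactSpace (Cn n) X

theorem sigmaCompactSpace_of_charts (n : ℕ) (X : Type*) [TopologicalSpace X]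
    [ChartedSpace (Cn n) X] [SecondCountableTopology X] : SigmaCompactSpace X := by
  have := locallyCompactSpace_of_charts n X
  infer_instance

theorem normalSpace_of_charts (n : ℕ) (X : Type*) [TopologicalSpace X]
    [ChartedSpace (Cn n) X] [T2Space X] [SecondCountableTopology X] : NormalSpace X := by
  have := locallyCompactSpace_of_charts n X
  infer_instance

section Cutoff

variable {n : ℕ} {X : Type*} [TopologicalSpace X] [ChartedSpace (Cn n) X]
  [IsManifold 𝓘(ℂ, Cn n) ω X]

variable (n X) in
theorem isManifold_real : IsManifold 𝓘(ℝ, Cn n) ∞ X := by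
  refine isManifold_of_contDiffOn _ _ _ fun e e' he he' y hy => ?_
  have h : y ∈ (e.symm.trans e').source := hy.1
  rw [OpenPartialHomeomorph.trans_source] at h
  exact (contDiffAt_real_transition he he' h.1 h.2).contDiffWithinAt

theorem contDiffOn_of_contMDiff {f : X → ℝ} (hf : ContMDiff 𝓘(ℝ, Cn n) 𝓘(ℝ, ℝ) ∞ f)
    {e : OpenPartialHomeomorph X (Cn n)} (he : e ∈ atlas (Cn n) X) :
    ContDiffOn ℝ ∞ (f ∘ e.symm) e.target := by
  have := isManifold_real n X
  rw [← contMDiffOn_iff_contDiffOn]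
  exact hf.comp_contMDiffOn (contMDiffOn_symm_of_mem_maximalAtlas
    (IsManifold.subset_maximalAtlas he))

variable [T2Space X] [SecondCountableTopology X]

/-- Smooth cutoff functions: `χ = 1` near the closed set `L`, with support in the open set `U`. -/
theorem exists_cutoff {L U : Set X} (hL : IsClosed L) (hU : IsOpen U) (hLU : L ⊆ U) :
    ∃ χ : SmoothFun n X, (∀ x ∈ L, ∀ᶠ z in 𝓝 x, χ z = 1) ∧ tsupport χ ⊆ U ∧
      ∀ x, χ x ∈ Icc (0 : ℝ) 1 := by
  have := isManifold_real n X
  have := sigmaCompactSpace_of_charts n X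
  have := normalSpace_of_charts n X
  obtain ⟨V, hV, hLV, hVU⟩ := normal_exists_closure_subset hL hU hLU
  obtain ⟨f, hf1, hf0, hf⟩ := exists_contMDiffMap_one_nhds_of_subset_interior (n := ⊤)
    𝓘(ℝ, Cn n) hL (hLV.trans hV.interior_eq.ge)
  refine ⟨⟨f, fun e he => contDiffOn_of_contMDiff f.contMDiff he⟩, fun x hx => ?_, ?_, hf⟩
  · exact hf1.filter_mono (nhds_le_nhdsSet hx)
  · refine (closure_mono fun x hx => ?_).trans hVU
    by_contra h
    exact hx (hf0 x h)

/-- Smooth partitions of unity subordinate to an open cover. -/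
theorem exists_partition {ι : Type*} {U : ι → Set X} (hU : ∀ i, IsOpen (U i))
    (hcov : ⋃ i, U i = univ) :
    ∃ ρ : ι → SmoothFun n X, (LocallyFinite fun i => Function.support (ρ i)) ∧
      (∀ i, tsupport (ρ i) ⊆ U i) ∧ ∀ x, ∑ᶠ i, ρ i x = 1 := by
  have := isManifold_real n X
  have := sigmaCompactSpace_of_charts n X
  have := normalSpace_of_charts n X
  obtain ⟨f, hf⟩ := SmoothPartitionOfUnity.exists_isSubordinate 𝓘(ℝ, Cn n) isClosed_univ U hU
    hcov.ge
  exact ⟨fun i => ⟨f i, fun e he => contDiffOn_of_contMDiff (f i).contMDiff he⟩, f.locallyFinite,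
    hf, fun x => f.sum_eq_one (mem_univ x)⟩

end Cutoff

/-! ### Currents with compact support -/

section Functionals

variable {n : ℕ} {X : Type*} [TopologicalSpace X] [ChartedSpace (Cn n) X] {k : ℕ}

/-- The complex currents with compact support: continuous functionals on the complex `k`-forms. -/
abbrev Functional (n : ℕ) (X : Type*) [TopologicalSpace X] [ChartedSpace (Cn n) X] (k : ℕ) :
    Type _ := SmoothForm n X k →L[ℂ] ℂ

/-- The boundary `T ↦ T ∘ d`. -/
def boundary [IsManifold 𝓘(ℂ, Cn n) ω X] : Functional n X (k + 1) →ₗ[ℂ] Functional n X k where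
  toFun T := T.comp ⟨d, continuous_d⟩
  map_add' _ _ := rfl
  map_smul' _ _ := rfl

@[simp]
theorem boundary_apply [IsManifold 𝓘(ℂ, Cn n) ω X] (T : Functional n X (k + 1))
    (η : SmoothForm n X k) : boundary T η = T (d η) := rfl

theorem boundary_boundary [IsManifold 𝓘(ℂ, Cn n) ω X] (T : Functional n X (k + 2)) :
    boundary (boundary T) = 0 := by
  ext η
  simp [d_d]

/-- Multiplication of a current by a smooth function. -/
def mulFunctional (f : SmoothFun n X) : Functional n X k →ₗ[ℂ] Functional n X k where
  toFun T := T.comp ⟨mulForm f, continuous_mulForm f⟩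
  map_add' _ _ := rfl
  map_smul' _ _ := rfl

/-- The currents whose support is a compact subset of `U`. -/
def supportedIn (k : ℕ) (U : Set X) : Submodule ℂ (Functional n X k) where
  carrier := {T | ∃ L : Set X, IsCompact L ∧ L ⊆ U ∧
    ∀ η : SmoothForm n X k, (∀ x ∈ L, ∀ᶠ z in 𝓝 x, η z = 0) → T η = 0}
  zero_mem' := ⟨∅, isCompact_empty, empty_subset _, fun _ _ => rfl⟩
  add_mem' := by
    rintro S T ⟨L, hL, hLU, hS⟩ ⟨M, hM, hMU, hT⟩
    refine ⟨L ∪ M, hL.union hM, union_subset hLU hMU, fun η hη => ?_⟩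
    rw [add_apply, hS η fun x hx => hη x (Or.inl hx),
      hT η fun x hx => hη x (Or.inr hx), add_zero]
  smul_mem' := by
    rintro c T ⟨L, hL, hLU, hT⟩
    refine ⟨L, hL, hLU, fun η hη => ?_⟩
    rw [smul_apply, hT η hη, smul_zero]

theorem supportedIn_mono {U V : Set X} (h : U ⊆ V) :
    supportedIn (n := n) k U ≤ supportedIn k V := by
  rintro T ⟨L, hL, hLU, hT⟩
  exact ⟨L, hL, hLU.trans h, hT⟩

theorem mem_supportedIn_univ (T : Functional n X k) : T ∈ supportedIn k (univ : Set X) := by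
  obtain ⟨L, hL, h⟩ := exists_compact_support (T.restrictScalars ℝ)
  exact ⟨L, hL, subset_univ _, fun η hη => norm_eq_zero.1 (h η hη)⟩

theorem eq_zero_of_mem_supportedIn_empty {T : Functional n X k}
    (hT : T ∈ supportedIn k (∅ : Set X)) : T = 0 := by
  obtain ⟨L, -, hLU, h⟩ := hT
  ext η
  exact h η fun x hx => absurd (hLU hx) (notMem_empty x)

theorem boundary_mem_supportedIn [IsManifold 𝓘(ℂ, Cn n) ω X] {U : Set X}
    {T : Functional n X (k + 1)} (hT : T ∈ supportedIn (k + 1) U) :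
    boundary T ∈ supportedIn k U := by
  obtain ⟨L, hL, hLU, h⟩ := hT
  exact ⟨L, hL, hLU, fun η hη => h _ fun x hx => eventually_d_eq_zero (hη x hx)⟩

theorem mulFunctional_mem_supportedIn {U V : Set X} {f : SmoothFun n X} (hf : tsupport f ⊆ V)
    {T : Functional n X k} (hT : T ∈ supportedIn k U) :
    mulFunctional f T ∈ supportedIn k (V ∩ U) := by
  obtain ⟨L, hL, hLU, h⟩ := hT
  refine ⟨L ∩ tsupport f, hL.inter_right (isClosed_tsupport _),
    fun x hx => ⟨hf hx.2, hLU hx.1⟩, fun η hη => h _ fun x hx => ?_⟩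
  by_cases hxf : x ∈ tsupport f
  · filter_upwards [hη x ⟨hx, hxf⟩] with z hz
    ext v
    simp [hz]
  · filter_upwards [notMem_tsupport_iff_eventuallyEq.1 hxf] with z hz
    rw [mulForm_apply, hz]
    ext v
    simp

theorem evalForm_mem_supportedIn {U : Set X} {x : X} (hx : x ∈ U) (v : Fin k → Cn n) :
    (evalForm x v : Functional n X k) ∈ supportedIn k U :=
  ⟨{x}, isCompact_singleton, singleton_subset_iff.2 hx, fun η hη => by
    simp [(hη x rfl).self_of_nhds]⟩

/-- The constant function `1`, as a form of degree `0`. -/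
def oneForm (n : ℕ) (X : Type*) [TopologicalSpace X] [ChartedSpace (Cn n) X] :
    SmoothForm n X 0 := funForm (fun _ => 1) fun _ _ => contDiffOn_const

@[simp]
theorem oneForm_apply (x : X) (v : Fin 0 → Cn n) : oneForm n X x v = 1 := rfl

end Functionals

/-! ### The Poincaré lemma for currents -/

section LocalPoincare

variable {n : ℕ} {X : Type*} [TopologicalSpace X] [ChartedSpace (Cn n) X]
  [IsManifold 𝓘(ℂ, Cn n) ω X] {k : ℕ} {e : OpenPartialHomeomorph X (Cn n)} {Ω : Set (Cn n)}
  {χ : SmoothFun n X} {x₀ : Cn n}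

theorem intervalIntegrable_coneIntegrand (hc : Convex ℝ Ω) (hx₀ : x₀ ∈ Ω)
    {f : Cn n → AltForm n (k + 1)} (hf : ContDiffOn ℝ ∞ f Ω) {x : Cn n} (hx : x ∈ Ω) :
    IntervalIntegrable (fun t => coneIntegrand x₀ f (t, x)) MeasureTheory.volume 0 1 :=
  intervalIntegrable_slice (F := AltForm n k)
    (contDiffOn_coneIntegrand (x₀ := x₀) hf).continuousOn (prod_subset_contraction hc hx₀) hx

theorem cone_add (hc : Convex ℝ Ω) (hx₀ : x₀ ∈ Ω)
    {f g : Cn n → AltForm n (k + 1)} (hf : ContDiffOn ℝ ∞ f Ω) (hg : ContDiffOn ℝ ∞ g Ω)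
    {x : Cn n} (hx : x ∈ Ω) : cone x₀ (f + g) x = cone x₀ f x + cone x₀ g x := by
  rw [cone, cone, cone, ← intervalIntegral.integral_add
    (intervalIntegrable_coneIntegrand hc hx₀ hf hx)
    (intervalIntegrable_coneIntegrand hc hx₀ hg hx)]
  congr 1
  funext t
  exact map_add _ _ _

theorem cone_smul (c : ℂ) (f : Cn n → AltForm n (k + 1)) (x : Cn n) :
    cone x₀ (c • f) x = c • cone x₀ f x := by
  rw [cone, cone, ← intervalIntegral.integral_smul]
  congr 1
  funext t
  ext v
  exact mul_left_comm (((t ^ k : ℝ) : ℂ)) c _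

/-- The homotopy operator of the Poincaré lemma in a chart, cut off by a function `χ`: the form
`χ · e^* (cone (e⁻¹)^* β)`. -/
def chartCone (k : ℕ) (he : e ∈ atlas (Cn n) X) (hΩ : IsOpen Ω) (hc : Convex ℝ Ω) (hx₀ : x₀ ∈ Ω)
    (hΩe : Ω ⊆ e.target) (hχ : tsupport χ ⊆ e.source ∩ e ⁻¹' Ω) :
    SmoothForm n X (k + 1) →ₗ[ℂ] SmoothForm n X k where
  toFun β := chartForm he hΩ hχ (contDiffOn_cone hΩ hc hx₀ ((β.contDiffOn he).mono hΩe))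
  map_add' β γ := by
    ext1 x
    change chartPull e χ _ x = chartPull e χ _ x + chartPull e χ _ x
    by_cases hx : x ∈ tsupport χ
    · have h := cone_add hc hx₀ ((β.contDiffOn he).mono hΩe) ((γ.contDiffOn he).mono hΩe)
        (hχ hx).2
      simp only [chartPull]
      change χ x • (cone x₀ (chartRep β e + chartRep γ e) (e x)).compContinuousLinearMap _ = _
      rw [h]
      ext v
      exact smul_add (χ x) (_ : ℂ) _
    · have h0 := image_eq_zero_of_notMem_tsupport hx
      rw [chartPull_eq_zero h0, chartPull_eq_zero h0, chartPull_eq_zero h0, add_zero]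
  map_smul' c β := by
    ext1 x
    change chartPull e χ (cone x₀ (c • chartRep β e)) x =
      c • chartPull e χ (cone x₀ (chartRep β e)) x
    simp only [chartPull]
    rw [cone_smul, smul_comm c]
    rfl

/-- A seminorm of `chartCone β` is bounded by the derivatives of `β` on one compact subset of `Ω`. The
compact set does not depend on `β`; this gives continuity, and compact support of the transpose. -/
theorem jetSeminorm_chartCone_le [T2Space X] (he : e ∈ atlas (Cn n) X) (hΩ : IsOpen Ω)
    (hc : Convex ℝ Ω) (hx₀ : x₀ ∈ Ω) (hΩe : Ω ⊆ e.target)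
    (hχ : tsupport χ ⊆ e.source ∩ e ⁻¹' Ω) (j : JetIndex n X) :
    ∃ C : ℝ, ∃ i : JetIndex n X, i.chart = e ∧ i.carrier ⊆ Ω ∧
      ∀ β : SmoothForm n X (k + 1),
        jetSeminorm k j (chartCone k he hΩ hc hx₀ hΩe hχ β) ≤ C * jetSum (k + 1) i β := by
  obtain ⟨C, hC0, L, hL, hLΩ, hCL⟩ := exists_bound_chartForm (k := k) he hΩ hχ j
  choose D hD0 M hM hMΩ hDM using fun m => exists_bound_cone (k := k) hΩ hc hx₀ hL hLΩ m
  let i : JetIndex n X := ⟨e, he, j.order, ⋃ m ∈ Finset.range (j.order + 1), M m,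
    (Finset.range (j.order + 1)).isCompact_biUnion fun m _ => hM m,
    (iUnion₂_subset fun m _ => hMΩ m).trans hΩe⟩
  refine ⟨C * ∑ m ∈ Finset.range (j.order + 1), D m, i, rfl, iUnion₂_subset fun m _ => hMΩ m,
    fun β => ?_⟩
  have hj0 : 0 ≤ jetSum (k + 1) i β := apply_nonneg _ _
  have hD0' : 0 ≤ ∑ m ∈ Finset.range (j.order + 1), D m := Finset.sum_nonneg fun m _ => hD0 m
  have hβ := (β.contDiffOn he).mono hΩe
  refine jetSeminorm_le (mul_nonneg (mul_nonneg hC0 hD0') hj0) ?_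
  rw [mul_assoc]
  refine hCL _ (contDiffOn_cone hΩ hc hx₀ hβ) _ (mul_nonneg hD0' hj0) fun z hz => ?_
  rw [Finset.sum_mul]
  refine Finset.sum_le_sum fun m hm => hDM m _ hβ _ hj0 (fun y hy => ?_) z hz
  have hm' := Finset.mem_range.1 hm
  refine le_trans (Finset.sum_le_sum_of_subset_of_nonneg
    (Finset.range_mono (by omega : m + 1 ≤ j.order + 1)) fun _ _ _ => norm_nonneg _) ?_
  exact sum_jet_le_jetSum β i (mem_biUnion hm hy)

theorem continuous_chartCone [T2Space X] (he : e ∈ atlas (Cn n) X) (hΩ : IsOpen Ω)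
    (hc : Convex ℝ Ω) (hx₀ : x₀ ∈ Ω) (hΩe : Ω ⊆ e.target)
    (hχ : tsupport χ ⊆ e.source ∩ e ⁻¹' Ω) :
    Continuous (chartCone k he hΩ hc hx₀ hΩe hχ) := by
  refine continuous_of_jet_le ((chartCone k he hΩ hc hx₀ hΩe hχ).restrictScalars ℝ) fun j => ?_
  obtain ⟨C, i, -, -, h⟩ := jetSeminorm_chartCone_le (k := k) he hΩ hc hx₀ hΩe hχ j
  exact ⟨fun β => C * jetSum (k + 1) i β, continuous_const.mul (continuous_jetSum i), by simp,
    fun β y hy => (le_jetSeminorm _ j hy).trans (h β)⟩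

/-- The transpose of the cut-off homotopy operator maps currents to currents with compact support
in `e⁻¹(Ω)`. -/
theorem comp_chartCone_mem_supportedIn [T2Space X] (he : e ∈ atlas (Cn n) X) (hΩ : IsOpen Ω)
    (hc : Convex ℝ Ω) (hx₀ : x₀ ∈ Ω) (hΩe : Ω ⊆ e.target)
    (hχ : tsupport χ ⊆ e.source ∩ e ⁻¹' Ω) (T : Functional n X k) :
    T.comp ⟨chartCone k he hΩ hc hx₀ hΩe hχ, continuous_chartCone he hΩ hc hx₀ hΩe hχ⟩ ∈
      supportedIn (k + 1) (e.symm '' Ω) := by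
  obtain ⟨s, C, -, hs⟩ := Seminorm.bound_of_continuous withSeminorms_jet
    ((normSeminorm ℝ ℂ).comp (T.restrictScalars ℝ : SmoothForm n X k →ₗ[ℝ] ℂ)) (by
      exact T.continuous.norm)
  choose D i hie hiΩ hD using jetSeminorm_chartCone_le (k := k) he hΩ hc hx₀ hΩe hχ
  refine ⟨⋃ j ∈ s, e.symm '' (i j).carrier, s.isCompact_biUnion fun j _ => ?_,
    iUnion₂_subset fun j _ => image_mono (hiΩ j), fun β hβ => ?_⟩
  · exact (i j).isCompact.image_of_continuousOn
      (e.continuousOn_symm.mono ((hiΩ j).trans hΩe))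
  · have h1 : s.sup (jetSeminorm k) (chartCone k he hΩ hc hx₀ hΩe hχ β) ≤ 0 := by
      refine Seminorm.finset_sup_apply_le le_rfl fun j hj => (hD j β).trans ?_
      have h2 : jetSum (k + 1) (i j) β = 0 := by
        rw [jetSum_apply]
        refine Finset.sum_eq_zero fun m _ => le_antisymm (jetSeminorm_le le_rfl fun y hy => ?_)
          (apply_nonneg _ _)
        rw [jet_eq_zero_of_eventuallyEq ((i j).subset hy), norm_zero]
        rw [hie j]
        exact hβ _ (mem_biUnion hj (mem_image_of_mem _ hy))
      rw [h2, mul_zero]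
    have h3 : ‖T (chartCone k he hΩ hc hx₀ hΩe hχ β)‖ ≤
        C * s.sup (jetSeminorm k) (chartCone k he hΩ hc hx₀ hΩe hχ β) := hs _
    rw [le_antisymm h1 (apply_nonneg _ _), mul_zero] at h3
    exact norm_le_zero_iff.1 h3

theorem chartRep_chartCone (he : e ∈ atlas (Cn n) X) (hΩ : IsOpen Ω)
    (hc : Convex ℝ Ω) (hx₀ : x₀ ∈ Ω) (hΩe : Ω ⊆ e.target)
    (hχ : tsupport χ ⊆ e.source ∩ e ⁻¹' Ω) (β : SmoothForm n X (k + 1)) {x : X}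
    (hx : x ∈ e.source) (h1 : ∀ᶠ z in 𝓝 x, χ z = 1) :
    chartRep (chartCone k he hΩ hc hx₀ hΩe hχ β) e =ᶠ[𝓝 (e x)] cone x₀ (chartRep β e) := by
  have h2 : Tendsto e.symm (𝓝 (e x)) (𝓝 x) := by
    have := e.continuousAt_symm (e.map_source hx)
    rwa [ContinuousAt, e.left_inv hx] at this
  filter_upwards [h2.eventually h1, e.open_target.mem_nhds (e.map_source hx)] with y hy hye
  refine (chartRep_chartPull_self he χ _ hye).trans ?_
  rw [hy]
  exact one_smul ℝ _

theorem cone_chartRep_d (he : e ∈ atlas (Cn n) X)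
    (hΩe : Ω ⊆ e.target) (β : SmoothForm n X k) (x : Cn n) (hx : x ∈ Ω) (hc : Convex ℝ Ω)
    (hx₀ : x₀ ∈ Ω) : cone x₀ (chartRep (d β) e) x = cone x₀ (extDeriv (chartRep β e)) x := by
  have hsub := prod_subset_contraction hc hx₀
  rw [cone, cone]
  refine intervalIntegral.integral_congr fun t ht => ?_
  rw [uIcc_of_le zero_le_one] at ht
  simp only [coneIntegrand]
  rw [chartRep_d β he (hΩe (hsub (mk_mem_prod ht hx)))]

/-- The local Poincaré lemma for currents with compact support in an open set that is convex in a
chart: a cycle `T` is a boundary. The primitive is the transpose of the cut-off homotopy operator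
applied to `T`; the cutoff is `1` near the support of `T`, where the homotopy formula holds. -/
theorem exists_boundary_eq [T2Space X] [SecondCountableTopology X] {U : Set X} (hU : IsOpen U)
    (he : e ∈ atlas (Cn n) X) (hUe : U ⊆ e.source) (hconv : Convex ℝ (e '' U))
    {T : Functional n X (k + 1)} (hT : T ∈ supportedIn (k + 1) U) (hcyc : boundary T = 0) :
    ∃ R ∈ supportedIn (k + 2) U, boundary R = T := by
  obtain ⟨L, hL, hLU, hTL⟩ := hT
  rcases L.eq_empty_or_nonempty with rfl | ⟨p, hp⟩
  · refine ⟨0, zero_mem _, ?_⟩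
    ext η
    rw [hTL η fun x hx => absurd hx (notMem_empty x)]
    simp
  obtain ⟨χ, hχ1, hχU, -⟩ := exists_cutoff (n := n) hL.isClosed hU hLU
  have hΩ : IsOpen (e '' U) := e.isOpen_image_of_subset_source hU hUe
  have hΩe : e '' U ⊆ e.target := by
    rintro _ ⟨x, hx, rfl⟩
    exact e.map_source (hUe hx)
  have hx₀ : e p ∈ e '' U := mem_image_of_mem _ (hLU hp)
  have hχ : tsupport χ ⊆ e.source ∩ e ⁻¹' (e '' U) := fun x hx =>
    ⟨hUe (hχU hx), mem_image_of_mem _ (hχU hx)⟩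
  refine ⟨_, supportedIn_mono ?_
    (comp_chartCone_mem_supportedIn he hΩ hconv hx₀ hΩe hχ T), ?_⟩
  · rintro _ ⟨_, ⟨x, hx, rfl⟩, rfl⟩
    rwa [e.left_inv (hUe hx)]
  ext η
  rw [boundary_apply]
  change T (chartCone _ he hΩ hconv hx₀ hΩe hχ (d η)) = T η
  have h0 : T (d (chartCone _ he hΩ hconv hx₀ hΩe hχ η)) = 0 :=
    congrArg (fun S : Functional n X k => S _) hcyc
  have h1 := hTL (chartCone _ he hΩ hconv hx₀ hΩe hχ (d η) +
    d (chartCone _ he hΩ hconv hx₀ hΩe hχ η) - η) fun x hx => ?_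
  · rwa [map_sub, map_add, h0, add_zero, sub_eq_zero] at h1
  filter_upwards [(hχ1 x hx).eventually_nhds, hU.mem_nhds (hLU hx)] with z hz hzU
  refine sub_eq_zero.2 (eq_of_chartRep_eq (η := (chartCone _ he hΩ hconv hx₀ hΩe hχ (d η) +
    d (chartCone _ he hΩ hconv hx₀ hΩe hχ η) : SmoothForm n X (k + 1)).toFun) he (hUe hzU) ?_)
  have h2 := chartRep_chartCone he hΩ hconv hx₀ hΩe hχ (d η) (hUe hzU) hz
  have h3 := chartRep_chartCone he hΩ hconv hx₀ hΩe hχ η (hUe hzU) hz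
  have hzΩ : e z ∈ e '' U := mem_image_of_mem _ hzU
  change chartRep (chartCone _ he hΩ hconv hx₀ hΩe hχ (d η)) e (e z) +
    chartRep (d (chartCone _ he hΩ hconv hx₀ hΩe hχ η)) e (e z) = _
  rw [chartRep_d _ he (hΩe hzΩ), h2.eq_of_nhds, h3.extDeriv_eq,
    cone_chartRep_d he hΩe _ _ hzΩ hconv hx₀]
  refine (add_comm _ _).trans ?_
  exact extDeriv_cone_add_cone_extDeriv hΩ hconv hx₀ ((η.contDiffOn he).mono hΩe) hzΩ

/-- The local Poincaré lemma in degree zero: a current of degree zero that vanishes on the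
constants is a boundary. The homotopy formula now reads `cone (d η) = η - η(x₀)`. -/
theorem exists_boundary_eq_of_apply_one [T2Space X] [SecondCountableTopology X] {U : Set X}
    (hU : IsOpen U) (he : e ∈ atlas (Cn n) X) (hUe : U ⊆ e.source) (hconv : Convex ℝ (e '' U))
    {T : Functional n X 0} (hT : T ∈ supportedIn 0 U) (hone : T (oneForm n X) = 0) :
    ∃ R ∈ supportedIn 1 U, boundary R = T := by
  obtain ⟨L, hL, hLU, hTL⟩ := hT
  rcases L.eq_empty_or_nonempty with rfl | ⟨p, hp⟩
  · refine ⟨0, zero_mem _, ?_⟩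
    ext η
    rw [hTL η fun x hx => absurd hx (notMem_empty x)]
    simp
  obtain ⟨χ, hχ1, hχU, -⟩ := exists_cutoff (n := n) hL.isClosed hU hLU
  have hΩ : IsOpen (e '' U) := e.isOpen_image_of_subset_source hU hUe
  have hΩe : e '' U ⊆ e.target := by
    rintro _ ⟨x, hx, rfl⟩
    exact e.map_source (hUe hx)
  have hx₀ : e p ∈ e '' U := mem_image_of_mem _ (hLU hp)
  have hχ : tsupport χ ⊆ e.source ∩ e ⁻¹' (e '' U) := fun x hx =>
    ⟨hUe (hχU hx), mem_image_of_mem _ (hχU hx)⟩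
  refine ⟨_, supportedIn_mono ?_
    (comp_chartCone_mem_supportedIn he hΩ hconv hx₀ hΩe hχ T), ?_⟩
  · rintro _ ⟨_, ⟨x, hx, rfl⟩, rfl⟩
    rwa [e.left_inv (hUe hx)]
  ext η
  rw [boundary_apply]
  change T (chartCone _ he hΩ hconv hx₀ hΩe hχ (d η)) = T η
  set c : ℂ := chartRep η e (e p) 0 with hcdef
  have h1 := hTL (chartCone _ he hΩ hconv hx₀ hΩe hχ (d η) + c • oneForm n X - η)
    fun x hx => ?_
  · rwa [map_sub, map_add, map_smul, hone, smul_zero, add_zero, sub_eq_zero] at h1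
  filter_upwards [(hχ1 x hx).eventually_nhds, hU.mem_nhds (hLU hx)] with z hz hzU
  refine sub_eq_zero.2 (eq_of_chartRep_eq (η := (chartCone _ he hΩ hconv hx₀ hΩe hχ (d η) +
    c • oneForm n X : SmoothForm n X 0).toFun) he (hUe hzU) ?_)
  have h2 := chartRep_chartCone he hΩ hconv hx₀ hΩe hχ (d η) (hUe hzU) hz
  have hzΩ : e z ∈ e '' U := mem_image_of_mem _ hzU
  change chartRep (chartCone _ he hΩ hconv hx₀ hΩe hχ (d η)) e (e z) +
    chartRep (c • oneForm n X : SmoothForm n X 0) e (e z) = _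
  rw [h2.eq_of_nhds, cone_chartRep_d he hΩe _ _ hzΩ hconv hx₀,
    cone_extDeriv_zero hΩ hconv hx₀ ((η.contDiffOn he).mono hΩe) hzΩ]
  ext v
  have hv : v = 0 := Subsingleton.elim _ _
  subst hv
  have h4 : chartRep (c • oneForm n X : SmoothForm n X 0) e (e z) 0 = c := by
    change c * 1 = c
    rw [mul_one]
  rw [ContinuousAlternatingMap.add_apply, h4]
  simp [hcdef]

end LocalPoincare

/-! ### Good covers -/

section LocalConvexity

variable {E : Type*} [NormedAddCommGroup E] [InnerProductSpace ℝ E]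

/-- The strict convexity of the squared norm, with its exact defect. -/
theorem norm_sq_combination {l m : ℝ} (hlm : l + m = 1) (a b : E) :
    ‖l • a + m • b‖ ^ 2 = l * ‖a‖ ^ 2 + m * ‖b‖ ^ 2 - l * m * ‖a - b‖ ^ 2 := by
  have hm : m = 1 - l := by linarith
  subst hm
  rw [norm_add_sq_real, norm_sub_sq_real, norm_smul, norm_smul, mul_pow, mul_pow,
    Real.norm_eq_abs, Real.norm_eq_abs, sq_abs, sq_abs, real_inner_smul_left,
    real_inner_smul_right]
  ring

/-- A map with Lipschitz derivative is affine up to a quadratic error. -/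
theorem norm_combination_sub_le {φ : E → E} {S : Set E} (hS : Convex ℝ S) {K : ℝ} (hK : 0 ≤ K)
    (hd : ∀ z ∈ S, DifferentiableAt ℝ φ z)
    (hL : ∀ z ∈ S, ∀ w ∈ S, ‖fderiv ℝ φ z - fderiv ℝ φ w‖ ≤ K * ‖z - w‖) {p q : E} (hp : p ∈ S)
    (hq : q ∈ S) {l m : ℝ} (hl : 0 ≤ l) (hm : 0 ≤ m) (hlm : l + m = 1) :
    ‖l • φ p + m • φ q - φ (l • p + m • q)‖ ≤ K * (l * m * ‖p - q‖ ^ 2) := by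
  set c := l • p + m • q with hc
  have hcS : c ∈ S := hS hp hq hl hm hlm
  have key : ∀ z ∈ S, ‖φ z - φ c - fderiv ℝ φ c (z - c)‖ ≤ K * ‖z - c‖ ^ 2 := by
    intro z hz
    have h1 := (convex_segment (𝕜 := ℝ) c z).norm_image_sub_le_of_norm_hasFDerivWithin_le'
      (f := φ) (f' := fderiv ℝ φ) (φ := fderiv ℝ φ c) (C := K * ‖z - c‖)
      (fun w hw => (hd w (hS.segment_subset hcS hz hw)).hasFDerivAt.hasFDerivWithinAt)
      (fun w hw => (hL w (hS.segment_subset hcS hz hw) c hcS).trans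
        (mul_le_mul_of_nonneg_left (by
          obtain ⟨a, b, ha, hb, hab, rfl⟩ := hw
          have : a • c + b • z - c = b • (z - c) := by
            have : a = 1 - b := by linarith
            subst this
            module
          rw [this, norm_smul, Real.norm_of_nonneg hb]
          exact mul_le_of_le_one_left (norm_nonneg _) (by linarith)) hK))
      (left_mem_segment ℝ c z) (right_mem_segment ℝ c z)
    rwa [mul_assoc, ← sq] at h1
  have hp' : p - c = m • (p - q) := by
    have : l = 1 - m := by linarith
    subst this
    rw [hc]; module
  have hq' : q - c = -(l • (p - q)) := by
    have : m = 1 - l := by linarith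
    subst this
    rw [hc]; module
  have h2 : l • φ p + m • φ q - φ c = l • (φ p - φ c - fderiv ℝ φ c (p - c)) +
      m • (φ q - φ c - fderiv ℝ φ c (q - c)) := by
    rw [hp', hq', map_neg, map_smul, map_smul]
    have : l = 1 - m := by linarith
    subst this
    module
  rw [h2]
  have h3 := key p hp
  have h4 := key q hq
  rw [hp', norm_smul, Real.norm_of_nonneg hm] at h3
  rw [hq', norm_neg, norm_smul, Real.norm_of_nonneg hl] at h4
  rw [← hp'] at h3
  rw [← hq'] at h4
  calc _ ≤ l * ‖φ p - φ c - fderiv ℝ φ c (p - c)‖ + m * ‖φ q - φ c - fderiv ℝ φ c (q - c)‖ := by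
        refine (norm_add_le _ _).trans_eq ?_
        rw [norm_smul, norm_smul, Real.norm_of_nonneg hl, Real.norm_of_nonneg hm]
    _ ≤ l * (K * (m * ‖p - q‖) ^ 2) + m * (K * (l * ‖p - q‖) ^ 2) := by gcongr
    _ = K * (l * m * (l + m) * ‖p - q‖ ^ 2) := by ring
    _ = _ := by rw [hlm, mul_one]

/-- The images of small balls under a diffeomorphism `τ` are convex: on a segment in the image, the
inverse `τ⁻¹` differs from an affine map by at most `l * m * (κ * ‖a - b‖ ^ 2)`, which is absorbed by
the term `l * m * ‖a - b‖ ^ 2` that the strict convexity of the squared norm provides. -/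
theorem eventually_convex_image_ball (τ : OpenPartialHomeomorph E E) {y : E} (hy : y ∈ τ.source)
    (h1 : ContDiffAt ℝ ∞ τ y) (h2 : ContDiffAt ℝ ∞ τ.symm (τ y)) :
    ∀ᶠ r in 𝓝[>] (0 : ℝ), Convex ℝ (τ '' Metric.ball y r) := by
  obtain ⟨K, N, hN, hK⟩ := ((h2.fderiv_right (m := 1) (by norm_cast)).exists_lipschitzOnWith)
  obtain ⟨C, M, hM, hC⟩ := (h1.of_le (m := 1) (by norm_cast)).exists_lipschitzOnWith
  have hdiff : ∀ᶠ z in 𝓝 (τ y), DifferentiableAt ℝ τ.symm z :=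
    ((h2.of_le (m := 1) (by norm_cast)).eventually (by simp)).mono
      fun z hz => hz.differentiableAt (by simp)
  obtain ⟨s, hs, hsub⟩ := Metric.mem_nhds_iff.1 (inter_mem (inter_mem hN hdiff)
    (τ.open_target.mem_nhds (τ.map_source hy)))
  have hcont : ∀ᶠ x in 𝓝 y, τ x ∈ Metric.ball (τ y) s :=
    (τ.continuousAt hy).eventually (Metric.ball_mem_nhds _ hs)
  obtain ⟨t, ht, htsub⟩ := Metric.mem_nhds_iff.1 (inter_mem (inter_mem hM hcont)
    (τ.open_source.mem_nhds hy))
  set κ : ℝ := K * C ^ 2 with hκ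
  have hκ0 : 0 ≤ κ := by positivity
  -- this radius makes `r * κ ≤ 1 / 4`, so that the error is at most three quarters of the gain
  have hr0 : 0 < min t (1 / (4 * (κ + 1))) := lt_min ht (by positivity)
  filter_upwards [Ioo_mem_nhdsGT hr0] with r hr
  have hrt : r < t := hr.2.trans_le (min_le_left _ _)
  have hrκ : r * κ ≤ 1 / 4 := by
    have h3 : r * (4 * (κ + 1)) ≤ 1 := by
      have := hr.2.le.trans (min_le_right _ _)
      rwa [le_div_iff₀ (by positivity)] at this
    nlinarith [hr.1]
  have hball : Metric.ball y r ⊆ Metric.ball y t := Metric.ball_subset_ball hrt.le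
  rintro _ ⟨a, ha, rfl⟩ _ ⟨b, hb, rfl⟩ l m hl hm hlm
  have ha' := htsub (hball ha)
  have hb' := htsub (hball hb)
  have hcS : l • τ a + m • τ b ∈ Metric.ball (τ y) s :=
    convex_ball (τ y) s ha'.1.2 hb'.1.2 hl hm hlm
  refine ⟨τ.symm (l • τ a + m • τ b), ?_, τ.right_inv (hsub hcS).2⟩
  have h3 := norm_combination_sub_le (φ := τ.symm) (convex_ball (τ y) s) K.2
    (fun z hz => (hsub hz).1.2) (fun z hz w hw => by
      simpa [dist_eq_norm] using hK.dist_le_mul z (hsub hz).1.1 w (hsub hw).1.1)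
    ha'.1.2 hb'.1.2 hl hm hlm
  rw [τ.left_inv ha'.2, τ.left_inv hb'.2] at h3
  have h4 : ‖τ a - τ b‖ ≤ C * ‖a - b‖ := by
    simpa [dist_eq_norm] using hC.dist_le_mul a ha'.1.1 b hb'.1.1
  set δ := ‖a - b‖ with hδ
  have hδ0 : 0 ≤ δ := norm_nonneg _
  rw [Metric.mem_ball, dist_eq_norm] at ha hb ⊢
  have hδr : δ ≤ 2 * r := by
    have : a - b = (a - y) - (b - y) := by abel
    rw [hδ, this]
    exact (norm_sub_le _ _).trans (by linarith)
  have h5 : ‖l • a + m • b - τ.symm (l • τ a + m • τ b)‖ ≤ l * m * (κ * δ ^ 2) := by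
    refine h3.trans ?_
    have h6 : ‖τ a - τ b‖ ^ 2 ≤ (C * δ) ^ 2 := pow_le_pow_left₀ (norm_nonneg _) h4 2
    calc (K : ℝ) * (l * m * ‖τ a - τ b‖ ^ 2) ≤ K * (l * m * (C * δ) ^ 2) := by gcongr
      _ = _ := by rw [hκ]; ring
  have h7 := norm_sq_combination hlm (a - y) (b - y)
  have e1 : l • (a - y) + m • (b - y) = l • a + m • b - y := by
    have : m = 1 - l := by linarith
    subst this
    module
  have e2 : a - y - (b - y) = a - b := by abel
  rw [e1, e2, ← hδ] at h7
  set D := ‖l • a + m • b - y‖ with hD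
  have h8 : ‖τ.symm (l • τ a + m • τ b) - y‖ ≤ D + l * m * (κ * δ ^ 2) := by
    have : τ.symm (l • τ a + m • τ b) - y = (l • a + m • b - y) -
      (l • a + m • b - τ.symm (l • τ a + m • τ b)) := by abel
    rw [this]
    exact (norm_sub_le _ _).trans (by linarith)
  have hD0 : 0 ≤ D := norm_nonneg _
  have hlm0 : 0 ≤ l * m := mul_nonneg hl hm
  have hlm1 : l * m ≤ 1 := by nlinarith
  have hr2 : l * ‖a - y‖ ^ 2 + m * ‖b - y‖ ^ 2 < r ^ 2 := by
    have ha2 : ‖a - y‖ ^ 2 < r ^ 2 := by gcongr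
    have hb2 : ‖b - y‖ ^ 2 < r ^ 2 := by gcongr
    have hm' : m = 1 - l := by linarith
    subst hm'
    rcases hl.eq_or_lt with rfl | hl'
    · simpa using hb2
    · nlinarith
  have hDr : D ≤ r := by
    refine le_of_sq_le_sq ?_ hr.1.le
    nlinarith [mul_nonneg hlm0 (sq_nonneg δ)]
  have hX : 0 ≤ l * m * δ ^ 2 := mul_nonneg hlm0 (sq_nonneg δ)
  refine lt_of_le_of_lt h8 (lt_of_pow_lt_pow_left₀ 2 hr.1.le ?_)
  have hrκ0 : 0 ≤ r * κ := mul_nonneg hr.1.le hκ0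
  have h9 : κ * δ ^ 2 * κ ≤ 1 / 4 := by
    have : δ ^ 2 ≤ (2 * r) ^ 2 := pow_le_pow_left₀ hδ0 hδr 2
    calc κ * δ ^ 2 * κ ≤ κ * (2 * r) ^ 2 * κ := by gcongr
      _ = 4 * (r * κ) * (r * κ) := by ring
      _ ≤ 4 * (1 / 4) * (1 / 4) := by gcongr
      _ = 1 / 4 := by norm_num
  have h10 : D * κ ≤ 1 / 4 := (mul_le_mul_of_nonneg_right hDr hκ0).trans hrκ
  calc (D + l * m * (κ * δ ^ 2)) ^ 2
      = D ^ 2 + (l * m * δ ^ 2) * (2 * (D * κ) + (l * m) * (κ * δ ^ 2 * κ)) := by ring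
    _ ≤ D ^ 2 + (l * m * δ ^ 2) * (2 * (1 / 4) + 1 * (1 / 4)) := by gcongr
    _ < r ^ 2 := by nlinarith

end LocalConvexity

section GoodCover

variable {n : ℕ} {X : Type*} [TopologicalSpace X] [ChartedSpace (Cn n) X]

/-- The intersection of the members of a cover that are listed in `J`. -/
def listInter {ι : Type*} (U : ι → Set X) (J : List ι) : Set X := {x | ∀ i ∈ J, x ∈ U i}

/-- An open cover is good if all nonempty finite intersections of its members are convex in some
chart. -/
structure IsGoodCover {ι : Type*} (n : ℕ) {X : Type*} [TopologicalSpace X]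
    [ChartedSpace (Cn n) X] (U : ι → Set X) : Prop where
  isOpen : ∀ i, IsOpen (U i)
  iUnion_eq : ⋃ i, U i = univ
  exists_chart : ∀ J : List ι, J ≠ [] → ∃ e ∈ atlas (Cn n) X,
    listInter U J ⊆ e.source ∧ Convex ℝ (e '' listInter U J)

variable (n X) in
/-- Complex manifolds have good covers. Start from a locally finite cover by charts `V b`, shrunk to
`W b`; small balls around `x` in a chart are contained in some `W a`, avoid the `W b` with
`x ∉ closure (W b)`, and are convex in the finitely many other charts. If balls around
`x₁, …, x_m` have a common point, and the first one is contained in `W a`, then all of them meet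
`W a`, hence are convex in the chart `V a`. -/
theorem exists_isGoodCover [T2Space X] [SecondCountableTopology X] [IsManifold 𝓘(ℂ, Cn n) ω X] :
    ∃ U : X → Set X, IsGoodCover n U := by
  have := locallyCompactSpace_of_charts n X
  have := sigmaCompactSpace_of_charts n X
  have := normalSpace_of_charts n X
  obtain ⟨V, hVo, hVc, hVf, hVs⟩ := precise_refinement (fun x : X => (chartAt (Cn n) x).source)
    (fun x => (chartAt (Cn n) x).open_source)
    (iUnion_eq_univ_iff.2 fun x => ⟨x, mem_chart_source _ x⟩)
  obtain ⟨W, hWc, hWo, hWV⟩ := exists_iUnion_eq_closure_subset hVo hVf.point_finite hVc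
  have hWf : LocallyFinite fun b => closure (W b) := hVf.subset hWV
  have key : ∀ x : X, ∃ U : Set X, IsOpen U ∧ x ∈ U ∧ (∃ a, U ⊆ W a) ∧
      ∀ b, (U ∩ W b).Nonempty → U ⊆ V b ∧ Convex ℝ (chartAt (Cn n) b '' U) := by
    intro x
    obtain ⟨a, ha⟩ := iUnion_eq_univ_iff.1 hWc x
    set e := chartAt (Cn n) a with he
    have hea : e ∈ atlas (Cn n) X := chart_mem_atlas _ _
    have hxe : x ∈ e.source := hVs a (hWV a (subset_closure ha))
    have hfin : {b | x ∈ closure (W b)}.Finite := hWf.point_finite x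
    have hN : (⋂ (b) (_ : x ∉ closure (W b)), (closure (W b))ᶜ) ∩ W a ∩
        (⋂ b ∈ {b | x ∈ closure (W b)}, V b) ∈ 𝓝 x :=
      inter_mem (inter_mem (hWf.iInter_compl_mem_nhds (fun _ => isClosed_closure) x)
        ((hWo a).mem_nhds ha)) ((biInter_mem hfin).2 fun b hb => (hVo b).mem_nhds (hWV b hb))
    set N := (⋂ (b) (_ : x ∉ closure (W b)), (closure (W b))ᶜ) ∩ W a ∩
        (⋂ b ∈ {b | x ∈ closure (W b)}, V b)
    have htend : Tendsto e.symm (𝓝 (e x)) (𝓝 x) := by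
      have := e.continuousAt_symm (e.map_source hxe)
      rwa [ContinuousAt, e.left_inv hxe] at this
    have h1 : ∀ᶠ r in 𝓝[>] (0 : ℝ), Metric.ball (e x) r ⊆ e.target ∩ e.symm ⁻¹' N := by
      obtain ⟨t, ht, hsub⟩ := Metric.mem_nhds_iff.1
        (inter_mem (e.open_target.mem_nhds (e.map_source hxe)) (htend hN))
      filter_upwards [Ioo_mem_nhdsGT ht] with r hr
      exact (Metric.ball_subset_ball hr.2.le).trans hsub
    have h2 : ∀ᶠ r in 𝓝[>] (0 : ℝ), ∀ b ∈ {b | x ∈ closure (W b)},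
        Convex ℝ ((e.symm.trans (chartAt (Cn n) b)) '' Metric.ball (e x) r) := by
      refine (eventually_all_finite hfin).2 fun b hb => ?_
      have hxb : x ∈ (chartAt (Cn n) b).source := hVs b (hWV b hb)
      have hca : chartAt (Cn n) b ∈ atlas (Cn n) X := chart_mem_atlas _ _
      refine eventually_convex_image_ball _ ?_ ?_ ?_
      · simp [e.map_source hxe, e.left_inv hxe, hxb]
      · exact contDiffAt_real_transition hea hca (e.map_source hxe) (by rwa [e.left_inv hxe])
      · have h3 : (e.symm.trans (chartAt (Cn n) b)) (e x) = chartAt (Cn n) b x := by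
          simp [e.left_inv hxe]
        rw [h3]
        exact contDiffAt_real_transition hca hea ((chartAt (Cn n) b).map_source hxb)
          (by rwa [(chartAt (Cn n) b).left_inv hxb])
    obtain ⟨r, ⟨hr1, hr2⟩, hr0⟩ := ((h1.and h2).and self_mem_nhdsWithin).exists
    have hsub : e.symm '' Metric.ball (e x) r ⊆ N := by
      rintro _ ⟨y, hy, rfl⟩
      exact (hr1 hy).2
    refine ⟨e.symm '' Metric.ball (e x) r, e.symm.isOpen_image_of_subset_source
      Metric.isOpen_ball fun y hy => (hr1 hy).1, ⟨e x, Metric.mem_ball_self hr0, e.left_inv hxe⟩,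
      ⟨a, fun z hz => (hsub hz).1.2⟩, ?_⟩
    rintro b ⟨z, hz, hzb⟩
    have hb : x ∈ closure (W b) := by
      by_contra hb
      exact mem_iInter₂.1 (hsub hz).1.1 b hb (subset_closure hzb)
    refine ⟨fun w hw => mem_iInter₂.1 (hsub hw).2 b hb, ?_⟩
    have h3 := hr2 b hb
    rwa [OpenPartialHomeomorph.coe_trans, image_comp] at h3
  choose U hUo hxU hUa hUb using key
  refine ⟨U, hUo, iUnion_eq_univ_iff.2 fun x => ⟨x, hxU x⟩, fun J hJ => ?_⟩
  obtain ⟨i, J, rfl⟩ := List.exists_cons_of_ne_nil hJ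
  rcases (listInter U (i :: J)).eq_empty_or_nonempty with h | ⟨z, hz⟩
  · exact ⟨chartAt (Cn n) i, chart_mem_atlas _ _, by simp [h], by simp [h, convex_empty]⟩
  obtain ⟨a, ha⟩ := hUa i
  have hza : z ∈ W a := ha (hz i (by simp))
  have h1 : ∀ j ∈ i :: J, U j ⊆ V a ∧ Convex ℝ (chartAt (Cn n) a '' U j) := fun j hj =>
    hUb j a ⟨z, hz j hj, hza⟩
  have hsub : ∀ j ∈ i :: J, U j ⊆ (chartAt (Cn n) a).source := fun j hj =>
    (h1 j hj).1.trans (hVs a)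
  refine ⟨chartAt (Cn n) a, chart_mem_atlas _ _,
    fun w hw => hsub i (by simp) (hw i (by simp)), ?_⟩
  have h2 : chartAt (Cn n) a '' listInter U (i :: J) =
      ⋂ j ∈ i :: J, chartAt (Cn n) a '' U j := by
    ext y
    simp only [mem_image, mem_iInter, listInter, mem_ofPred_eq]
    constructor
    · rintro ⟨w, hw, rfl⟩ j hj
      exact ⟨w, hw j hj, rfl⟩
    · intro h
      obtain ⟨w, hw, rfl⟩ := h i (by simp)
      refine ⟨w, fun j hj => ?_, rfl⟩
      obtain ⟨w', hw', heq⟩ := h j hj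
      rwa [← (chartAt (Cn n) a).injOn (hsub j hj hw') (hsub i (by simp) hw) heq]
  rw [h2]
  exact convex_iInter₂ fun j hj => (h1 j hj).2

end GoodCover

/-! ### Čech chains with coefficients in a complex -/

section CechDifferential

variable {ι M N : Type*} [AddCommGroup M] [Module ℂ M] [AddCommGroup N] [Module ℂ N]

/-- Prepending an index to all simplices of a chain. -/
def consChain (j : ι) : (List ι →₀ M) →ₗ[ℂ] (List ι →₀ M) := Finsupp.lmapDomain M ℂ (List.cons j)

@[simp]
theorem consChain_single (j : ι) (I : List ι) (v : M) :
    consChain j (Finsupp.single I v) = Finsupp.single (j :: I) v := by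
  simp [consChain]

/-- Coefficientwise application of a linear map to a chain. -/
def mapChain (f : M →ₗ[ℂ] N) : (List ι →₀ M) →ₗ[ℂ] (List ι →₀ N) := Finsupp.mapRange.linearMap f

@[simp]
theorem mapChain_apply (f : M →ₗ[ℂ] N) (x : List ι →₀ M) (I : List ι) :
    mapChain f x I = f (x I) := by
  simp [mapChain]

@[simp]
theorem mapChain_single (f : M →ₗ[ℂ] N) (I : List ι) (v : M) :
    mapChain f (Finsupp.single I v) = Finsupp.single I (f v) := by
  simp [mapChain]

theorem mapChain_consChain (f : M →ₗ[ℂ] N) (j : ι) (x : List ι →₀ M) :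
    mapChain f (consChain j x) = consChain j (mapChain f x) := by
  induction x using Finsupp.induction_linear with
  | zero => simp
  | add x y hx hy => simp [hx, hy]
  | single I v => simp

/-- The Čech differential of the simplex `I` with a given coefficient. -/
def cechSingle (M : Type*) [AddCommGroup M] [Module ℂ M] : List ι → M →ₗ[ℂ] (List ι →₀ M)
  | [] => 0
  | j :: I => Finsupp.lsingle I - consChain j ∘ₗ cechSingle M I

/-- The (augmented, unordered) Čech differential: the alternating sum of the faces of a simplex. The
simplices are lists of indices; the empty list corresponds to the augmentation. -/
def cech : (List ι →₀ M) →ₗ[ℂ] (List ι →₀ M) := Finsupp.lsum ℂ (cechSingle M)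

theorem cech_single (I : List ι) (v : M) : cech (Finsupp.single I v) = cechSingle M I v := by
  simp [cech]

theorem cech_consChain (j : ι) (x : List ι →₀ M) :
    cech (consChain j x) = x - consChain j (cech x) := by
  induction x using Finsupp.induction_linear with
  | zero => simp
  | add x y hx hy => simp only [map_add, hx, hy]; abel
  | single I v => simp [cech_single, cechSingle]

theorem cech_cech (x : List ι →₀ M) : cech (cech x) = 0 := by
  induction x using Finsupp.induction_linear with
  | zero => simp
  | add x y hx hy => simp [hx, hy]
  | single I v =>
    induction I with
    | nil => simp [cech_single, cechSingle]
    | cons j I ih => rw [← consChain_single, cech_consChain, map_sub, cech_consChain, ih]; simp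

theorem cech_mapChain (f : M →ₗ[ℂ] N) (x : List ι →₀ M) :
    cech (mapChain f x) = mapChain f (cech x) := by
  induction x using Finsupp.induction_linear with
  | zero => simp
  | add x y hx hy => simp [hx, hy]
  | single I v =>
    induction I with
    | nil => simp [cech_single, cechSingle]
    | cons j I ih => rw [← consChain_single, mapChain_consChain, cech_consChain, cech_consChain,
        map_sub, mapChain_consChain, ih]

theorem cechSingle_mem_span (I : List ι) (v : M) : cechSingle M I v ∈ Submodule.span ℂ
    {x | ∃ J : List ι, J ⊆ I ∧ J.length + 1 = I.length ∧ x = Finsupp.single J v} := by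
  induction I with
  | nil => simp [cechSingle]
  | cons j I ih =>
    refine Submodule.sub_mem _ (Submodule.subset_span ⟨I, by simp, by simp, rfl⟩) ?_
    refine (Submodule.map_span_le (consChain j) _ _).2 ?_ (Submodule.mem_map_of_mem ih)
    rintro _ ⟨J, hJ, hlen, rfl⟩
    exact Submodule.subset_span ⟨j :: J, List.cons_subset_cons j hJ, by simp [hlen], by simp⟩

variable {m : ι → M →ₗ[ℂ] M}

theorem finite_support_mapChain (hfin : ∀ v, (Function.support fun j => m j v).Finite)
    (x : List ι →₀ M) : (Function.support fun j => mapChain (m j) x).Finite := by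
  refine (x.support.finite_toSet.biUnion fun I _ => hfin (x I)).subset fun j hj => ?_
  by_contra h
  refine hj ?_
  ext I
  by_cases hI : I ∈ x.support
  · by_contra h2
    exact h (mem_biUnion hI (by simpa using h2))
  · simp [Finsupp.notMem_support_iff.1 hI]

theorem finite_support_consChain (hfin : ∀ v, (Function.support fun j => m j v).Finite)
    (x : List ι →₀ M) :
    (Function.support fun j => consChain j (mapChain (m j) x)).Finite :=
  (finite_support_mapChain hfin x).subset fun j hj h => hj (by
    change consChain j (mapChain (m j) x) = 0
    rw [show mapChain (m j) x = 0 from h, map_zero])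

/-- The contracting homotopy of the Čech differential defined by a partition of unity. -/
def contraction (m : ι → M →ₗ[ℂ] M) (hfin : ∀ v, (Function.support fun j => m j v).Finite) :
    (List ι →₀ M) →ₗ[ℂ] (List ι →₀ M) where
  toFun x := ∑ᶠ j, consChain j (mapChain (m j) x)
  map_add' x y := by
    rw [← finsum_add_distrib (finite_support_consChain hfin x) (finite_support_consChain hfin y)]
    simp
  map_smul' c x := by
    rw [RingHom.id_apply, smul_finsum' c (finite_support_consChain hfin x)]
    simp

variable {hfin : ∀ v, (Function.support fun j => m j v).Finite}

theorem contraction_apply (x : List ι →₀ M) :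
    contraction m hfin x = ∑ᶠ j, consChain j (mapChain (m j) x) := rfl

theorem contraction_single (I : List ι) (v : M) :
    contraction m hfin (Finsupp.single I v) = ∑ᶠ j, Finsupp.single (j :: I) (m j v) := by
  simp [contraction_apply]

theorem cech_contraction (hsum : ∀ v, ∑ᶠ j, m j v = v) (x : List ι →₀ M) :
    cech (contraction m hfin x) = x - contraction m hfin (cech x) := by
  have h1 : ∑ᶠ j, mapChain (m j) x = x := by
    ext I
    have := (Finsupp.lapply I : (List ι →₀ M) →ₗ[ℂ] M).toAddMonoidHom.map_finsum
      (finite_support_mapChain hfin x)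
    refine Eq.trans this ?_
    simpa using hsum (x I)
  rw [contraction_apply, contraction_apply]
  have h2 := (cech (ι := ι) (M := M)).toAddMonoidHom.map_finsum (finite_support_consChain hfin x)
  refine Eq.trans h2 ?_
  simp only [LinearMap.toAddMonoidHom_coe, cech_consChain, cech_mapChain]
  rw [finsum_sub_distrib (finite_support_mapChain hfin x)
    (finite_support_consChain hfin (cech x)), h1]

end CechDifferential

/-! ### Cycles that are orthogonal to the closed forms are boundaries -/

section CechComplex

variable {ι : Type*} {S : ℕ → Type*} [∀ a, AddCommGroup (S a)] [∀ a, Module ℂ (S a)]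

/-- The properties of the complexes of currents with compact support in the finite intersections of
the members of a good cover, with a partition of unity, that the comparison of de Rham and Čech
homology is based on: `S a` is the space of currents of degree `a`, `sub a I` consists of the
currents with support in the intersection of the sets listed in `I`, the predicate `ne I` says
that this intersection is nonempty, `bd` is the boundary operator, `ε` the evaluation on the
constant `1` and `m a j` the multiplication by the `j`-th function of the partition. -/
structure IsCechComplex (bd : ∀ a, S (a + 1) →ₗ[ℂ] S a) (ε : S 0 →ₗ[ℂ] ℂ)
    (m : ∀ a, ι → S a →ₗ[ℂ] S a) (sub : ∀ a, List ι → Submodule ℂ (S a)) (ne : List ι → Prop) :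
    Prop where
  bd_bd : ∀ a v, bd a (bd (a + 1) v) = 0
  ε_bd : ∀ v, ε (bd 0 v) = 0
  finite : ∀ a v, (Function.support fun j => m a j v).Finite
  sum_eq : ∀ a v, ∑ᶠ j, m a j v = v
  bd_mem : ∀ a I v, v ∈ sub (a + 1) I → bd a v ∈ sub a I
  m_mem : ∀ a j I v, v ∈ sub a I → m a j v ∈ sub a (j :: I)
  anti : ∀ a I J, I ⊆ J → sub a J ≤ sub a I
  mem_nil : ∀ a v, v ∈ sub a []
  eq_zero : ∀ I, ¬ ne I → ∀ v ∈ sub 0 I, v = 0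
  exists_ε_eq_one : ∀ I, ne I → ∃ v ∈ sub 0 I, ε v = 1
  exact : ∀ a I, I ≠ [] → ∀ v ∈ sub (a + 1) I, bd a v = 0 → ∃ w ∈ sub (a + 2) I, bd (a + 1) w = v
  exact_zero : ∀ I, I ≠ [] → ∀ v ∈ sub 0 I, ε v = 0 → ∃ w ∈ sub 1 I, bd 0 w = v

variable {bd : ∀ a, S (a + 1) →ₗ[ℂ] S a} {ε : S 0 →ₗ[ℂ] ℂ}
  {m : ∀ a, ι → S a →ₗ[ℂ] S a} {sub : ∀ a, List ι → Submodule ℂ (S a)} {ne : List ι → Prop}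

/-- The chains of simplices with at least `r` vertices, with coefficients supported in the
corresponding intersections. -/
def chains (sub : ∀ a, List ι → Submodule ℂ (S a)) (a r : ℕ) :
    Submodule ℂ (List ι →₀ S a) where
  carrier := {x | ∀ I, x I ∈ sub a I ∧ (I.length < r → x I = 0)}
  zero_mem' I := ⟨zero_mem _, fun _ => rfl⟩
  add_mem' {x y} hx hy I := ⟨add_mem (hx I).1 (hy I).1, fun h => by
    rw [Finsupp.add_apply, (hx I).2 h, (hy I).2 h, add_zero]⟩
  smul_mem' c x hx I := ⟨Submodule.smul_mem _ _ (hx I).1, fun h => by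
    rw [Finsupp.smul_apply, (hx I).2 h, smul_zero]⟩

/-- The complex chains of simplices of the nerve with at least `r` vertices. -/
def nerveChains (ne : List ι → Prop) (r : ℕ) : Submodule ℂ (List ι →₀ ℂ) where
  carrier := {x | ∀ I, (¬ ne I ∨ I.length < r) → x I = 0}
  zero_mem' _ _ := rfl
  add_mem' {x y} hx hy I h := by rw [Finsupp.add_apply, hx I h, hy I h, add_zero]
  smul_mem' c x hx I h := by rw [Finsupp.smul_apply, hx I h, smul_zero]

theorem single_mem_chains {a r : ℕ} {I : List ι} {v : S a} (hv : v ∈ sub a I)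
    (hr : r ≤ I.length) : Finsupp.single I v ∈ chains sub a r := by
  classical
  intro J
  by_cases h : I = J
  · subst h
    exact ⟨by simpa using hv, fun h => absurd h (not_lt.2 hr)⟩
  · rw [Finsupp.single_eq_of_ne' h]
    exact ⟨zero_mem _, fun _ => rfl⟩

theorem map_mem_of_single {a r : ℕ} {M : Type*} [AddCommGroup M] [Module ℂ M]
    (f : (List ι →₀ S a) →ₗ[ℂ] M) (W : Submodule ℂ M)
    (h : ∀ I, r ≤ I.length → ∀ v ∈ sub a I, f (Finsupp.single I v) ∈ W) {x : List ι →₀ S a}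
    (hx : x ∈ chains sub a r) : f x ∈ W := by
  rw [← Finsupp.sum_single x, Finsupp.sum, map_sum]
  refine Submodule.sum_mem _ fun I hI => h I ?_ _ (hx I).1
  by_contra hr
  exact Finsupp.mem_support_iff.1 hI ((hx I).2 (not_le.1 hr))

/-- Chains whose coefficients are boundaries are boundaries: the primitives can be chosen to vanish
where the coefficients do. -/
theorem exists_mapChain_bd_eq {a r : ℕ} {x : List ι →₀ S a} (hx : x ∈ chains sub a r)
    (h : ∀ I, r ≤ I.length → ∃ w ∈ sub (a + 1) I, bd a w = x I) :
    ∃ y ∈ chains sub (a + 1) r, mapChain (bd a) y = x := by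
  have h' : ∀ I, ∃ w ∈ sub (a + 1) I, bd a w = x I ∧ (x I = 0 → w = 0) := by
    intro I
    by_cases hI : x I = 0
    · exact ⟨0, zero_mem _, by simp [hI], fun _ => rfl⟩
    · obtain ⟨w, hw, hwx⟩ := h I (by
        by_contra hr
        exact hI ((hx I).2 (not_le.1 hr)))
      exact ⟨w, hw, hwx, fun h => absurd h hI⟩
  choose w hw hwε hw0 using h'
  refine ⟨Finsupp.onFinset x.support w fun I hI => Finsupp.mem_support_iff.2
    fun h => hI (hw0 I h), fun I => ⟨hw I, fun h => hw0 I ((hx I).2 h)⟩, ?_⟩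
  ext I
  simpa using hwε I

namespace IsCechComplex

variable (H : IsCechComplex bd ε m sub ne)
include H

theorem mapChain_bd_mem {a r : ℕ} {x : List ι →₀ S (a + 1)} (hx : x ∈ chains sub (a + 1) r) :
    mapChain (bd a) x ∈ chains sub a r := fun I =>
  ⟨by simpa using H.bd_mem a I _ (hx I).1, fun h => by simp [(hx I).2 h]⟩

theorem contraction_mem {a r : ℕ} {x : List ι →₀ S a} (hx : x ∈ chains sub a r) :
    contraction (m a) (H.finite a) x ∈ chains sub a (r + 1) := by
  refine map_mem_of_single _ _ (fun I hI v hv => ?_) hx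
  rw [contraction_single]
  exact finsum_induction (· ∈ chains sub a (r + 1)) (zero_mem _) (fun _ _ => add_mem)
    fun j => single_mem_chains (H.m_mem a j I v hv) (by simpa using hI)

theorem cech_mem {a r : ℕ} {x : List ι →₀ S a} (hx : x ∈ chains sub a (r + 1)) :
    cech x ∈ chains sub a r := by
  refine map_mem_of_single _ _ (fun I hI v hv => ?_) hx
  rw [cech_single]
  refine Submodule.span_le.2 ?_ (cechSingle_mem_span I v)
  rintro _ ⟨J, hJ, hlen, rfl⟩
  exact single_mem_chains (H.anti a J I hJ hv) (by omega)

theorem mapChain_ε_mem {r : ℕ} {x : List ι →₀ S 0} (hx : x ∈ chains sub 0 r) :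
    mapChain ε x ∈ nerveChains ne r := by
  rintro I (h | h)
  · rw [mapChain_apply, H.eq_zero I h _ (hx I).1, map_zero]
  · rw [mapChain_apply, (hx I).2 h, map_zero]

theorem exists_mapChain_ε_eq {r : ℕ} {y : List ι →₀ ℂ} (hy : y ∈ nerveChains ne r) :
    ∃ x ∈ chains sub 0 r, mapChain ε x = y := by
  have h : ∀ I, ∃ v ∈ sub 0 I, ε v = y I ∧ (y I = 0 → v = 0) := by
    intro I
    by_cases hI : y I = 0
    · exact ⟨0, zero_mem _, by simp [hI], fun _ => rfl⟩
    · have hne : ne I := by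
        by_contra h
        exact hI (hy I (Or.inl h))
      obtain ⟨v, hv, hv1⟩ := H.exists_ε_eq_one I hne
      exact ⟨y I • v, Submodule.smul_mem _ _ hv, by simp [hv1], fun h => absurd h hI⟩
  choose w hw hwε hw0 using h
  refine ⟨Finsupp.onFinset y.support w fun I hI => Finsupp.mem_support_iff.2
    fun h => hI (hw0 I h), fun I => ⟨hw I, fun h => hw0 I (hy I (Or.inr h))⟩, ?_⟩
  ext I
  simpa using hwε I

/-- The zigzag from the Čech–de Rham double complex to the chains of the nerve: `ε (Q ∂)^a`, for the
contraction `Q` and the boundary operator `∂`. -/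
def zigzag : ∀ a : ℕ, (List ι →₀ S a) →ₗ[ℂ] (List ι →₀ ℂ)
  | 0 => mapChain ε
  | a + 1 => zigzag a ∘ₗ contraction (m a) (H.finite a) ∘ₗ mapChain (bd a)

theorem zigzag_succ (a : ℕ) (x : List ι →₀ S (a + 1)) : H.zigzag (a + 1) x =
    H.zigzag a (contraction (m a) (H.finite a) (mapChain (bd a) x)) := rfl

theorem mapChain_bd_bd (a : ℕ) (x : List ι →₀ S (a + 2)) :
    mapChain (bd a) (mapChain (bd (a + 1)) x) = 0 := by
  ext I
  simp [H.bd_bd]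

theorem zigzag_mapChain_bd (a : ℕ) (x : List ι →₀ S (a + 1)) :
    H.zigzag a (mapChain (bd a) x) = 0 := by
  cases a with
  | zero =>
    ext I
    simp [zigzag, H.ε_bd]
  | succ a => rw [zigzag_succ, H.mapChain_bd_bd, map_zero, map_zero]

theorem zigzag_mem {a r : ℕ} {x : List ι →₀ S a} (hx : x ∈ chains sub a r) :
    H.zigzag a x ∈ nerveChains ne (r + a) := by
  induction a generalizing r with
  | zero => exact H.mapChain_ε_mem hx
  | succ a ih =>
    rw [zigzag_succ, show r + (a + 1) = r + 1 + a by omega]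
    exact ih (H.contraction_mem (H.mapChain_bd_mem hx))

/-- Up to sign, the zigzag commutes with the Čech differential. -/
theorem exists_zigzag_cech (a : ℕ) (x : List ι →₀ S a) :
    H.zigzag a (cech x) = cech ((-1 : ℂ) ^ a • H.zigzag a x) := by
  induction a with
  | zero => simp [zigzag, cech_mapChain]
  | succ a ih =>
    rw [zigzag_succ, zigzag_succ, ← cech_mapChain]
    have h := cech_contraction (hfin := H.finite a) (H.sum_eq a) (mapChain (bd a) x)
    have h2 : contraction (m a) (H.finite a) (cech (mapChain (bd a) x)) =
        mapChain (bd a) x - cech (contraction (m a) (H.finite a) (mapChain (bd a) x)) := by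
      rw [h, sub_sub_cancel]
    rw [h2, map_sub, H.zigzag_mapChain_bd,
      ih, zero_sub, ← map_neg, pow_succ]
    simp

/-- A chain whose zigzag is a boundary in the nerve is a boundary in the double complex. The zigzag
of `x` is the zigzag of `Q ∂ x`, one degree lower, which allows induction on the degree. -/
theorem exists_eq_bd_add_cech {a : ℕ} : ∀ {r : ℕ} {x : List ι →₀ S (a + 1)}, 1 ≤ r →
    x ∈ chains sub (a + 1) r → cech (mapChain (bd a) x) = 0 →
    H.zigzag (a + 1) x ∈ (nerveChains ne (r + (a + 1) + 1)).map cech →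
    ∃ y ∈ chains sub (a + 2) r, ∃ z ∈ chains sub (a + 1) (r + 1),
      mapChain (bd (a + 1)) y = x - cech z := by
  -- the last step of both cases of the induction
  have step : ∀ {a r : ℕ} {x : List ι →₀ S (a + 1)} {z : List ι →₀ S (a + 1)}, 1 ≤ r →
      x ∈ chains sub (a + 1) r → z ∈ chains sub (a + 1) (r + 1) →
      mapChain (bd a) (x - cech z) = 0 → ∃ y ∈ chains sub (a + 2) r,
        ∃ z ∈ chains sub (a + 1) (r + 1), mapChain (bd (a + 1)) y = x - cech z := by
    intro a r x z hr hx hz h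
    obtain ⟨y, hy, hyx⟩ := exists_mapChain_bd_eq (sub_mem hx (H.cech_mem hz)) fun I hI =>
      H.exact a I (by rintro rfl; simp at hI; omega) _ (sub_mem hx (H.cech_mem hz) I).1 (by
        rw [← mapChain_apply, h]; rfl)
    exact ⟨y, hy, z, hz, hyx⟩
  induction a with
  | zero =>
    intro r x hr hx hcyc hzig
    have hx' := H.contraction_mem (H.mapChain_bd_mem hx)
    set x' := contraction (m 0) (H.finite 0) (mapChain (bd 0) x) with hx'def
    have h1 : cech x' = mapChain (bd 0) x := by
      rw [hx'def, cech_contraction (H.sum_eq 0), hcyc, map_zero, sub_zero]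
    obtain ⟨ν, hν, hνx⟩ := hzig
    obtain ⟨β, hβ, hβν⟩ := H.exists_mapChain_ε_eq hν
    have hβ' := H.cech_mem (r := r + 1) hβ
    obtain ⟨y, hy, hyx⟩ := exists_mapChain_bd_eq (sub_mem hx' hβ') fun I hI =>
      H.exact_zero I (by rintro rfl; simp at hI) _ (sub_mem hx' hβ' I).1 (by
        rw [← mapChain_apply, map_sub, ← cech_mapChain, hβν, hνx]
        change (H.zigzag 1 x - H.zigzag 1 x) I = 0
        simp)
    refine step hr hx hy ?_
    rw [map_sub, ← cech_mapChain, hyx, map_sub, h1, cech_cech, sub_zero, sub_self]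
  | succ a ih =>
    intro r x hr hx hcyc hzig
    have hx' := H.contraction_mem (H.mapChain_bd_mem hx)
    set x' := contraction (m (a + 1)) (H.finite (a + 1)) (mapChain (bd (a + 1)) x) with hx'def
    have h1 : cech x' = mapChain (bd (a + 1)) x := by
      rw [hx'def, cech_contraction (H.sum_eq (a + 1)), hcyc, map_zero, sub_zero]
    obtain ⟨y, hy, z, hz, hyx⟩ := ih (by omega) hx' (by
      rw [cech_mapChain, h1, H.mapChain_bd_bd]) (by
        rw [show r + 1 + (a + 1) + 1 = r + (a + 1 + 1) + 1 by omega]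
        exact hzig)
    refine step hr hx hy ?_
    rw [map_sub, ← cech_mapChain, hyx, map_sub, h1, cech_cech, sub_zero, sub_self]

/-- The Čech class of a current. -/
def cechClass (a : ℕ) : S a →ₗ[ℂ] (List ι →₀ ℂ) :=
  H.zigzag a ∘ₗ contraction (m a) (H.finite a) ∘ₗ Finsupp.lsingle []

theorem cechClass_apply (a : ℕ) (v : S a) : H.cechClass a v =
    H.zigzag a (contraction (m a) (H.finite a) (Finsupp.single [] v)) := rfl

theorem single_mem (a : ℕ) (v : S a) : Finsupp.single [] v ∈ chains sub a 0 :=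
  single_mem_chains (H.mem_nil a v) (Nat.zero_le _)

theorem cech_contraction_single (a : ℕ) (v : S a) :
    cech (contraction (m a) (H.finite a) (Finsupp.single [] v)) = Finsupp.single [] v := by
  rw [cech_contraction (H.sum_eq a), cech_single]
  simp [cechSingle]

/-- The Čech class of a boundary is a boundary. -/
theorem cechClass_bd_mem (a : ℕ) (v : S (a + 1)) :
    H.cechClass a (bd a v) ∈ (nerveChains ne (a + 2)).map cech := by
  set y := contraction (m (a + 1)) (H.finite (a + 1)) (Finsupp.single [] v) with hy
  have hy1 : y ∈ chains sub (a + 1) 1 := H.contraction_mem (H.single_mem (a + 1) v)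
  set z := contraction (m a) (H.finite a) (mapChain (bd a) y) with hz
  have hz1 : z ∈ chains sub a 2 := H.contraction_mem (H.mapChain_bd_mem hy1)
  have h1 : contraction (m a) (H.finite a) (Finsupp.single [] (bd a v)) =
      mapChain (bd a) y - cech z := by
    have h2 : Finsupp.single [] (bd a v) = cech (mapChain (bd a) y) := by
      rw [cech_mapChain, H.cech_contraction_single, mapChain_single]
    rw [h2, hz, cech_contraction (H.sum_eq a), sub_sub_cancel]
  refine ⟨-((-1 : ℂ) ^ a • H.zigzag a z), ?_, ?_⟩
  · rw [show a + 2 = 2 + a by omega]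
    exact neg_mem (Submodule.smul_mem _ _ (H.zigzag_mem hz1))
  · rw [cechClass_apply, h1, map_sub, H.zigzag_mapChain_bd, zero_sub, H.exists_zigzag_cech,
      map_neg]

/-- A cycle whose Čech class is a boundary is a boundary. -/
theorem exists_bd_eq {a : ℕ} {v : S (a + 1)} (hv : bd a v = 0)
    (h : H.cechClass (a + 1) v ∈ (nerveChains ne (a + 3)).map cech) :
    ∃ w, bd (a + 1) w = v := by
  obtain ⟨y, hy, z, hz, hyz⟩ := H.exists_eq_bd_add_cech (r := 1) le_rfl
    (H.contraction_mem (H.single_mem (a + 1) v)) (by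
      rw [cech_mapChain, H.cech_contraction_single, mapChain_single, hv, Finsupp.single_zero])
    (by
      rw [show 1 + (a + 1) + 1 = a + 3 by omega]
      exact h)
  refine ⟨cech y [], ?_⟩
  have h1 := congrArg (fun x => cech x []) hyz
  simpa [cech_mapChain, H.cech_contraction_single, cech_cech] using h1

/-- The functionals `v ↦ φ (Čech class of v)` belong to every class of functionals that is closed
under the operations by which they are built. -/
theorem comp_cechClass_mem (rep : ∀ a, Set (S a →ₗ[ℂ] ℂ))
    (h0 : ∀ c : ι → ℂ, ∃ f ∈ rep 0, ∀ v, f v = ∑ᶠ j, c j * ε (m 0 j v))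
    (hs : ∀ a (g : ι → S a →ₗ[ℂ] ℂ), (∀ j, g j ∈ rep a) →
      ∃ f ∈ rep (a + 1), ∀ v, f v = ∑ᶠ j, g j (bd a (m (a + 1) j v)))
    (φ : (List ι →₀ ℂ) →ₗ[ℂ] ℂ) (a : ℕ) :
    ∃ f ∈ rep a, ∀ v, f v = φ (H.cechClass a v) := by
  suffices ∀ a (I : List ι), ∃ f ∈ rep a, ∀ v, f v =
      φ (H.zigzag a (contraction (m a) (H.finite a) (Finsupp.single I v))) from this a []
  intro a
  have hfin : ∀ (a : ℕ) (v : S a) (I : List ι),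
      (Function.support fun j => Finsupp.single (j :: I) (m a j v)).Finite := fun a v I =>
    (H.finite a v).subset fun j hj h => hj (by
      change Finsupp.single (j :: I) (m a j v) = 0
      rw [show m a j v = 0 from h, Finsupp.single_zero])
  induction a with
  | zero =>
    intro I
    obtain ⟨f, hf, hfv⟩ := h0 fun j => φ (Finsupp.single (j :: I) 1)
    refine ⟨f, hf, fun v => ?_⟩
    rw [hfv, contraction_single]
    have h1 := (φ ∘ₗ H.zigzag 0).toAddMonoidHom.map_finsum (hfin 0 v I)
    refine Eq.trans ?_ h1.symm
    congr 1
    funext j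
    have h2 : Finsupp.single (j :: I) (ε (m 0 j v)) =
        ε (m 0 j v) • Finsupp.single (j :: I) (1 : ℂ) := by simp
    simp only [LinearMap.toAddMonoidHom_coe, LinearMap.comp_apply, zigzag, mapChain_single]
    rw [h2, map_smul, smul_eq_mul, mul_comm]
  | succ a ih =>
    intro I
    choose g hg hgv using fun j => ih (j :: I)
    obtain ⟨f, hf, hfv⟩ := hs a g hg
    refine ⟨f, hf, fun v => ?_⟩
    rw [hfv, contraction_single]
    have h1 := (φ ∘ₗ H.zigzag (a + 1)).toAddMonoidHom.map_finsum (hfin (a + 1) v I)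
    refine Eq.trans ?_ h1.symm
    congr 1
    funext j
    simp only [LinearMap.toAddMonoidHom_coe, LinearMap.comp_apply, zigzag_succ, mapChain_single]
    rw [hgv]

/-- A cycle that is annihilated by the representable functionals that vanish on all boundaries is a
boundary. -/
theorem exists_bd_eq_of_annihilated (rep : ∀ a, Set (S a →ₗ[ℂ] ℂ))
    (h0 : ∀ c : ι → ℂ, ∃ f ∈ rep 0, ∀ v, f v = ∑ᶠ j, c j * ε (m 0 j v))
    (hs : ∀ a (g : ι → S a →ₗ[ℂ] ℂ), (∀ j, g j ∈ rep a) →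
      ∃ f ∈ rep (a + 1), ∀ v, f v = ∑ᶠ j, g j (bd a (m (a + 1) j v)))
    {a : ℕ} {v : S (a + 1)} (hv : bd a v = 0)
    (h : ∀ f ∈ rep (a + 1), (∀ w, f (bd (a + 1) w) = 0) → f v = 0) :
    ∃ w, bd (a + 1) w = v := by
  by_contra hno
  have h1 : H.cechClass (a + 1) v ∉ (nerveChains ne (a + 3)).map cech := fun h1 =>
    hno (H.exists_bd_eq hv h1)
  obtain ⟨φ, hφ, hker⟩ := Submodule.exists_le_ker_of_notMem h1
  obtain ⟨f, hf, hfv⟩ := H.comp_cechClass_mem rep h0 hs φ (a + 1)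
  refine hφ ?_
  rw [← hfv]
  refine h f hf fun w => ?_
  rw [hfv]
  exact hker (H.cechClass_bd_mem (a + 1) w)

end IsCechComplex

end CechComplex

/-! ### Currents that vanish on the closed forms are boundaries -/

section LocallyFiniteSums

variable {n : ℕ} {X : Type*} [TopologicalSpace X] [ChartedSpace (Cn n) X] {k : ℕ} {ι : Type*}

/-- Evaluation of forms at a point, as an additive map. -/
def SmoothForm.evalAt (x : X) : SmoothForm n X k →+ AltForm n k where
  toFun η := η x
  map_zero' := rfl
  map_add' _ _ := rfl

theorem SmoothForm.sum_apply (F : Finset ι) (β : ι → SmoothForm n X k) (x : X) :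
    (∑ j ∈ F, β j) x = ∑ j ∈ F, β j x := map_sum (SmoothForm.evalAt x) β F

variable {ρ : ι → SmoothFun n X} (hρ : LocallyFinite fun j => Function.support (ρ j))
include hρ

/-- Near `x`, only the functions with `x` in their support contribute to a locally finite sum. -/
theorem eventually_finsum_eq (β : ι → SmoothForm n X k) (x : X) (F : Finset ι)
    (hF : ∀ j, x ∈ tsupport (ρ j) → j ∈ F) :
    ∀ᶠ z in 𝓝 x, ∑ᶠ j, (ρ j z • β j z : AltForm n k) = (∑ j ∈ F, mulForm (ρ j) (β j)) z := by
  filter_upwards [hρ.closure.iInter_compl_mem_nhds (fun _ => isClosed_closure) x] with z hz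
  rw [SmoothForm.sum_apply]
  refine finsum_eq_sum_of_support_subset _ fun j hj => hF j ?_
  by_contra hx
  refine hj ?_
  have h1 : ρ j z = 0 := by
    by_contra h
    exact mem_iInter₂.1 hz j hx (subset_closure h)
  ext v
  simp [h1]

/-- The locally finite sum `∑ ρ_j β_j` of forms. -/
def locallyFiniteSum (β : ι → SmoothForm n X k) : SmoothForm n X k where
  toFun x := ∑ᶠ j, (ρ j x • β j x : AltForm n k)
  contDiffOn' e he y hy := by
    have hfin := hρ.closure.point_finite (e.symm y)
    have h := eventually_finsum_eq hρ β (e.symm y) hfin.toFinset (by simp [tsupport])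
    have h1 := ((∑ j ∈ hfin.toFinset, mulForm (ρ j) (β j)).contDiffAt he hy)
    refine (h1.congr_of_eventuallyEq ?_).contDiffWithinAt
    filter_upwards [(e.continuousAt_symm hy).eventually h] with z hz
    rw [chartRep, hz]
    rfl

theorem locallyFiniteSum_apply (β : ι → SmoothForm n X k) (x : X) :
    locallyFiniteSum hρ β x = ∑ᶠ j, (ρ j x • β j x : AltForm n k) := rfl

theorem finite_inter_support {L : Set X} (hL : IsCompact L) :
    {j | (tsupport (ρ j) ∩ L).Nonempty}.Finite := hρ.closure.finite_nonempty_inter_compact hL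

/-- Currents with compact support commute with locally finite sums. -/
theorem apply_locallyFiniteSum (T : Functional n X k) (β : ι → SmoothForm n X k) :
    T (locallyFiniteSum hρ β) = ∑ᶠ j, T (mulForm (ρ j) (β j)) := by
  obtain ⟨L, hL, -, hT⟩ := mem_supportedIn_univ T
  have hfin := finite_inter_support hρ hL
  rw [finsum_eq_sum_of_support_subset (s := hfin.toFinset), ← map_sum, ← sub_eq_zero, ← map_sub]
  · refine hT _ fun x hx => ?_
    filter_upwards [eventually_finsum_eq hρ β x hfin.toFinset
      fun j hj => by simpa using ⟨x, hj, hx⟩] with z hz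
    exact sub_eq_zero.2 hz
  · intro j hj
    by_contra h
    refine hj (hT _ fun x hx => ?_)
    have hx' : x ∉ tsupport (ρ j) := fun hx' => h (by simpa using ⟨x, hx', hx⟩)
    filter_upwards [notMem_tsupport_iff_eventuallyEq.1 hx'] with z hz
    ext v
    simp [hz]

theorem finite_support_mulFunctional (T : Functional n X k) :
    (Function.support fun j => mulFunctional (ρ j) T).Finite := by
  obtain ⟨L, hL, -, hT⟩ := mem_supportedIn_univ T
  refine (finite_inter_support hρ hL).subset fun j hj => ?_
  by_contra h
  refine hj ?_
  ext η
  refine hT _ fun x hx => ?_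
  have hx' : x ∉ tsupport (ρ j) := fun hx' => h ⟨x, hx', hx⟩
  filter_upwards [notMem_tsupport_iff_eventuallyEq.1 hx'] with z hz
  ext v
  simp [hz]

theorem finsum_mulFunctional (hone : ∀ x, ∑ᶠ j, ρ j x = 1) (T : Functional n X k) :
    ∑ᶠ j, mulFunctional (ρ j) T = T := by
  ext η
  let ev : Functional n X k →+ ℂ :=
    { toFun := fun S => S η, map_zero' := rfl, map_add' := fun _ _ => rfl }
  have h1 := ev.map_finsum (finite_support_mulFunctional hρ T)
  refine h1.trans ?_
  change ∑ᶠ j, T (mulForm (ρ j) η) = T η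
  rw [← apply_locallyFiniteSum hρ T fun _ => η]
  congr 1
  ext1 x
  rw [locallyFiniteSum_apply]
  have h2 : (Function.support fun j => ρ j x).Finite := hρ.point_finite x
  rw [← finsum_smul' h2 (η x), hone, one_smul]

end LocallyFiniteSums

section RealPart

variable {n : ℕ} {X : Type*} [TopologicalSpace X] [ChartedSpace (Cn n) X] {k : ℕ}

instance : ContinuousConstSMul ℂ (SmoothForm n X k) where
  continuous_const_smul c :=
    continuous_of_chartRep_eq ((LinearMap.lsmul ℂ (SmoothForm n X k) c).restrictScalars ℝ)
      fun _ _ => ⟨fun _ => c • ContinuousLinearMap.id ℝ _, contDiffOn_const, fun _ _ _ => rfl⟩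

/-- The real part of a form. -/
def realPart (k : ℕ) : SmoothForm n X k →L[ℝ] realForms n X k where
  toLinearMap := LinearMap.codRestrict (realForms n X k)
    ((2⁻¹ : ℝ) • (LinearMap.id + conjugate)) fun η => by
      change conjugate ((2⁻¹ : ℝ) • (η + conjugate η)) = (2⁻¹ : ℝ) • (η + conjugate η)
      rw [map_smul, map_add, add_comm]
      congr 2
      ext x v
      simp [conjugate_apply]
  cont := Continuous.subtype_mk
    ((continuous_id.add continuous_conjugate).const_smul (2⁻¹ : ℝ)) _

theorem coe_realPart (η : SmoothForm n X k) :
    (realPart k η : SmoothForm n X k) = (2⁻¹ : ℝ) • (η + conjugate η) := rfl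

theorem realPart_of_mem (ψ : realForms n X k) : realPart k (ψ : SmoothForm n X k) = ψ := by
  apply Subtype.ext
  have h : conjugate (ψ : SmoothForm n X k) = ψ := ψ.2
  rw [coe_realPart, h, ← two_smul ℝ, smul_smul]
  norm_num

end RealPart

section DeRham

variable {n : ℕ} {X : Type*} [TopologicalSpace X] [ChartedSpace (Cn n) X]
  [IsManifold 𝓘(ℂ, Cn n) ω X]

theorem d_oneForm : d (oneForm n X) = 0 := by
  ext1 x
  rw [d_apply]
  have h : chartRep (oneForm n X) (chartAt (Cn n) x) = fun _ =>
      ContinuousAlternatingMap.constOfIsEmpty ℝ (Cn n) (Fin 0) (1 : ℂ) := rfl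
  rw [h, extDeriv, fderiv_const_apply]
  exact map_zero (ContinuousAlternatingMap.alternatizeUncurryFinCLM ℝ (Cn n) ℂ)

/-- The pairing with a form, as a functional on the currents. -/
def pairing {k : ℕ} (η : SmoothForm n X k) : Functional n X k →ₗ[ℂ] ℂ where
  toFun T := T η
  map_add' _ _ := rfl
  map_smul' _ _ := rfl

omit [IsManifold 𝓘(ℂ, Cn n) ω X] in
theorem IsGoodCover.isOpen_listInter {ι : Type*} {U : ι → Set X} (hU : IsGoodCover n U)
    (I : List ι) : IsOpen (listInter U I) := by
  have : listInter U I = ⋂ i ∈ {i | i ∈ I}, U i := by ext; simp [listInter]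
  rw [this]
  exact I.finite_toSet.isOpen_biInter fun i _ => hU.isOpen i

/-- The currents with compact support, a good cover and a partition of unity satisfy the assumptions
of the comparison with Čech homology. -/
theorem isCechComplex [T2Space X] [SecondCountableTopology X] {ι : Type*} {U : ι → Set X}
    (hU : IsGoodCover n U) {ρ : ι → SmoothFun n X}
    (hρ : LocallyFinite fun j => Function.support (ρ j)) (hρU : ∀ j, tsupport (ρ j) ⊆ U j)
    (hone : ∀ x, ∑ᶠ j, ρ j x = 1) :
    IsCechComplex (S := Functional n X) (fun _ => boundary)
      (pairing (oneForm n X))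
      (fun _ j => mulFunctional (ρ j)) (fun a I => supportedIn a (listInter U I))
      (fun I => (listInter U I).Nonempty) where
  bd_bd _ v := boundary_boundary v
  ε_bd v := by
    change v (d (oneForm n X)) = 0
    rw [d_oneForm, map_zero]
  finite _ v := finite_support_mulFunctional hρ v
  sum_eq _ v := finsum_mulFunctional hρ hone v
  bd_mem _ _ _ hv := boundary_mem_supportedIn hv
  m_mem _ j I v hv := by
    refine supportedIn_mono (fun x hx => ?_) (mulFunctional_mem_supportedIn (hρU j) hv)
    simpa [listInter] using And.intro hx.1 hx.2
  anti _ _ _ hIJ := supportedIn_mono fun _ hx i hi => hx i (hIJ hi)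
  mem_nil _ v := supportedIn_mono (fun _ _ => by simp [listInter]) (mem_supportedIn_univ v)
  eq_zero I hI v hv := by
    rw [not_nonempty_iff_eq_empty.1 hI] at hv
    exact eq_zero_of_mem_supportedIn_empty hv
  exists_ε_eq_one I hI := by
    obtain ⟨x, hx⟩ := hI
    exact ⟨evalForm x 0, evalForm_mem_supportedIn hx 0, oneForm_apply (n := n) x 0⟩
  exact _ I hI v hv h := by
    obtain ⟨e, he, hsub, hconv⟩ := hU.exists_chart I hI
    exact exists_boundary_eq (hU.isOpen_listInter I) he hsub hconv hv h
  exact_zero I hI v hv h := by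
    obtain ⟨e, he, hsub, hconv⟩ := hU.exists_chart I hI
    exact exists_boundary_eq_of_apply_one (hU.isOpen_listInter I) he hsub hconv hv h

variable [T2Space X] [SecondCountableTopology X] {k : ℕ}

/-- A continuous functional on the complex forms that vanishes on the closed forms is of the form
`R ∘ d` for a continuous functional `R`. No closed range hypothesis is needed. -/
theorem exists_boundary_eq_of_closed (T : Functional n X (k + 1))
    (hT : ∀ η : SmoothForm n X (k + 1), d η = 0 → T η = 0) :
    ∃ R : Functional n X (k + 2), boundary R = T := by
  obtain ⟨U, hU⟩ := exists_isGoodCover n X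
  obtain ⟨ρ, hρ, hρU, hone⟩ := exists_partition (n := n) hU.isOpen hU.iUnion_eq
  have H := isCechComplex hU hρ hρU hone
  -- the representable functionals are the pairings with smooth forms
  refine H.exists_bd_eq_of_annihilated
    (fun a => {f | ∃ η : SmoothForm n X a, ∀ T, f T = T η}) (fun c => ?_) (fun a g hg => ?_) ?_ ?_
  · refine ⟨pairing (locallyFiniteSum hρ fun j => c j • oneForm n X), ⟨_, fun _ => rfl⟩, fun v => ?_⟩
    refine (apply_locallyFiniteSum hρ v _).trans ?_
    congr 1
    funext j
    rw [map_smul, map_smul]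
    rfl
  · choose β hβ using hg
    refine ⟨pairing (locallyFiniteSum hρ fun j => d (β j)), ⟨_, fun _ => rfl⟩, fun v => ?_⟩
    refine (apply_locallyFiniteSum hρ v _).trans ?_
    congr 1
    funext j
    rw [hβ]
    rfl
  · ext η
    exact hT _ (d_d η)
  -- a form that pairs to zero with all boundaries is closed, as points are currents
  · rintro f ⟨η, hη⟩ hf
    rw [hη]
    refine hT η ?_
    ext x v
    have := hf (evalForm x v)
    rwa [hη] at this

/-- The real version of `exists_boundary_eq_of_closed`. -/
theorem exists_eq_comp_dReal (T : realForms n X (k + 1) →L[ℝ] ℝ)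
    (hT : ∀ ψ, dReal n X (k + 1) ψ = 0 → T ψ = 0) :
    ∃ R : realForms n X (k + 2) →L[ℝ] ℝ, ∀ ψ, R (dReal n X (k + 1) ψ) = T ψ := by
  obtain ⟨R, hR⟩ := exists_boundary_eq_of_closed
    (StrongDual.extendRCLike (𝕜 := ℂ) (T.comp (realPart (k + 1)))) fun η hη => by
      have h : ∀ θ : SmoothForm n X (k + 1), d θ = 0 → T (realPart (k + 1) θ) = 0 :=
        fun θ hθ => hT _ (Subtype.ext (by
          change d ((2⁻¹ : ℝ) • (θ + conjugate θ)) = 0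
          rw [LinearMap.map_smul_of_tower, map_add, ← conjugate_d, hθ, map_zero, add_zero,
            smul_zero]))
      rw [StrongDual.extendRCLike_apply]
      simp [h η hη, h (Complex.I • η) (by rw [map_smul, hη, smul_zero])]
  refine ⟨Complex.reCLM.comp ((R.restrictScalars ℝ).comp (realForms n X (k + 2)).subtypeL),
    fun ψ => ?_⟩
  have h1 : R (d (ψ : SmoothForm n X (k + 1))) =
      StrongDual.extendRCLike (𝕜 := ℂ) (T.comp (realPart (k + 1))) ψ := by
    rw [← hR]
    rfl
  change (R (d (ψ : SmoothForm n X (k + 1)))).re = T ψ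
  rw [h1]
  refine (StrongDual.re_extendRCLike_apply (𝕜 := ℂ) (T.comp (realPart (k + 1))) _).trans ?_
  change T (realPart (k + 1) ψ) = T ψ
  rw [realPart_of_mem]

end DeRham

/-! ### Wedge products of covectors as determinants -/

section Determinants

variable {n : ℕ} {ι κ : Type*} [Fintype ι] [DecidableEq ι] [Fintype κ] [DecidableEq κ]

/-- The wedge product of a family of complex valued real covectors, over any finite index type. -/
def covectorDet (φ : ι → Cn n →ₗ[ℝ] ℂ) : Cn n [⋀^ι]→ₗ[ℝ] ℂ :=
  MultilinearMap.alternatization ((MultilinearMap.mkPiAlgebra ℝ ι ℂ).compLinearMap φ)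

theorem covectorDet_apply (φ : ι → Cn n →ₗ[ℝ] ℂ) (v : ι → Cn n) :
    covectorDet φ v = Matrix.det (Matrix.of fun i j => φ j (v i)) := by
  rw [Matrix.det_apply, covectorDet, MultilinearMap.alternatization_apply]
  rfl

theorem covectorDet_domDomCongr (φ : ι → Cn n →ₗ[ℝ] ℂ) (e : ι ≃ κ) :
    (covectorDet φ).domDomCongr e = covectorDet (φ ∘ e.symm) := by
  ext v
  rw [AlternatingMap.domDomCongr_apply, covectorDet_apply, covectorDet_apply,
    ← Matrix.det_submatrix_equiv_self e]
  congr 1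
  ext i j
  simp

theorem covectorDet_comp_perm (φ : ι → Cn n →ₗ[ℝ] ℂ) (π : Equiv.Perm ι) :
    covectorDet (φ ∘ π) = (((Equiv.Perm.sign π : ℤ) : ℂ)) • covectorDet φ := by
  ext v
  rw [AlternatingMap.smul_apply, covectorDet_apply, covectorDet_apply, smul_eq_mul,
    ← Matrix.det_permute']
  rfl

theorem covectorDet_matrix (φ : ι → Cn n →ₗ[ℝ] ℂ) (B : Matrix ι ι ℂ) :
    covectorDet (fun i => ∑ j, B i j • φ j) = B.det • covectorDet φ := by
  ext v
  rw [AlternatingMap.smul_apply, covectorDet_apply, covectorDet_apply, smul_eq_mul, mul_comm,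
    ← Matrix.det_transpose B, ← Matrix.det_mul]
  congr 1
  ext i j
  simp [Matrix.mul_apply, mul_comm]

theorem covectorDet_smul_apply (φ : ι → Cn n →ₗ[ℝ] ℂ) (c : ι → ℂ) (z : ℂ)
    (h : ∀ j v, φ j (z • v) = c j * φ j v) (v : ι → Cn n) :
    covectorDet φ (fun i => z • v i) = (∏ j, c j) * covectorDet φ v := by
  rw [covectorDet_apply, covectorDet_apply, ← Matrix.det_mul_row]
  congr 1
  ext i j
  simp [h]

theorem continuous_covectorDet (φ : ι → Cn n →ₗ[ℝ] ℂ) : Continuous (covectorDet φ) := by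
  have h : (covectorDet φ : (ι → Cn n) → ℂ) =
      fun v => Matrix.det (Matrix.of fun i j => φ j (v i)) :=
    funext (covectorDet_apply φ)
  rw [h]
  refine Continuous.matrix_det (continuous_matrix fun i j => ?_)
  exact (LinearMap.continuous_of_finiteDimensional (φ j)).comp (continuous_apply i)

/-- On the values of a real basis, the wedge of a family of covectors vanishes only if the covectors
are linearly dependent over `ℂ`. -/
theorem covectorDet_basis_ne_zero (b : Module.Basis ι ℝ (Cn n)) {φ : ι → Cn n →ₗ[ℝ] ℂ}
    (hφ : ∀ c : ι → ℂ, ∑ j, c j • φ j = 0 → c = 0) : covectorDet φ b ≠ 0 := by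
  rw [covectorDet_apply]
  intro h
  obtain ⟨c, hc, h0⟩ := Matrix.exists_mulVec_eq_zero_iff.2 h
  refine hc (hφ c (b.ext fun i => ?_))
  have := congrFun h0 i
  simpa [Matrix.mulVec, dotProduct, mul_comm] using this

theorem covectorDet_eq_zero {φ : ι → Cn n →ₗ[ℝ] ℂ} {c : ι → ℂ} (hc : c ≠ 0)
    (h : ∑ j, c j • φ j = 0) : covectorDet φ = 0 := by
  ext v
  rw [covectorDet_apply]
  refine Matrix.exists_mulVec_eq_zero_iff.1 ⟨c, hc, ?_⟩
  ext i
  have := LinearMap.congr_fun h (v i)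
  simpa [Matrix.mulVec, dotProduct, mul_comm] using this

end Determinants

section Wedge

variable {n k l : ℕ}

/-- The wedge product as a sum over representatives of the shuffles. -/
theorem wedge_apply (α : Cn n [⋀^Fin k]→ₗ[ℝ] ℂ) (β : Cn n [⋀^Fin l]→ₗ[ℝ] ℂ)
    (v : Fin (k + l) → Cn n) :
    wedge α β v = ∑ s : Equiv.Perm.ModSumCongr (Fin k) (Fin l),
      ((Equiv.Perm.sign s.out : ℤ) : ℂ) *
        (α (fun i => v (finSumFinEquiv (s.out (Sum.inl i)))) *
          β (fun i => v (finSumFinEquiv (s.out (Sum.inr i))))) := by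
  rw [wedge, AlternatingMap.domDomCongr_apply, LinearMap.compAlternatingMap_apply,
    AlternatingMap.domCoprod_apply, sum_apply, map_sum]
  refine Finset.sum_congr rfl fun s _ => ?_
  conv_lhs => rw [← Quotient.out_eq' s]
  rw [AlternatingMap.domCoprod.summand_mk'', smul_apply,
    MultilinearMap.domDomCongr_apply, MultilinearMap.domCoprod_apply, Units.smul_def, map_zsmul,
    LinearMap.mul'_apply, zsmul_eq_mul]
  rfl

theorem wedge_smul_left (c : ℂ) (α : Cn n [⋀^Fin k]→ₗ[ℝ] ℂ) (β : Cn n [⋀^Fin l]→ₗ[ℝ] ℂ) :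
    wedge (c • α) β = c • wedge α β := by
  ext v
  simp only [AlternatingMap.smul_apply, wedge_apply, smul_eq_mul, Finset.mul_sum]
  exact Finset.sum_congr rfl fun s _ => by ring

theorem wedge_smul_right (c : ℂ) (α : Cn n [⋀^Fin k]→ₗ[ℝ] ℂ) (β : Cn n [⋀^Fin l]→ₗ[ℝ] ℂ) :
    wedge α (c • β) = c • wedge α β := by
  ext v
  simp only [AlternatingMap.smul_apply, wedge_apply, smul_eq_mul, Finset.mul_sum]
  exact Finset.sum_congr rfl fun s _ => by ring

theorem wedge_covectorDet (φ : Fin k → Cn n →ₗ[ℝ] ℂ) (ψ : Fin l → Cn n →ₗ[ℝ] ℂ) :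
    wedge (covectorDet φ) (covectorDet ψ) =
      (covectorDet (Sum.elim φ ψ)).domDomCongr finSumFinEquiv := by
  rw [wedge, covectorDet, covectorDet, ← MultilinearMap.domCoprod_alternization,
    ← LinearMap.compMultilinearMap_alternatization, covectorDet]
  congr 2
  ext v
  simp [MultilinearMap.domCoprod_apply]

end Wedge

/-! ### The simple positive forms -/

section Simple

variable {n k p : ℕ}

/-- The covectors `ψ₁, …, ψ_k, conj ψ₁, …, conj ψ_k`. -/
def withConj {ι : Type*} (ψ : ι → Cn n →ₗ[ℂ] ℂ) : ι ⊕ ι → Cn n →ₗ[ℝ] ℂ :=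
  Sum.elim (fun i => (ψ i).restrictScalars ℝ)
    (fun i => Complex.conjAe.toLinearMap ∘ₗ (ψ i).restrictScalars ℝ)

/-- The constant `i^{k²} 2^{-k}` in the definition of `simplePositive`. -/
def simpleConst (k : ℕ) : ℂ := Complex.I ^ (k ^ 2) * (2 ^ k)⁻¹

theorem simpleConst_ne_zero (k : ℕ) : simpleConst k ≠ 0 := by
  simp [simpleConst]

theorem simpleConst_mul (p k : ℕ) :
    simpleConst p * simpleConst k = (-1) ^ (p * k) * simpleConst (p + k) := by
  have h : (p + k) ^ 2 = p ^ 2 + k ^ 2 + 2 * (p * k) := by ring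
  have h1 : ((-1 : ℂ) ^ (p * k)) * (-1) ^ (p * k) = 1 := by
    rw [← mul_pow]; simp
  rw [simpleConst, simpleConst, simpleConst, h, pow_add, pow_add, pow_mul Complex.I 2,
    Complex.I_sq, pow_add, mul_inv]
  linear_combination -(Complex.I ^ p ^ 2 * (2 ^ p)⁻¹ * (Complex.I ^ k ^ 2 * (2 ^ k)⁻¹)) * h1

theorem covectorDet_restrictScalars (ψ : Fin k → Cn n →ₗ[ℂ] ℂ) :
    wedgeCovectors ψ = covectorDet fun i => (ψ i).restrictScalars ℝ := by
  ext v
  rw [wedgeCovectors_apply, covectorDet_apply]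
  rfl

theorem conj_covectorDet {ι : Type*} [Fintype ι] [DecidableEq ι] (φ : ι → Cn n →ₗ[ℝ] ℂ) :
    Complex.conjAe.toLinearMap.compAlternatingMap (covectorDet φ) =
      covectorDet fun i => Complex.conjAe.toLinearMap ∘ₗ φ i := by
  ext v
  rw [LinearMap.compAlternatingMap_apply, covectorDet_apply, covectorDet_apply]
  exact RingHom.map_det (starRingEnd ℂ) _

theorem simplePositive_eq (ψ : Fin k → Cn n →ₗ[ℂ] ℂ) :
    simplePositive ψ =
      simpleConst k • (covectorDet (withConj ψ)).domDomCongr finSumFinEquiv := by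
  rw [simplePositive, covectorDet_restrictScalars, conj_covectorDet, wedge_covectorDet]
  rfl

theorem sign_sumComm (k : ℕ) :
    ((Equiv.Perm.sign (Equiv.sumComm (Fin k) (Fin k) : Equiv.Perm (Fin k ⊕ Fin k)) : ℤ) : ℂ) =
      (-1) ^ k := by
  let e : Fin k × Bool ≃ Fin k ⊕ Fin k :=
    (Equiv.prodComm _ _).trans (Equiv.boolProdEquivSum (Fin k))
  have h : (Equiv.sumComm (Fin k) (Fin k) : Equiv.Perm (Fin k ⊕ Fin k)) =
      e.permCongr (Equiv.prodCongrRight fun _ => Equiv.swap false true) := by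
    ext x
    rcases x with x | x <;> simp [e, Equiv.permCongr_apply, Equiv.boolProdEquivSum]
  rw [h, Equiv.Perm.sign_permCongr, Equiv.Perm.sign_prodCongrRight]
  simp

/-- The form `σ_k η ∧ conj η` is real: conjugation exchanges the two blocks of covectors. -/
theorem conj_simplePositive (ψ : Fin k → Cn n →ₗ[ℂ] ℂ) (v : Fin (k + k) → Cn n) :
    conj (simplePositive ψ v) = simplePositive ψ v := by
  have h1 : Complex.conjAe.toLinearMap.compAlternatingMap (covectorDet (withConj ψ)) =
      (-1 : ℂ) ^ k • covectorDet (withConj ψ) := by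
    rw [conj_covectorDet, ← sign_sumComm, ← covectorDet_comp_perm]
    congr 1
    funext i
    rcases i with i | i
    · rfl
    · ext x
      simp [withConj]
  have h2 : ∀ w, conj (covectorDet (withConj ψ) w) = (-1 : ℂ) ^ k * covectorDet (withConj ψ) w :=
    fun w => AlternatingMap.congr_fun h1 w
  have h3 : conj (simpleConst k) = (-1 : ℂ) ^ k * simpleConst k := by
    rw [simpleConst, map_mul, map_pow, Complex.conj_I, neg_pow, map_inv₀, map_pow, map_ofNat,
      mul_assoc]
    congr 1
    rw [sq, pow_mul]
    rcases Nat.even_or_odd k with hk | hk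
    · rw [hk.neg_one_pow, one_pow]
    · rw [hk.neg_one_pow, hk.neg_one_pow]
  have h4 : ((-1 : ℂ) ^ k) * (-1) ^ k = 1 := by rw [← mul_pow]; simp
  rw [simplePositive_eq, AlternatingMap.smul_apply, smul_eq_mul, map_mul,
    AlternatingMap.domDomCongr_apply, h2, h3]
  change _ = simpleConst k * covectorDet (withConj ψ) (v ∘ finSumFinEquiv)
  linear_combination (simpleConst k * covectorDet (withConj ψ) (v ∘ finSumFinEquiv)) * h4

theorem withConj_matrix {ι : Type*} [Fintype ι] [DecidableEq ι] (ψ : ι → Cn n →ₗ[ℂ] ℂ)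
    (B : Matrix ι ι ℂ) :
    withConj (fun i => ∑ j, B i j • ψ j) =
      fun i => ∑ j, Matrix.fromBlocks B 0 0 (B.map conj) i j • withConj ψ j := by
  funext i
  ext v
  rcases i with i | i <;>
    simp [withConj, Fintype.sum_sum_type]

/-- `σ_k η ∧ conj η` is homogeneous of degree two in `η`. -/
theorem simplePositive_matrix (ψ : Fin k → Cn n →ₗ[ℂ] ℂ) (B : Matrix (Fin k) (Fin k) ℂ) :
    simplePositive (fun i => ∑ j, B i j • ψ j) =
      ((Complex.normSq B.det : ℝ) : ℂ) • simplePositive ψ := by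
  have h : (B.map conj).det = conj B.det := (RingHom.map_det (starRingEnd ℂ) B).symm
  rw [simplePositive_eq, simplePositive_eq, withConj_matrix, covectorDet_matrix,
    Matrix.det_fromBlocks_zero₁₂, h, Complex.mul_conj, smul_comm]
  rfl

theorem simplePositive_eq_zero {ψ : Fin k → Cn n →ₗ[ℂ] ℂ} (hψ : ¬ LinearIndependent ℂ ψ) :
    simplePositive ψ = 0 := by
  rw [Fintype.not_linearIndependent_iff] at hψ
  obtain ⟨c, hc, i, hi⟩ := hψ
  have h : covectorDet (withConj ψ) = 0 := by
    refine covectorDet_eq_zero (c := Sum.elim c 0) (fun h0 => hi (congrFun h0 (Sum.inl i))) ?_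
    ext v
    have := LinearMap.congr_fun hc v
    simpa [withConj, Fintype.sum_sum_type] using this
  rw [simplePositive_eq, h]
  ext v
  simp

end Simple

/-! ### Top degree forms and transversality -/

section TopForms

variable {n : ℕ}

/-- The coordinate covector `dz_j`. -/
abbrev coordCovector (n : ℕ) (j : Fin n) : Cn n →ₗ[ℂ] ℂ :=
  (EuclideanSpace.proj j : Cn n →L[ℂ] ℂ).toLinearMap

theorem eq_sum_coordCovector (ψ : Cn n →ₗ[ℂ] ℂ) :
    ψ = ∑ j, ψ (EuclideanSpace.single j 1) • coordCovector n j := by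
  refine (EuclideanSpace.basisFun (Fin n) ℂ).toBasis.ext fun i => ?_
  simp [coordCovector, Finset.sum_apply, PiLp.single_apply]

/-- A basis of the real vector space underlying `ℂⁿ`. -/
def realBasis (n : ℕ) : Module.Basis (Fin (n + n)) ℝ (Cn n) :=
  Module.finBasisOfFinrankEq ℝ (Cn n) (by
    rw [finrank_real_of_complex, finrank_euclideanSpace_fin, two_mul])

theorem volumeForm_realBasis_ne_zero (n : ℕ) : volumeForm n (realBasis n) ≠ 0 := by
  rw [volumeForm, simplePositive_eq, AlternatingMap.smul_apply, AlternatingMap.domDomCongr_apply]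
  refine smul_ne_zero (simpleConst_ne_zero n) ?_
  have h := covectorDet_basis_ne_zero ((realBasis n).reindex finSumFinEquiv.symm)
    (φ := withConj (coordCovector n)) fun c hc => ?_
  · convert h using 2
    ext i : 1
    simp
  · have h1 : ∀ (z : ℂ) (j : Fin n), c (Sum.inl j) * z + c (Sum.inr j) * conj z = 0 := by
      intro z j
      have := LinearMap.congr_fun hc (EuclideanSpace.single j z)
      simpa [withConj, Fintype.sum_sum_type, Finset.sum_apply, PiLp.single_apply,
        apply_ite conj] using this
    ext i
    have h2 := h1 1
    have h3 := h1 Complex.I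
    simp only [mul_one, map_one, Complex.conj_I] at h2 h3
    rcases i with j | j
    · have e : 2 * c (Sum.inl j) = 0 := by
        linear_combination h2 j - Complex.I * h3 j + (c (Sum.inl j) - c (Sum.inr j)) * Complex.I_sq
      simpa using e
    · have e : 2 * c (Sum.inr j) = 0 := by
        linear_combination h2 j + Complex.I * h3 j - (c (Sum.inl j) - c (Sum.inr j)) * Complex.I_sq
      simpa using e

/-- The space of top degree forms is one dimensional: forms are compared on one basis. -/
theorem topForm_ext {η η' : Cn n [⋀^Fin (n + n)]→ₗ[ℝ] ℂ} (h : η (realBasis n) = η' (realBasis n)) :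
    η = η' := by
  refine (realBasis n).ext_alternating fun v hv => ?_
  let π : Equiv.Perm (Fin (n + n)) := Equiv.ofBijective v (Finite.injective_iff_bijective.1 hv)
  have h1 := η.map_perm (realBasis n) π
  have h2 := η'.map_perm (realBasis n) π
  exact h1.trans ((congrArg _ h).trans h2.symm)

theorem simplePositive_top (χ : Fin n → Cn n →ₗ[ℂ] ℂ) :
    simplePositive χ = ((Complex.normSq (Matrix.det (Matrix.of fun i j =>
      χ i (EuclideanSpace.single j 1))) : ℝ) : ℂ) • volumeForm n := by
  rw [volumeForm, ← simplePositive_matrix]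
  congr 1
  funext i
  exact eq_sum_coordCovector (χ i)

theorem det_ne_zero_of_linearIndependent {χ : Fin n → Cn n →ₗ[ℂ] ℂ} (hχ : LinearIndependent ℂ χ) :
    Matrix.det (Matrix.of fun i j => χ i (EuclideanSpace.single j 1)) ≠ 0 := by
  intro h
  obtain ⟨c, hc, h0⟩ := Matrix.exists_vecMul_eq_zero_iff.2 h
  refine hc (funext fun i => Fintype.linearIndependent_iff.1 hχ c ?_ i)
  refine (EuclideanSpace.basisFun (Fin n) ℂ).toBasis.ext fun j => ?_
  have := congrFun h0 j
  simpa [Matrix.vecMul, dotProduct] using this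

theorem wedge_compLinearMap {k l : ℕ} (α : Cn n [⋀^Fin k]→ₗ[ℝ] ℂ) (β : Cn n [⋀^Fin l]→ₗ[ℝ] ℂ)
    (g : Cn n →ₗ[ℝ] Cn n) :
    (wedge α β).compLinearMap g = wedge (α.compLinearMap g) (β.compLinearMap g) := by
  ext v
  rw [AlternatingMap.compLinearMap_apply, wedge_apply, wedge_apply]
  rfl

theorem simplePositive_compLinearMap {k : ℕ} (ψ : Fin k → Cn n →ₗ[ℂ] ℂ) (g : Cn n →ₗ[ℂ] Cn n) :
    (simplePositive ψ).compLinearMap (g.restrictScalars ℝ) =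
      simplePositive fun i => ψ i ∘ₗ g := by
  ext v
  rw [AlternatingMap.compLinearMap_apply, simplePositive_eq, simplePositive_eq,
    AlternatingMap.smul_apply, AlternatingMap.smul_apply, AlternatingMap.domDomCongr_apply,
    AlternatingMap.domDomCongr_apply, covectorDet_apply, covectorDet_apply]
  congr 2
  ext i j
  rcases j with j | j <;> rfl

theorem volumeForm_compLinearMap (g : Cn n ≃ₗ[ℂ] Cn n) :
    ∃ r : ℝ, 0 < r ∧
      (volumeForm n).compLinearMap (g.toLinearMap.restrictScalars ℝ) = r • volumeForm n := by
  have h := simplePositive_compLinearMap (coordCovector n) g.toLinearMap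
  rw [simplePositive_top fun i => coordCovector n i ∘ₗ g.toLinearMap] at h
  refine ⟨_, (Complex.normSq_nonneg _).lt_of_ne' fun h0 => volumeForm_realBasis_ne_zero n ?_, h⟩
  rw [h0] at h
  have h1 := AlternatingMap.congr_fun h fun i => g.symm (realBasis n i)
  simpa [volumeForm] using h1

end TopForms

section Transverse

variable {n p : ℕ}

/-- Transversality is invariant under complex linear changes of coordinates. -/
theorem IsTransverse.compEquiv {α β : AltForm n (2 * p)} (hα : IsTransverse α)
    (g : Cn n ≃ₗ[ℂ] Cn n) (hβ : ∀ v, β v = α fun i => g (v i)) : IsTransverse β := by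
  intro k h ψ hψ
  obtain ⟨c, hc, e⟩ := hα k h (fun i => ψ i ∘ₗ g.symm.toLinearMap) (by
    refine Fintype.linearIndependent_iff.2 fun a ha => Fintype.linearIndependent_iff.1 hψ a ?_
    ext v
    have := LinearMap.congr_fun ha (g v)
    simpa using this)
  obtain ⟨r, hr, e'⟩ := volumeForm_compLinearMap g
  refine ⟨c * r, mul_pos hc hr, ?_⟩
  have h1 : β.toAlternatingMap =
      α.toAlternatingMap.compLinearMap (g.toLinearMap.restrictScalars ℝ) := by
    ext v
    exact hβ v
  have h2 : simplePositive ψ = (simplePositive fun i => ψ i ∘ₗ g.symm.toLinearMap).compLinearMap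
      (g.toLinearMap.restrictScalars ℝ) := by
    rw [simplePositive_compLinearMap]
    congr 1
    funext i
    ext v
    simp
  rw [h1, h2, ← wedge_compLinearMap, mul_smul, ← e']
  ext v
  exact AlternatingMap.congr_fun e fun i => g (v i)

theorem IsTransverse.isWeaklyPositive {α : AltForm n (2 * p)} (hα : IsTransverse α) :
    IsWeaklyPositive α := by
  intro k h ψ
  by_cases hψ : LinearIndependent ℂ ψ
  · obtain ⟨c, hc, e⟩ := hα k h ψ hψ
    exact ⟨c, hc.le, e⟩
  · refine ⟨0, le_rfl, ?_⟩
    rw [simplePositive_eq_zero hψ]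
    ext v
    simp [wedge_apply]

theorem isWeaklyPositive_zero : IsWeaklyPositive (0 : AltForm n (2 * p)) := by
  intro k h ψ
  refine ⟨0, le_rfl, ?_⟩
  ext v
  simp [wedge_apply]

theorem wedge_smul_add_smul {k l : ℕ} (a b : ℝ) (α β : AltForm n k) (γ : Cn n [⋀^Fin l]→ₗ[ℝ] ℂ) :
    wedge (a • α + b • β).toAlternatingMap γ =
      a • wedge α.toAlternatingMap γ + b • wedge β.toAlternatingMap γ := by
  ext v
  simp only [AlternatingMap.smul_apply, AlternatingMap.add_apply, wedge_apply, Finset.smul_sum,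
    ← Finset.sum_add_distrib]
  refine Finset.sum_congr rfl fun s _ => ?_
  simp only [ContinuousAlternatingMap.coe_toAlternatingMap, ContinuousAlternatingMap.add_apply,
    ContinuousAlternatingMap.smul_apply, Complex.real_smul]
  ring

theorem IsWeaklyPositive.smul_add_smul {α β : AltForm n (2 * p)} (hα : IsWeaklyPositive α)
    (hβ : IsWeaklyPositive β) {a b : ℝ} (ha : 0 ≤ a) (hb : 0 ≤ b) :
    IsWeaklyPositive (a • α + b • β) := by
  intro k h ψ
  obtain ⟨c, hc, e⟩ := hα k h ψ
  obtain ⟨c', hc', e'⟩ := hβ k h ψ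
  refine ⟨a * c + b * c', by positivity, ?_⟩
  rw [wedge_smul_add_smul, add_smul, mul_smul, mul_smul, ← e, ← e']
  rfl

theorem IsWeaklyPositive.smul {α : AltForm n (2 * p)} (hα : IsWeaklyPositive α) {a : ℝ}
    (ha : 0 ≤ a) : IsWeaklyPositive (a • α) := by
  have h := hα.smul_add_smul isWeaklyPositive_zero ha zero_le_one
  have e : a • α + (1 : ℝ) • (0 : AltForm n (2 * p)) = a • α := by
    ext v
    simp
  rwa [e] at h

theorem IsTransverse.smul_add_smul {α β : AltForm n (2 * p)} (hα : IsTransverse α)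
    (hβ : IsWeaklyPositive β) {a b : ℝ} (ha : 0 < a) (hb : 0 ≤ b) :
    IsTransverse (a • α + b • β) := by
  intro k h ψ hψ
  obtain ⟨c, hc, e⟩ := hα k h ψ hψ
  obtain ⟨c', hc', e'⟩ := hβ k h ψ
  refine ⟨a * c + b * c', by positivity, ?_⟩
  rw [wedge_smul_add_smul, add_smul, mul_smul, mul_smul, ← e, ← e']
  rfl

/-- The quotient of `α ∧ σ_k ψ₁ ∧ … ∧ ψ_k ∧ conj (ψ₁ ∧ … ∧ ψ_k)` by the volume form. -/
def wedgeDensity {k : ℕ} (h : 2 * p + (k + k) = n + n) (α : AltForm n (2 * p))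
    (ψ : Fin k → Cn n →ₗ[ℂ] ℂ) : ℝ :=
  ((wedge α.toAlternatingMap (simplePositive ψ)).domDomCongr (finCongr h) (realBasis n) /
    volumeForm n (realBasis n)).re

theorem wedgeDensity_eq {k : ℕ} {h : 2 * p + (k + k) = n + n} {α : AltForm n (2 * p)}
    {ψ : Fin k → Cn n →ₗ[ℂ] ℂ} {c : ℝ}
    (hc : (wedge α.toAlternatingMap (simplePositive ψ)).domDomCongr (finCongr h) =
      c • volumeForm n) : wedgeDensity h α ψ = c := by
  rw [wedgeDensity, hc, AlternatingMap.smul_apply, Complex.real_smul,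
    mul_div_assoc, div_self (volumeForm_realBasis_ne_zero n), mul_one, Complex.ofReal_re]

/-- The multiple of the volume form is real, because both factors of the wedge product are. -/
theorem wedge_simplePositive_eq {k : ℕ} (h : 2 * p + (k + k) = n + n) {α : AltForm n (2 * p)}
    (hα : conjForm α = α) (ψ : Fin k → Cn n →ₗ[ℂ] ℂ) :
    (wedge α.toAlternatingMap (simplePositive ψ)).domDomCongr (finCongr h) =
      wedgeDensity h α ψ • volumeForm n := by
  refine topForm_ext ?_
  have h1 : conj ((wedge α.toAlternatingMap (simplePositive ψ)).domDomCongr (finCongr h)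
      (realBasis n)) =
      (wedge α.toAlternatingMap (simplePositive ψ)).domDomCongr (finCongr h) (realBasis n) := by
    rw [AlternatingMap.domDomCongr_apply, wedge_apply, map_sum]
    refine Finset.sum_congr rfl fun s _ => ?_
    rw [map_mul, map_mul, conj_simplePositive, ContinuousAlternatingMap.coe_toAlternatingMap,
      ← conjForm_apply, hα]
    simp
  have h2 : conj (volumeForm n (realBasis n)) = volumeForm n (realBasis n) :=
    conj_simplePositive _ _
  rw [AlternatingMap.smul_apply, Complex.real_smul, wedgeDensity,
    Complex.conj_eq_iff_re.1 (by rw [map_div₀, h1, h2]),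
    div_mul_cancel₀ _ (volumeForm_realBasis_ne_zero n)]

/-- The covector `⟪g, ·⟫`. -/
def innerCovector (g : Cn n) : Cn n →ₗ[ℂ] ℂ := (innerSL ℂ g).toLinearMap

theorem innerCovector_apply (g v : Cn n) : innerCovector g v = inner ℂ g v := rfl

theorem continuous_wedgeDensity {k : ℕ} (h : 2 * p + (k + k) = n + n) :
    Continuous fun x : AltForm n (2 * p) × (Fin k → Cn n) =>
      wedgeDensity h x.1 fun i => innerCovector (x.2 i) := by
  refine Complex.continuous_re.comp (Continuous.div_const ?_ _)
  simp only [AlternatingMap.domDomCongr_apply, wedge_apply]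
  refine continuous_finsetSum _ fun s _ => continuous_const.mul (Continuous.mul ?_ ?_)
  · exact (ContinuousAlternatingMap.apply ℝ (Cn n) ℂ _).continuous.comp continuous_fst
  · simp only [simplePositive_eq, AlternatingMap.smul_apply, AlternatingMap.domDomCongr_apply,
      covectorDet_apply]
    refine continuous_const.mul (Continuous.matrix_det (continuous_matrix fun i j => ?_))
    have h1 : ∀ (w : Cn n) (j : Fin k), Continuous fun x : AltForm n (2 * p) × (Fin k → Cn n) =>
        inner ℂ (x.2 j) w := fun w j =>
      (continuous_apply j |>.comp continuous_snd).inner continuous_const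
    rcases j with j | j
    · exact h1 _ j
    · exact Complex.continuous_conj.comp (h1 _ j)

/-- The families `ψ` which are orthonormal suffice, by the Gram–Schmidt process and the homogeneity
of `σ_k η ∧ conj η`. -/
theorem isTransverse_of_orthonormal {k : ℕ} (h : 2 * p + (k + k) = n + n) {α : AltForm n (2 * p)}
    (hα : conjForm α = α)
    (H : ∀ g : Fin k → Cn n, Orthonormal ℂ g → 0 < wedgeDensity h α fun i => innerCovector (g i)) :
    IsTransverse α := by
  intro k' h' ψ hψ
  obtain rfl : k' = k := by omega
  let D := InnerProductSpace.toDual ℂ (Cn n)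
  let g : Fin k' → Cn n := fun i => D.symm (LinearMap.toContinuousLinearMap (ψ i))
  have hg : ∀ i, innerCovector (g i) = ψ i := by
    intro i
    ext v
    simp [innerCovector_apply, g, D]
  have hgl : LinearIndependent ℂ g := by
    refine Fintype.linearIndependent_iff.2 fun a ha i => ?_
    have h1 := Fintype.linearIndependent_iff.1 hψ (fun i => conj (a i)) (by
      ext v
      have := congrArg (fun w => inner ℂ w v) ha
      simp only [sum_inner, inner_smul_left, inner_zero_left] at this
      simpa [← hg, innerCovector_apply] using this) i
    simpa using h1
  set f := InnerProductSpace.gramSchmidtNormed ℂ g with hf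
  have hfo : Orthonormal ℂ f := InnerProductSpace.gramSchmidtNormed_orthonormal hgl
  have hspan : ∀ i, ∃ a : Fin k' → ℂ, ∑ j, a j • f j = g i := by
    intro i
    rw [← Submodule.mem_span_range_iff_exists_fun, hf,
      InnerProductSpace.span_gramSchmidtNormed_range,
      InnerProductSpace.span_gramSchmidt]
    exact Submodule.subset_span ⟨i, rfl⟩
  choose a ha using hspan
  let B : Matrix (Fin k') (Fin k') ℂ := Matrix.of fun i j => conj (a i j)
  have hB : ψ = fun i => ∑ j, B i j • innerCovector (f j) := by
    funext i
    ext v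
    rw [← hg i, innerCovector_apply, ← ha i, sum_inner]
    simp [inner_smul_left, innerCovector_apply, B]
  have hdet : B.det ≠ 0 := by
    intro h0
    obtain ⟨c, hc, hc0⟩ := Matrix.exists_vecMul_eq_zero_iff.2 h0
    refine hc (funext fun i => Fintype.linearIndependent_iff.1 hψ c ?_ i)
    rw [hB]
    simp only [Finset.smul_sum, smul_smul]
    rw [Finset.sum_comm]
    refine Finset.sum_eq_zero fun j _ => ?_
    rw [← Finset.sum_smul]
    have := congrFun hc0 j
    simp only [Matrix.vecMul, dotProduct] at this
    rw [this]
    simp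
  refine ⟨Complex.normSq B.det * wedgeDensity h α fun i => innerCovector (f i),
    mul_pos (Complex.normSq_pos.2 hdet) (H f hfo), ?_⟩
  rw [hB, simplePositive_matrix, wedge_smul_right, mul_smul, ← wedge_simplePositive_eq h hα]
  rfl

theorem isCompact_orthonormal (k : ℕ) : IsCompact {g : Fin k → Cn n | Orthonormal ℂ g} := by
  refine Metric.isCompact_of_isClosed_isBounded ?_ ?_
  · simp only [orthonormal_iff_ite, ofPred_forall]
    refine isClosed_iInter fun i => isClosed_iInter fun j => isClosed_eq ?_ continuous_const
    exact (continuous_apply i).inner (continuous_apply j)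
  · refine (Metric.isBounded_closedBall (x := (0 : Fin k → Cn n)) (r := 1)).subset fun g hg => ?_
    rw [mem_closedBall_zero_iff, pi_norm_le_iff_of_nonneg zero_le_one]
    exact fun i => (hg.1 i).le

/-- Transversality is an open condition on real forms. -/
theorem exists_isOpen_iff_isTransverse (n p : ℕ) : ∃ U : Set (AltForm n (2 * p)), IsOpen U ∧
    ∀ α, conjForm α = α → (α ∈ U ↔ IsTransverse α) := by
  by_cases hp : p ≤ n
  · have h : 2 * p + ((n - p) + (n - p)) = n + n := by omega
    refine ⟨{α | ∀ g ∈ {g : Fin (n - p) → Cn n | Orthonormal ℂ g},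
      0 < wedgeDensity h α fun i => innerCovector (g i)}, ?_, fun α hα => ⟨fun H => ?_, ?_⟩⟩
    · rw [isOpen_iff_eventually]
      intro α hα
      refine (isCompact_orthonormal (n - p)).eventually_forall_of_forall_eventually fun g hg => ?_
      exact (continuous_wedgeDensity h).continuousAt.eventually (lt_mem_nhds (hα g hg))
    · exact isTransverse_of_orthonormal h hα H
    · intro H g hg
      have hl : LinearIndependent ℂ fun i => innerCovector (g i) := by
        refine Fintype.linearIndependent_iff.2 fun a ha i => ?_
        have h1 := Fintype.linearIndependent_iff.1 hg.linearIndependent (fun i => conj (a i)) (by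
          refine ext_inner_right ℂ fun v => ?_
          have := LinearMap.congr_fun ha v
          simpa [sum_inner, inner_smul_left, innerCovector_apply] using this) i
        simpa using h1
      obtain ⟨c, hc, e⟩ := H _ h _ hl
      rwa [wedgeDensity_eq e]
  · refine ⟨univ, isOpen_univ, fun α _ => ⟨fun _ k h => ?_, fun _ => mem_univ _⟩⟩
    omega

end Transverse

/-! ### Existence of transverse forms -/

section Existence

variable {n p k : ℕ}

theorem sum_alternatingMap_apply {ι : Type*} (s : Finset ι) (f : ι → Cn n [⋀^Fin k]→ₗ[ℝ] ℂ)
    (v : Fin k → Cn n) : (∑ i ∈ s, f i) v = ∑ i ∈ s, f i v :=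
  map_sum (⟨⟨fun g => g v, rfl⟩, fun _ _ => rfl⟩ : (Cn n [⋀^Fin k]→ₗ[ℝ] ℂ) →+ ℂ) f s

/-- The form `σ_p φ₁ ∧ … ∧ φ_p ∧ conj (φ₁ ∧ … ∧ φ_p)`, as a `(p, p)`-form. -/
def simplePP (φ : Fin p → Cn n →ₗ[ℂ] ℂ) : Cn n [⋀^Fin (2 * p)]→ₗ[ℝ] ℂ :=
  (simplePositive φ).domDomCongr (finCongr (two_mul p).symm)

theorem continuous_simplePP (φ : Fin p → Cn n →ₗ[ℂ] ℂ) : Continuous (simplePP φ) := by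
  have h : (simplePP φ : (Fin (2 * p) → Cn n) → ℂ) = fun v => simpleConst p *
      covectorDet (withConj φ) fun i => v (finCongr (two_mul p).symm (finSumFinEquiv i)) := by
    funext v
    rw [simplePP, simplePositive_eq]
    rfl
  rw [h]
  exact continuous_const.mul ((continuous_covectorDet _).comp
    (continuous_pi fun i => continuous_apply _))

theorem simplePP_smul (φ : Fin p → Cn n →ₗ[ℂ] ℂ) (z : ℂ) (v : Fin (2 * p) → Cn n) :
    simplePP φ (fun i => z • v i) = z ^ p * conj z ^ p * simplePP φ v := by
  have h := covectorDet_smul_apply (withConj φ) (Sum.elim (fun _ => z) fun _ => conj z) z (by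
    intro j w
    rcases j with j | j <;> simp [withConj]) fun i =>
      v (finCongr (two_mul p).symm (finSumFinEquiv i))
  rw [simplePP, simplePositive_eq]
  simp only [Fintype.prod_sum_type, Sum.elim_inl, Sum.elim_inr, Finset.prod_const,
    Finset.card_univ, Fintype.card_fin] at h
  change simpleConst p * covectorDet (withConj φ) (fun i =>
    z • v (finCongr (two_mul p).symm (finSumFinEquiv i))) = _ * (simpleConst p *
      covectorDet (withConj φ) (fun i => v (finCongr (two_mul p).symm (finSumFinEquiv i))))
  rw [h]
  ring

theorem conj_simplePP (φ : Fin p → Cn n →ₗ[ℂ] ℂ) (v : Fin (2 * p) → Cn n) :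
    conj (simplePP φ v) = simplePP φ v :=
  conj_simplePositive φ _

/-- `(φ ∧ conj φ) ∧ (ψ ∧ conj ψ)` and `(φ ∧ ψ) ∧ conj (φ ∧ ψ)` agree up to a real constant which
depends on the degrees only: the sign of a permutation of the covectors and a power of `i²`. -/
theorem exists_wedge_simplePP (p k : ℕ) (h : 2 * p + (k + k) = (p + k) + (p + k)) :
    ∃ t : ℝ, t ≠ 0 ∧ ∀ (φ : Fin p → Cn (p + k) →ₗ[ℂ] ℂ) (ψ : Fin k → Cn (p + k) →ₗ[ℂ] ℂ),
      (wedge (simplePP φ) (simplePositive ψ)).domDomCongr (finCongr h) =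
        t • simplePositive (Sum.elim φ ψ ∘ finSumFinEquiv.symm) := by
  let e₁ : (Fin p ⊕ Fin p) ⊕ (Fin k ⊕ Fin k) ≃ Fin ((p + k) + (p + k)) :=
    (Equiv.sumCongr (finSumFinEquiv.trans (finCongr (two_mul p).symm)) finSumFinEquiv).trans
      (finSumFinEquiv.trans (finCongr h))
  let e₂ : (Fin p ⊕ Fin p) ⊕ (Fin k ⊕ Fin k) ≃ Fin ((p + k) + (p + k)) :=
    (Equiv.sumSumSumComm _ _ _ _).trans
      ((Equiv.sumCongr finSumFinEquiv finSumFinEquiv).trans finSumFinEquiv)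
  let s : ℤ := Equiv.Perm.sign (e₁.symm.trans e₂)
  have hs : s ≠ 0 := Units.ne_zero _
  refine ⟨(-1) ^ (p * k) * s, mul_ne_zero (by simp) (by exact_mod_cast hs), fun φ ψ => ?_⟩
  have h1 : simplePP φ = simpleConst p •
      covectorDet (withConj φ ∘ (finSumFinEquiv.trans (finCongr (two_mul p).symm)).symm) := by
    rw [← covectorDet_domDomCongr, simplePP, simplePositive_eq]
    rfl
  have h2 : simplePositive ψ =
      simpleConst k • covectorDet (withConj ψ ∘ finSumFinEquiv.symm) := by
    rw [← covectorDet_domDomCongr, simplePositive_eq]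
  have h3 : simplePositive (Sum.elim φ ψ ∘ finSumFinEquiv.symm) =
      simpleConst (p + k) • covectorDet (Sum.elim (withConj φ) (withConj ψ) ∘ e₂.symm) := by
    rw [simplePositive_eq, covectorDet_domDomCongr]
    congr 2
    funext i
    simp only [e₂, Function.comp_apply, Equiv.symm_trans_apply]
    rcases finSumFinEquiv.symm i with j | j <;>
    · simp only [withConj, Sum.elim_inl, Sum.elim_inr, Equiv.sumCongr_symm, Equiv.sumCongr_apply,
        Sum.map_inl, Sum.map_inr, Function.comp_apply]
      rcases finSumFinEquiv.symm j with l | l <;> rfl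
  have h4 : Sum.elim (withConj φ ∘ (finSumFinEquiv.trans (finCongr (two_mul p).symm)).symm)
      (withConj ψ ∘ finSumFinEquiv.symm) ∘ (finSumFinEquiv.trans (finCongr h)).symm =
      (Sum.elim (withConj φ) (withConj ψ) ∘ e₂.symm) ∘ (e₁.symm.trans e₂) := by
    funext i
    simp only [e₁, Function.comp_apply, Equiv.symm_trans_apply, Equiv.trans_apply,
      Equiv.symm_apply_apply]
    rcases finSumFinEquiv.symm ((finCongr h).symm i) with j | j <;> rfl
  have h5 : (covectorDet (Sum.elim
      (withConj φ ∘ (finSumFinEquiv.trans (finCongr (two_mul p).symm)).symm)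
      (withConj ψ ∘ finSumFinEquiv.symm))).domDomCongr (finSumFinEquiv.trans (finCongr h)) =
      (s : ℂ) • covectorDet (Sum.elim (withConj φ) (withConj ψ) ∘ e₂.symm) := by
    rw [covectorDet_domDomCongr, h4, covectorDet_comp_perm]
  rw [h1, h2, wedge_smul_left, wedge_smul_right, wedge_covectorDet, h3]
  ext v
  have h6 := AlternatingMap.congr_fun h5 v
  simp only [AlternatingMap.smul_apply, AlternatingMap.domDomCongr_apply, smul_eq_mul,
    Complex.real_smul] at h6 ⊢
  push_cast
  rw [Equiv.coe_trans, ← Function.comp_assoc] at h6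
  linear_combination simpleConst p * simpleConst k * h6 + (s : ℂ) *
    covectorDet (Sum.elim (withConj φ) (withConj ψ) ∘ e₂.symm) v * simpleConst_mul p k

/-- Linearly independent covectors are completed to a basis by coordinate covectors. -/
theorem exists_linearIndependent_elim {ψ : Fin k → Cn (p + k) →ₗ[ℂ] ℂ}
    (hψ : LinearIndependent ℂ ψ) : ∃ J : Fin p → Fin (p + k),
      LinearIndependent ℂ (Sum.elim (fun i => coordCovector (p + k) (J i)) ψ) := by
  classical
  let w : Fin (p + k) ⊕ Fin k → Cn (p + k) →ₗ[ℂ] ℂ := Sum.elim (coordCovector (p + k)) ψ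
  have hs : LinearIndepOn ℂ w (range Sum.inr) := by
    rw [linearIndepOn_range_iff Sum.inr_injective]
    exact hψ
  obtain ⟨b, -, hsb, hspan, hb⟩ := exists_linearIndepOn_extension hs (subset_univ _)
  have htop : ⊤ ≤ Submodule.span ℂ (range fun i : b => w i) := by
    intro φ _
    have h1 : φ ∈ Submodule.span ℂ (w '' univ) := by
      rw [eq_sum_coordCovector φ]
      exact Submodule.sum_mem _ fun j _ => Submodule.smul_mem _ _
        (Submodule.subset_span ⟨Sum.inl j, mem_univ _, rfl⟩)
    have h2 := Submodule.span_le.2 hspan h1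
    rwa [image_eq_range] at h2
  have hcard : Fintype.card b = p + k := by
    rw [← Module.finrank_eq_card_basis (Module.Basis.mk hb htop)]
    exact (Subspace.dual_finrank_eq (K := ℂ) (V := Cn (p + k))).trans finrank_euclideanSpace_fin
  let S := {i : Fin (p + k) // Sum.inl i ∈ b}
  have hinr : ∀ j, Sum.inr j ∈ b := fun j => hsb ⟨j, rfl⟩
  let f : S ⊕ Fin k → b := Sum.elim (fun i => ⟨Sum.inl i.1, i.2⟩) fun j => ⟨Sum.inr j, hinr j⟩
  have hf : Function.Bijective f := by
    constructor
    · rintro (i | i) (j | j) hij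
      · have := Subtype.ext_iff.1 hij
        exact congrArg Sum.inl (Subtype.ext (Sum.inl_injective this))
      · cases Subtype.ext_iff.1 hij
      · cases Subtype.ext_iff.1 hij
      · have := Subtype.ext_iff.1 hij
        exact congrArg Sum.inr (Sum.inr_injective this)
    · rintro ⟨i | i, hi⟩
      · exact ⟨Sum.inl ⟨i, hi⟩, rfl⟩
      · exact ⟨Sum.inr i, rfl⟩
  have hS : Fintype.card S = p := by
    have := Fintype.card_of_bijective hf
    rw [Fintype.card_sum, Fintype.card_fin, hcard] at this
    omega
  let e : Fin p ≃ S := (Fintype.equivFinOfCardEq hS).symm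
  refine ⟨fun i => (e i).1, ?_⟩
  have h := hb.comp (fun x : Fin p ⊕ Fin k => f (Sum.map e id x))
    (hf.1.comp (Sum.map_injective.2 ⟨e.injective, Function.injective_id⟩))
  have heq : Sum.elim (fun i => coordCovector (p + k) (e i).1) ψ =
      fun x => w (f (Sum.map e id x)).1 := by
    funext x
    rcases x with x | x <;> rfl
  rw [heq]
  exact h

/-- Up to a real constant, the sum of the forms `σ_p dz_J ∧ conj dz_J` is transverse. -/
theorem exists_isTransverse (n p : ℕ) :
    ∃ α : AltForm n (2 * p), conjForm α = α ∧ IsType p p α ∧ IsTransverse α := by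
  by_cases hp : p ≤ n
  · obtain ⟨k, rfl⟩ := Nat.exists_eq_add_of_le hp
    have h : 2 * p + (k + k) = (p + k) + (p + k) := by ring
    obtain ⟨t, ht, H⟩ := exists_wedge_simplePP p k h
    let A : Cn (p + k) [⋀^Fin (2 * p)]→ₗ[ℝ] ℂ :=
      t • ∑ J : Fin p → Fin (p + k), simplePP fun i => coordCovector (p + k) (J i)
    have hA : ∀ v, A v = t * ∑ J : Fin p → Fin (p + k),
        simplePP (fun i => coordCovector (p + k) (J i)) v := fun v => by
      rw [AlternatingMap.smul_apply, sum_alternatingMap_apply, Complex.real_smul]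
    have hAc : Continuous A := by
      rw [show (A : (Fin (2 * p) → Cn (p + k)) → ℂ) = _ from funext hA]
      exact continuous_const.mul (continuous_finsetSum _ fun J _ => continuous_simplePP _)
    let α : AltForm (p + k) (2 * p) :=
      { A with
        cont := hAc }
    have hα : ∀ v, α v = A v := fun v => rfl
    refine ⟨α, ?_, ?_, ?_⟩
    · ext v
      rw [conjForm_apply, hα, hA, map_mul, map_sum, Complex.conj_ofReal]
      simp only [conj_simplePP]
    · intro z v
      rw [hα, hα, hA, hA]
      simp only [simplePP_smul, ← Finset.mul_sum]
      ring
    · intro k' h' ψ hψ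
      obtain rfl : k' = k := by omega
      let N : (Fin p → Fin (p + k')) → ℝ := fun J => Complex.normSq (Matrix.det (Matrix.of fun i j =>
        (Sum.elim (fun i => coordCovector (p + k') (J i)) ψ ∘ finSumFinEquiv.symm) i
          (EuclideanSpace.single j 1)))
      refine ⟨t * t * ∑ J, N J, ?_, ?_⟩
      · refine mul_pos (mul_self_pos.2 ht) ?_
        obtain ⟨J, hJ⟩ := exists_linearIndependent_elim hψ
        refine Finset.sum_pos' (fun J _ => Complex.normSq_nonneg _) ⟨J, Finset.mem_univ _, ?_⟩
        exact Complex.normSq_pos.2 (det_ne_zero_of_linearIndependent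
          (hJ.comp _ finSumFinEquiv.symm.injective))
      · have h1 : ∀ J : Fin p → Fin (p + k'),
            (wedge (simplePP fun i => coordCovector (p + k') (J i))
              (simplePositive ψ)).domDomCongr (finCongr h') = (t * N J) • volumeForm (p + k') := by
          intro J
          rw [H, simplePositive_top, mul_smul]
          rfl
        ext v
        have h2 : wedge α.toAlternatingMap (simplePositive ψ) = t • ∑ J : Fin p → Fin (p + k'),
            wedge (simplePP fun i => coordCovector (p + k') (J i)) (simplePositive ψ) := by
          ext w
          rw [AlternatingMap.smul_apply, sum_alternatingMap_apply, wedge_apply]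
          simp only [wedge_apply, ContinuousAlternatingMap.coe_toAlternatingMap, hα, hA]
          rw [Finset.sum_comm, Complex.real_smul, Finset.mul_sum]
          refine Finset.sum_congr rfl fun s _ => ?_
          rw [Finset.mul_sum, Finset.mul_sum, Finset.sum_mul, Finset.mul_sum]
          exact Finset.sum_congr rfl fun J _ => by ring
        have h3 := fun J => AlternatingMap.congr_fun (h1 J) v
        simp only [AlternatingMap.domDomCongr_apply, AlternatingMap.smul_apply] at h3 ⊢
        rw [h2, AlternatingMap.smul_apply, sum_alternatingMap_apply, Finset.sum_congr rfl fun J _ => h3 J,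
          ← Finset.sum_smul, ← Finset.mul_sum, smul_smul, mul_assoc]
  · refine ⟨0, map_zero _, fun z v => by simp, fun k h => ?_⟩
    omega

end Existence

/-! ### Transverse forms on the manifold -/

section TransverseForms

variable {n : ℕ} {X : Type*} [TopologicalSpace X] [ChartedSpace (Cn n) X]
  [IsManifold 𝓘(ℂ, Cn n) ω X] {p : ℕ}

/-- The derivative of a transition map as a complex linear automorphism of `ℂⁿ`. -/
theorem exists_equiv_fderiv_transition {e e' : OpenPartialHomeomorph X (Cn n)}
    (he : e ∈ atlas (Cn n) X) (he' : e' ∈ atlas (Cn n) X) {y : Cn n} (hy : y ∈ e.target)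
    (hy' : e.symm y ∈ e'.source) :
    ∃ g : Cn n ≃ₗ[ℂ] Cn n, ∀ v, g v = fderiv ℝ (e' ∘ e.symm) y v := by
  let f : Cn n →ₗ[ℂ] Cn n :=
    { toFun := fderiv ℝ (e' ∘ e.symm) y
      map_add' := map_add _
      map_smul' := fderiv_transition_smul he he' hy hy' }
  have hinj : Function.Injective f := by
    have h1 := fderiv_transition_comp he he he' hy (e.map_target hy) hy'
    have h2 : fderiv ℝ (e ∘ e.symm) y = ContinuousLinearMap.id ℝ (Cn n) := by
      rw [← fderiv_id (𝕜 := ℝ) (x := y)]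
      apply Filter.EventuallyEq.fderiv_eq
      filter_upwards [e.open_target.mem_nhds hy] with z hz
      simp [e.right_inv hz]
    refine Function.LeftInverse.injective
      (g := fderiv ℝ (e ∘ e'.symm) (e' (e.symm y))) fun v => ?_
    exact (DFunLike.congr_fun (h1.symm.trans h2) v :)
  exact ⟨LinearEquiv.ofInjectiveEndo f hinj, fun v => rfl⟩

theorem isTransverse_of_chartRep {η : X → AltForm n (2 * p)} {e : OpenPartialHomeomorph X (Cn n)}
    (he : e ∈ atlas (Cn n) X) {y : Cn n} (hy : y ∈ e.target)
    (h : IsTransverse (chartRep η e y)) : IsTransverse (η (e.symm y)) := by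
  obtain ⟨g, hg⟩ := exists_equiv_fderiv_transition he (chart_mem_atlas (Cn n) (e.symm y)) hy
    (mem_chart_source _ _)
  refine h.compEquiv g.symm fun v => ?_
  rw [chartRep, ContinuousAlternatingMap.compContinuousLinearMap_apply]
  congr 1
  funext i
  exact ((hg _).symm.trans (g.apply_symm_apply (v i))).symm

omit [IsManifold 𝓘(ℂ, Cn n) ω X] in
/-- Joint continuity of the evaluation of forms in a chart. -/
theorem tendsto_chartRep {k : ℕ} (η₀ : SmoothForm n X k) (x₀ : X) :
    Tendsto (fun z : SmoothForm n X k × X => chartRep z.1 (chartAt (Cn n) x₀)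
      (chartAt (Cn n) x₀ z.2)) (𝓝 (η₀, x₀)) (𝓝 (η₀ x₀)) := by
  set e := chartAt (Cn n) x₀ with he
  have hx₀ : x₀ ∈ e.source := mem_chart_source _ x₀
  have hea : e ∈ atlas (Cn n) X := chart_mem_atlas _ x₀
  obtain ⟨L, hL, hLt, hLc⟩ := local_compact_nhds (e.open_target.mem_nhds (e.map_source hx₀))
  let j : JetIndex n X := ⟨e, hea, 0, L, hLc, hLt⟩
  have h1 : Tendsto (fun z : SmoothForm n X k × X => chartRep η₀ e (e z.2)) (𝓝 (η₀, x₀))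
      (𝓝 (η₀ x₀)) := by
    rw [← chartRep_chartAt η₀.toFun x₀, ← he]
    exact ((η₀.contDiffOn hea).continuousOn.continuousAt
      (e.open_target.mem_nhds (e.map_source hx₀))).tendsto.comp
        ((e.continuousAt hx₀).tendsto.comp continuous_snd.continuousAt.tendsto)
  have h2 : Tendsto (fun z : SmoothForm n X k × X => chartRep (z.1 - η₀).toFun e (e z.2))
      (𝓝 (η₀, x₀)) (𝓝 0) := by
    have h3 : Tendsto (fun z : SmoothForm n X k × X => jetSeminorm k j (z.1 - η₀)) (𝓝 (η₀, x₀))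
        (𝓝 0) := by
      have hc : Continuous fun z : SmoothForm n X k × X => jetSeminorm k j (z.1 - η₀) :=
        (continuous_jetSeminorm j).comp (continuous_fst.sub continuous_const)
      have := hc.tendsto (η₀, x₀)
      simpa using this
    refine squeeze_zero_norm' ?_ h3
    have h4 : ∀ᶠ z : SmoothForm n X k × X in 𝓝 (η₀, x₀), e z.2 ∈ L :=
      ((e.continuousAt hx₀).tendsto.comp
        (continuous_snd.tendsto (η₀, x₀))).eventually hL
    filter_upwards [h4] with z hz
    have := le_jetSeminorm (z.1 - η₀) j hz
    rwa [norm_iteratedFDeriv_zero] at this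
  refine (by simpa using h1.add h2 : Tendsto _ _ (𝓝 (η₀ x₀))).congr fun z => ?_
  ext v
  simp only [chartRep, ContinuousAlternatingMap.add_apply,
    ContinuousAlternatingMap.compContinuousLinearMap_apply]
  rw [← ContinuousAlternatingMap.add_apply]
  congr 1
  change η₀ _ + (z.1 _ - η₀ _) = _
  abel

/-- Transversality is an open condition on the form and the point together. -/
theorem eventually_isTransverse {Ω₀ : RealForm n X p} {x₀ : X}
    (h : IsTransverse (Ω₀.1 x₀)) :
    ∀ᶠ z : RealForm n X p × X in 𝓝 (Ω₀, x₀), IsTransverse (z.1.1 z.2) := by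
  obtain ⟨U, hU, hUt⟩ := exists_isOpen_iff_isTransverse n p
  have hreal : ∀ (Ω : RealForm n X p) (x : X), conjForm (Ω.1 x) = Ω.1 x := fun Ω x =>
    congrArg (fun η : SmoothForm n X (2 * p) => η x) Ω.2.1
  set e := chartAt (Cn n) x₀ with he
  have h1 : Tendsto (fun z : RealForm n X p × X => chartRep z.1.1 e (e z.2)) (𝓝 (Ω₀, x₀))
      (𝓝 (Ω₀.1 x₀)) :=
    (tendsto_chartRep Ω₀.1 x₀).comp ((continuous_subtype_val.prodMap continuous_id).tendsto
      (Ω₀, x₀))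
  have h2 : ∀ᶠ z : RealForm n X p × X in 𝓝 (Ω₀, x₀), z.2 ∈ e.source :=
    (continuous_snd.tendsto (Ω₀, x₀)).eventually
      (e.open_source.mem_nhds (mem_chart_source _ x₀))
  filter_upwards [h1.eventually (hU.mem_nhds ((hUt _ (hreal Ω₀ x₀)).2 h)), h2] with z hz hz2
  have h3 : conjForm (chartRep z.1.1.toFun e (e z.2)) = chartRep z.1.1.toFun e (e z.2) := by
    ext v
    exact DFunLike.congr_fun (hreal z.1 (e.symm (e z.2))) _
  have h4 := isTransverse_of_chartRep (chart_mem_atlas _ x₀) (e.map_source hz2) ((hUt _ h3).1 hz)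
  rwa [e.left_inv hz2] at h4

theorem isOpen_isTransverse (Ω : RealForm n X p) : IsOpen {x | IsTransverse (Ω.1 x)} := by
  rw [isOpen_iff_eventually]
  intro x hx
  exact (Continuous.prodMk_right Ω).continuousAt.eventually (eventually_isTransverse hx)

/-- The real `(p, p)`-forms which are transverse on `K`. -/
def transverseOn (K : Set X) (p : ℕ) : Set (RealForm n X p) :=
  {Ω | ∀ x ∈ K, IsTransverse (Ω.1 x)}

theorem isOpen_transverseOn {K : Set X} (hK : IsCompact K) :
    IsOpen (transverseOn K p : Set (RealForm n X p)) := by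
  rw [isOpen_iff_eventually]
  intro Ω hΩ
  exact hK.eventually_forall_of_forall_eventually fun x hx => eventually_isTransverse (hΩ x hx)

omit [IsManifold 𝓘(ℂ, Cn n) ω X] in
theorem RealForm.smul_add_smul_apply (a b : ℝ) (Ω Θ : RealForm n X p) (x : X) :
    (a • Ω + b • Θ).1 x = a • Ω.1 x + b • Θ.1 x := by
  change (a • Ω.1 + b • Θ.1) x = _
  rw [SmoothForm.add_apply, SmoothForm.real_smul_apply, SmoothForm.real_smul_apply]

omit [IsManifold 𝓘(ℂ, Cn n) ω X] in
theorem convex_transverseOn (K : Set X) : Convex ℝ (transverseOn K p : Set (RealForm n X p)) := by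
  intro Ω hΩ Θ hΘ a b ha hb hab x hx
  rw [RealForm.smul_add_smul_apply]
  rcases ha.eq_or_lt with rfl | ha
  · rw [add_comm]
    exact (hΘ x hx).smul_add_smul (hΩ x hx).isWeaklyPositive (by linarith) le_rfl
  · exact (hΩ x hx).smul_add_smul (hΘ x hx).isWeaklyPositive ha hb

variable [T2Space X] [SecondCountableTopology X]

theorem exists_realForm_isTransverse_at (x₀ : X) (p : ℕ) : ∃ Ω : RealForm n X p,
    (∀ x, IsWeaklyPositive (Ω.1 x)) ∧ IsTransverse (Ω.1 x₀) := by
  obtain ⟨α, hα, hαt, hαp⟩ := exists_isTransverse n p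
  set e := chartAt (Cn n) x₀
  have he : e ∈ atlas (Cn n) X := chart_mem_atlas _ x₀
  obtain ⟨χ, hχ1, hχs, hχ01⟩ := exists_cutoff (n := n) (isClosed_singleton (x := x₀))
    e.open_source (singleton_subset_iff.2 (mem_chart_source _ x₀))
  let η : SmoothForm n X (2 * p) := chartForm he isOpen_univ (χ := χ) (f := fun _ => α)
    (by simpa using hχs) contDiffOn_const
  have hη : ∀ x, η x = χ x • α.compContinuousLinearMap
      (fderiv ℝ (e ∘ (chartAt (Cn n) x).symm) (chartAt (Cn n) x x)) := fun x => rfl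
  have hsrc : ∀ x, χ x ≠ 0 → x ∈ e.source := fun x hx =>
    hχs (subset_tsupport _ (Function.mem_support.2 hx))
  have hg : ∀ x, x ∈ e.source → ∃ g : Cn n ≃ₗ[ℂ] Cn n, ∀ v, g v =
      fderiv ℝ (e ∘ (chartAt (Cn n) x).symm) (chartAt (Cn n) x x) v := by
    intro x hx
    refine exists_equiv_fderiv_transition (chart_mem_atlas _ x) he (mem_chart_target _ x) ?_
    rwa [(chartAt (Cn n) x).left_inv (mem_chart_source _ x)]
  have hcomp : ∀ x, x ∈ e.source → IsTransverse (α.compContinuousLinearMap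
      (fderiv ℝ (e ∘ (chartAt (Cn n) x).symm) (chartAt (Cn n) x x))) := by
    intro x hx
    obtain ⟨g, hgx⟩ := hg x hx
    refine hαp.compEquiv g fun v => ?_
    simp only [hgx]
    rfl
  refine ⟨⟨η, ?_, ?_⟩, fun x => ?_, ?_⟩
  · change conjugate η = η
    ext x v
    rw [conjugate_apply, hη]
    have h := fun w => DFunLike.congr_fun hα w
    simp only [conjForm_apply] at h
    simp [h]
  · intro x z v
    by_cases hx : χ x = 0
    · have h0 : η x = 0 := by
        rw [hη]
        ext v
        simp [hx]
      simp [h0]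
    · obtain ⟨g, hgx⟩ := hg x (hsrc x hx)
      have h : ∀ w, η x w = χ x * α fun i => g (w i) := by
        intro w
        simp only [hgx]
        rw [hη, ContinuousAlternatingMap.smul_apply, Complex.real_smul]
        rfl
      rw [h, h]
      simp only [map_smul]
      rw [hαt]
      ring
  · change IsWeaklyPositive (η x)
    by_cases hx : χ x = 0
    · have h0 : η x = 0 := by
        rw [hη]
        ext v
        simp [hx]
      rw [h0]
      exact isWeaklyPositive_zero
    · rw [hη]
      exact (hcomp x (hsrc x hx)).isWeaklyPositive.smul (hχ01 x).1
  · change IsTransverse (η x₀)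
    have h1 : χ x₀ = 1 := (hχ1 x₀ rfl).self_of_nhds
    rw [hη, h1, one_smul]
    exact hcomp x₀ (mem_chart_source _ x₀)

/-- Forms that are transverse at a point and weakly positive everywhere can be added up over a finite
cover of `K`. -/
theorem transverseOn_nonempty {K : Set X} (hK : IsCompact K) (p : ℕ) :
    (transverseOn K p : Set (RealForm n X p)).Nonempty := by
  suffices h : ∃ Ω : RealForm n X p, (∀ x, IsWeaklyPositive (Ω.1 x)) ∧ Ω ∈ transverseOn K p from
    ⟨h.choose, h.choose_spec.2⟩
  have hadd : ∀ (Ω Θ : RealForm n X p) (x : X),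
      (Ω + Θ).1 x = (1 : ℝ) • Ω.1 x + (1 : ℝ) • Θ.1 x := by
    intro Ω Θ x
    rw [← RealForm.smul_add_smul_apply, one_smul, one_smul]
  refine hK.induction_on (p := fun s => ∃ Ω : RealForm n X p, (∀ x, IsWeaklyPositive (Ω.1 x)) ∧
    Ω ∈ transverseOn s p) ?_ ?_ ?_ ?_
  · exact ⟨0, fun _ => isWeaklyPositive_zero, fun _ hx => hx.elim⟩
  · rintro s t hst ⟨Ω, h1, h2⟩
    exact ⟨Ω, h1, fun x hx => h2 x (hst hx)⟩
  · rintro s t ⟨Ω, h1, h2⟩ ⟨Θ, h3, h4⟩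
    refine ⟨Ω + Θ, fun x => ?_, fun x hx => ?_⟩
    · rw [hadd]
      exact (h1 x).smul_add_smul (h3 x) zero_le_one zero_le_one
    · rw [hadd]
      rcases hx with hx | hx
      · exact (h2 x hx).smul_add_smul (h3 x) one_pos zero_le_one
      · rw [add_comm]
        exact (h4 x hx).smul_add_smul (h1 x) one_pos zero_le_one
  · intro x _
    obtain ⟨Ω, h1, h2⟩ := exists_realForm_isTransverse_at (n := n) x p
    exact ⟨_, mem_nhdsWithin_of_mem_nhds ((isOpen_isTransverse Ω).mem_nhds h2), Ω, h1,
      fun y hy => hy⟩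

end TransverseForms

/-! ### Supports of currents -/

section Supports

variable {n : ℕ} {X : Type*} [TopologicalSpace X] [ChartedSpace (Cn n) X] {p : ℕ}

/-- Multiplication of real `(p, p)`-forms by a smooth function. -/
def mulRealForm (f : SmoothFun n X) (Ω : RealForm n X p) : RealForm n X p :=
  ⟨mulForm f Ω.1, by
    refine ⟨?_, fun x z v => ?_⟩
    · change conjugate (mulForm f Ω.1) = mulForm f Ω.1
      ext x v
      have h : conj (Ω.1 x v) = Ω.1 x v :=
        DFunLike.congr_fun (congrArg (fun η : SmoothForm n X (2 * p) => η x) Ω.2.1) v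
      rw [conjugate_apply, mulForm_apply]
      simp [h]
    · have h := Ω.2.2 x z v
      simp only [mulForm_apply, ContinuousAlternatingMap.smul_apply, Complex.real_smul, h]
      ring⟩

theorem mulRealForm_apply (f : SmoothFun n X) (Ω : RealForm n X p) (x : X) :
    (mulRealForm f Ω).1 x = f x • Ω.1 x := rfl

variable [IsManifold 𝓘(ℂ, Cn n) ω X]

theorem continuous_ppPart : Continuous (ppPart (n := n) (X := X) p) :=
  Continuous.subtype_mk ((continuous_component p p).comp continuous_subtype_val) _

omit [TopologicalSpace X] [ChartedSpace (Cn n) X] [IsManifold 𝓘(ℂ, Cn n) ω X] in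
theorem typePart_of_isType {a b k : ℕ} (hab : a + b = k) {α : AltForm n k} (hα : IsType a b α) :
    typePart a b α = α := by
  ext v
  have h := typePart_apply_of_expansion hab (α := α) (v := v)
    (c := fun m => if m = a then α v else 0) fun z => by
      rw [hα, Finset.sum_eq_single a]
      · rw [if_pos rfl, show k - a = b by omega]
        ring
      · intro m _ hm
        rw [if_neg hm, zero_mul]
      · intro h
        exact absurd (Finset.mem_range.2 (by omega)) h
  rwa [if_pos rfl] at h

theorem ppPart_coe (Ω : RealForm n X p) : ppPart p ⟨Ω.1, Ω.2.1⟩ = Ω := by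
  refine Subtype.ext (SmoothForm.ext fun x => ?_)
  exact typePart_of_isType (by omega) (Ω.2.2 x)

theorem exists_compact_support_current (T : Current n X p) : ∃ L : Set X, IsCompact L ∧
    ∀ Ω : RealForm n X p, (∀ x ∈ L, ∀ᶠ z in 𝓝 x, Ω.1 z = 0) → T Ω = 0 := by
  obtain ⟨L, hL, h⟩ := exists_compact_support
    ((T.comp ⟨ppPart p, continuous_ppPart⟩).comp (realPart (2 * p)))
  refine ⟨L, hL, fun Ω hΩ => ?_⟩
  have h1 := norm_eq_zero.1 (h Ω.1 hΩ)
  have h2 : realPart (2 * p) Ω.1 = ⟨Ω.1, Ω.2.1⟩ := realPart_of_mem ⟨Ω.1, Ω.2.1⟩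
  change T (ppPart p (realPart (2 * p) Ω.1)) = 0 at h1
  rwa [h2, ppPart_coe] at h1

/-- `T` vanishes on the forms with compact support in `U`. -/
def VanishesOn (T : Current n X p) (U : Set X) : Prop :=
  ∀ α : RealForm n X p, HasCompactSupport (fun x => α.1 x) →
    tsupport (fun x => α.1 x) ⊆ U → T α = 0

variable [T2Space X] [SecondCountableTopology X]

theorem VanishesOn.union {T : Current n X p} {U V : Set X} (hU : IsOpen U) (hV : IsOpen V)
    (h1 : VanishesOn T U) (h2 : VanishesOn T V) : VanishesOn T (U ∪ V) := by
  intro α hαc hα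
  have hclosed : IsClosed (tsupport (fun x => α.1 x) \ V) :=
    (isClosed_tsupport _).sdiff hV
  obtain ⟨χ, hχ1, hχs, -⟩ := exists_cutoff (n := n) hclosed hU (by
    rintro x ⟨hx, hxV⟩
    exact (hα hx).resolve_right hxV)
  have hzero : ∀ x, x ∉ tsupport (fun x => α.1 x) → ∀ᶠ z in 𝓝 x, α.1 z = 0 := fun x hx =>
    notMem_tsupport_iff_eventuallyEq.1 hx
  have hsub : ∀ β : RealForm n X p, (∀ x, (∀ᶠ z in 𝓝 x, α.1 z = 0) → ∀ᶠ z in 𝓝 x, β.1 z = 0) →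
      tsupport (fun x => β.1 x) ⊆ tsupport (fun x => α.1 x) := by
    intro β hβ x hx
    by_contra hxα
    exact notMem_tsupport_iff_eventuallyEq.2 (hβ x (hzero x hxα)) hx
  have hcomp : ∀ β : RealForm n X p, (∀ x, (∀ᶠ z in 𝓝 x, α.1 z = 0) → ∀ᶠ z in 𝓝 x, β.1 z = 0) →
      HasCompactSupport (fun x => β.1 x) := fun β hβ =>
    hαc.of_isClosed_subset (isClosed_tsupport _) (hsub β hβ)
  have hβ1 : ∀ x, (∀ᶠ z in 𝓝 x, α.1 z = 0) → ∀ᶠ z in 𝓝 x, (mulRealForm χ α).1 z = 0 := by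
    intro x hx
    filter_upwards [hx] with z hz
    ext v
    simp [mulRealForm_apply, hz]
  have hβ2 : ∀ x, (∀ᶠ z in 𝓝 x, α.1 z = 0) →
      ∀ᶠ z in 𝓝 x, (α - mulRealForm χ α).1 z = 0 := by
    intro x hx
    filter_upwards [hx, hβ1 x hx] with z hz hz'
    change α.1 z - (mulRealForm χ α).1 z = 0
    rw [hz, hz', sub_zero]
  have e1 : T (mulRealForm χ α) = 0 := by
    refine h1 _ (hcomp _ hβ1) fun x hx => hχs ?_
    by_contra hxχ
    refine notMem_tsupport_iff_eventuallyEq.2 ?_ hx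
    filter_upwards [notMem_tsupport_iff_eventuallyEq.1 hxχ] with z hz
    ext v
    simp [mulRealForm_apply, hz]
  have e2 : T (α - mulRealForm χ α) = 0 := by
    refine h2 _ (hcomp _ hβ2) fun x hx => ?_
    by_contra hxV
    refine notMem_tsupport_iff_eventuallyEq.2 ?_ hx
    filter_upwards [hχ1 x ⟨hsub _ hβ2 hx, hxV⟩] with z hz
    change α.1 z - (mulRealForm χ α).1 z = 0
    ext v
    simp [mulRealForm_apply, hz]
  rw [← sub_add_cancel α (mulRealForm χ α), map_add, e1, e2, add_zero]

/-- A current vanishes on the forms that vanish near its support. -/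
theorem Current.eq_zero_of_eventually {T : Current n X p} {K : Set X} (hT : T.support ⊆ K)
    {β : RealForm n X p} (hβ : ∀ x ∈ K, ∀ᶠ z in 𝓝 x, β.1 z = 0) : T β = 0 := by
  have := locallyCompactSpace_of_charts n X
  obtain ⟨L, hL, hTL⟩ := exists_compact_support_current T
  obtain ⟨C, hC, hLC⟩ := exists_compact_superset hL
  obtain ⟨θ, hθ1, hθs, -⟩ := exists_cutoff (n := n) hL.isClosed isOpen_interior hLC
  have e1 : T (β - mulRealForm θ β) = 0 := by
    refine hTL _ fun x hx => ?_
    filter_upwards [hθ1 x hx] with z hz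
    change β.1 z - (mulRealForm θ β).1 z = 0
    ext v
    simp [mulRealForm_apply, hz]
  have hts : tsupport (fun x => (mulRealForm θ β).1 x) ⊆ C := by
    refine fun x hx => interior_subset (hθs ?_)
    by_contra hxχ
    refine notMem_tsupport_iff_eventuallyEq.2 ?_ hx
    filter_upwards [notMem_tsupport_iff_eventuallyEq.1 hxχ] with z hz
    ext v
    simp [mulRealForm_apply, hz]
  have hcs : HasCompactSupport (fun x => (mulRealForm θ β).1 x) :=
    hC.of_isClosed_subset (isClosed_tsupport _) hts
  have e2 : T (mulRealForm θ β) = 0 := by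
    obtain ⟨U, -, hKU, hTU⟩ : ∃ U, IsOpen U ∧ tsupport (fun x => (mulRealForm θ β).1 x) ⊆ U ∧
        VanishesOn T U := by
      refine IsCompact.induction_on hcs (p := fun s => ∃ U, IsOpen U ∧ s ⊆ U ∧ VanishesOn T U)
        ?_ ?_ ?_ ?_
      · refine ⟨∅, isOpen_empty, empty_subset _, fun α _ hα => ?_⟩
        have h0 : α = 0 := Subtype.ext (SmoothForm.ext fun x => by
          by_contra hx
          exact hα (subset_tsupport _ (Function.mem_support.2 hx)))
        rw [h0, ContinuousLinearMap.map_zero]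
      · rintro s t hst ⟨U, hU, htU, h⟩
        exact ⟨U, hU, hst.trans htU, h⟩
      · rintro s t ⟨U, hU, hsU, h⟩ ⟨V, hV, htV, h'⟩
        exact ⟨U ∪ V, hU.union hV, union_subset_union hsU htV, h.union hU hV h'⟩
      · intro x hx
        have hxT : x ∉ T.support := by
          intro hxT
          refine notMem_tsupport_iff_eventuallyEq.2 ?_ hx
          filter_upwards [hβ x (hT hxT)] with z hz
          ext v
          simp [mulRealForm_apply, hz]
        obtain ⟨U, ⟨hU, h⟩, hxU⟩ := not_not.1 hxT
        exact ⟨U, mem_nhdsWithin_of_mem_nhds (hU.mem_nhds hxU), U, hU, Subset.rfl, h⟩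
    exact hTU _ hcs hKU
  rw [← sub_add_cancel β (mulRealForm θ β), map_add, e1, e2, add_zero]

end Supports

/-! ### Separation by the Hahn–Banach theorem -/

section Separation

variable {n : ℕ} {X : Type*} [TopologicalSpace X] [ChartedSpace (Cn n) X]
  [IsManifold 𝓘(ℂ, Cn n) ω X] [T2Space X] [SecondCountableTopology X] {p : ℕ} {K : Set X}

/-- A subspace without forms that are transverse on `K` is annihilated by a current supported on `K`:
it is separated from the open convex set of these forms. -/
theorem exists_current_of_disjoint (hK : IsCompact K) (A : Submodule ℝ (RealForm n X p))
    (hA : ∀ Ω ∈ A, Ω ∉ transverseOn K p) : ∃ T : Current n X p, T ≠ 0 ∧ IsStronglyPositive T ∧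
      (∀ Ω ∈ A, T Ω = 0) ∧ T.support ⊆ K := by
  obtain ⟨f, u, hf, hu⟩ := geometric_hahn_banach_open (convex_transverseOn K)
    (isOpen_transverseOn (p := p) hK) A.convex
    (disjoint_left.2 fun Ω h h' => hA Ω h' h)
  -- a linear functional that is bounded below on a subspace vanishes on it
  have hfA : ∀ Ω ∈ A, f Ω = 0 := by
    intro Ω hΩ
    by_contra h0
    have h1 := hu _ (A.smul_mem ((u - 1) / f Ω) hΩ)
    rw [map_smul, smul_eq_mul, div_mul_cancel₀ _ h0] at h1
    linarith
  have hu0 : u ≤ 0 := (hu 0 A.zero_mem).trans_eq f.map_zero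
  have hpos : ∀ Ω ∈ transverseOn K p, f Ω < 0 := fun Ω hΩ => (hf Ω hΩ).trans_le hu0
  obtain ⟨Ω₀, hΩ₀⟩ := transverseOn_nonempty (n := n) hK p
  have hadd : ∀ (Ω : RealForm n X p) (t : ℝ), Ω + t • Ω₀ = (1 : ℝ) • Ω + t • Ω₀ := fun Ω t => by
    rw [one_smul]
  refine ⟨-f, fun h => ?_, fun Ω hΩ => ?_, fun Ω hΩ => ?_, ?_⟩
  · have h1 := hpos Ω₀ hΩ₀
    rw [neg_eq_zero.1 h] at h1
    exact lt_irrefl _ h1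
  -- a weakly positive form is a limit of the transverse forms `Ω + t Ω₀`
  · change 0 ≤ -f Ω
    have h1 : ∀ t : ℝ, 0 < t → f Ω + t * f Ω₀ < 0 := by
      intro t ht
      have h2 : Ω + t • Ω₀ ∈ transverseOn K p := fun x hx => by
        rw [hadd, RealForm.smul_add_smul_apply, add_comm]
        exact (hΩ₀ x hx).smul_add_smul (hΩ x) ht zero_le_one
      have h3 := hpos _ h2
      rwa [map_add, map_smul, smul_eq_mul] at h3
    have h2 : Tendsto (fun t : ℝ => f Ω + t * f Ω₀) (𝓝[>] 0) (𝓝 (f Ω + 0 * f Ω₀)) :=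
      ((continuous_const.add (continuous_id.mul continuous_const)).tendsto 0).mono_left
        nhdsWithin_le_nhds
    have h3 := le_of_tendsto h2 (eventually_mem_nhdsWithin.mono fun t ht => (h1 t ht).le)
    rw [zero_mul, add_zero] at h3
    linarith
  · change -f Ω = 0
    rw [hfA Ω hΩ, neg_zero]
  -- adding multiples of a form `α` supported off `K` does not affect transversality on `K`
  · intro x hx
    by_contra hxK
    refine hx ⟨Kᶜ, ⟨hK.isClosed.isOpen_compl, fun α _ hα => ?_⟩, hxK⟩
    change -f α = 0
    by_contra h0
    have h1 : ∀ t : ℝ, f Ω₀ + t * f α < 0 := by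
      intro t
      have h2 : Ω₀ + t • α ∈ transverseOn K p := fun x hx => by
        have h3 : α.1 x = 0 := by
          by_contra h3
          exact hα (subset_tsupport _ (Function.mem_support.2 h3)) hx
        have h4 : (Ω₀ + t • α).1 x = Ω₀.1 x + (t • α.1) x := rfl
        rw [h4, SmoothForm.real_smul_apply, h3]
        have h5 : Ω₀.1 x + t • (0 : AltForm n (2 * p)) = Ω₀.1 x := by
          ext v
          simp
        rw [h5]
        exact hΩ₀ x hx
      have h3 := hpos _ h2
      rwa [map_add, map_smul, smul_eq_mul] at h3
    have h2 := h1 (-f Ω₀ / f α)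
    rw [div_mul_cancel₀ _ (fun h => h0 (by rw [h, neg_zero]))] at h2
    linarith

/-- A nonzero strongly positive current supported on `K` is positive on the forms which are
transverse on `K`: if `T Ω = 0`, then `T (Ω + t α) ≥ 0` for every `α` and small
`t > 0`, so that `T α ≥ 0` and `T (-α) ≥ 0`. -/
theorem eq_zero_of_apply_eq_zero (hK : IsCompact K) {T : Current n X p}
    (hT : IsStronglyPositive T) (hTK : T.support ⊆ K) {Ω : RealForm n X p}
    (hΩ : Ω ∈ transverseOn K p) (h0 : T Ω = 0) : T = 0 := by
  -- transversality on `K` suffices: cut off where the form is no longer transverse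
  have key : ∀ Θ : RealForm n X p, Θ ∈ transverseOn K p → 0 ≤ T Θ := by
    intro Θ hΘ
    obtain ⟨χ, hχ1, hχs, hχ01⟩ := exists_cutoff (n := n) hK.isClosed (isOpen_isTransverse Θ) hΘ
    have h1 : 0 ≤ T (mulRealForm χ Θ) := by
      refine hT _ fun x => ?_
      rw [mulRealForm_apply]
      by_cases hx : χ x = 0
      · have e : χ x • Θ.1 x = 0 := by
          ext v
          simp [hx]
        rw [e]
        exact isWeaklyPositive_zero
      · exact (hχs (subset_tsupport _ (Function.mem_support.2 hx)) :
          IsTransverse (Θ.1 x)).isWeaklyPositive.smul (hχ01 x).1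
    have h2 : T (Θ - mulRealForm χ Θ) = 0 := by
      refine Current.eq_zero_of_eventually hTK fun x hx => ?_
      filter_upwards [hχ1 x hx] with z hz
      change Θ.1 z - (mulRealForm χ Θ).1 z = 0
      ext v
      simp [mulRealForm_apply, hz]
    rw [ContinuousLinearMap.map_sub, sub_eq_zero] at h2
    rwa [h2]
  have hnonneg : ∀ α : RealForm n X p, 0 ≤ T α := by
    intro α
    have h1 : ∀ᶠ t : ℝ in 𝓝 0, Ω + t • α ∈ transverseOn K p := by
      have hc : Continuous fun t : ℝ => Ω + t • α :=
        continuous_const.add (continuous_id.smul continuous_const)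
      refine hc.continuousAt.eventually ((isOpen_transverseOn hK).mem_nhds ?_)
      change Ω + (0 : ℝ) • α ∈ transverseOn K p
      rwa [zero_smul, add_zero]
    obtain ⟨t, ht, ht0⟩ := ((h1.filter_mono nhdsWithin_le_nhds).and
      (eventually_mem_nhdsWithin (a := (0 : ℝ)) (s := Ioi 0))).exists
    have h2 := key _ ht
    rw [map_add, map_smul, h0, zero_add, smul_eq_mul] at h2
    exact nonneg_of_mul_nonneg_right h2 ht0
  ext α
  have h1 := hnonneg (-α)
  rw [ContinuousLinearMap.map_neg] at h1
  change T α = 0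
  exact le_antisymm (by linarith) (hnonneg α)

/-- The duality principle behind all parts of the theorem. -/
theorem exists_transverse_iff (hK : IsCompact K) (A : Submodule ℝ (RealForm n X p)) :
    (∃ Ω ∈ A, ∀ x ∈ K, IsTransverse (Ω.1 x)) ↔ ¬ ∃ T : Current n X p, T ≠ 0 ∧
      IsStronglyPositive T ∧ (∀ Ω ∈ A, T Ω = 0) ∧ T.support ⊆ K := by
  constructor
  · rintro ⟨Ω, hΩA, hΩ⟩ ⟨T, hT0, hT, hTA, hTK⟩
    exact hT0 (eq_zero_of_apply_eq_zero hK hT hTK hΩ (hTA Ω hΩA))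
  · intro h
    by_contra h'
    exact h (exists_current_of_disjoint hK A fun Ω hΩ hΩt => h' ⟨Ω, hΩ, hΩt⟩)

end Separation

/-- For a strict operator, the functionals that vanish on the kernel are in the range of the
transpose: they factor continuously through the range, and extend by the Hahn–Banach theorem. -/
theorem inRangeTranspose_iff {V W : Type*} [AddCommGroup V] [Module ℝ V] [TopologicalSpace V]
    [IsTopologicalAddGroup V] [AddCommGroup W] [Module ℝ W] [TopologicalSpace W]
    [PolynormableSpace ℝ W] {σ : V →ₗ[ℝ] W} (hσ : IsStrictMap σ) (T : V →L[ℝ] ℝ) :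
    InRangeTranspose σ T ↔ ∀ v ∈ LinearMap.ker σ, T v = 0 := by
  constructor
  · rintro ⟨S, hS⟩ v hv
    rw [hS, LinearMap.mem_ker.1 hv, map_zero]
  · intro hT
    have hq := LinearMap.isStrictMap_iff_isOpenQuotientMap_rangeRestrict.1 hσ
    let S₀ : LinearMap.range σ →ₗ[ℝ] ℝ :=
      (LinearMap.ker σ).liftQ T.toLinearMap hT ∘ₗ
        σ.quotKerEquivRange.symm.toLinearMap
    have hS₀ : ∀ v, S₀ (σ.rangeRestrict v) = T v := by
      intro v
      have : σ.quotKerEquivRange.symm (σ.rangeRestrict v) = Submodule.Quotient.mk v := by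
        rw [LinearEquiv.symm_apply_eq]
        rfl
      change (LinearMap.ker σ).liftQ T.toLinearMap hT
        (σ.quotKerEquivRange.symm (σ.rangeRestrict v)) = T v
      rw [this]
      rfl
    have hc : Continuous S₀ := by
      rw [hq.isQuotientMap.continuous_iff]
      exact T.continuous.congr fun v => (hS₀ v).symm
    obtain ⟨S, hS⟩ := StrongDual.exists_extension (LinearMap.range σ) (⟨S₀, hc⟩ : _ →L[ℝ] ℝ)
    refine ⟨S, fun v => ?_⟩
    have := hS (σ.rangeRestrict v)
    exact (hS₀ v).symm.trans this.symm

end PKahler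

end

theorem theorem8p2 (n : ℕ) (hn : 2 ≤ n) (X : Type*) [TopologicalSpace X]
    [T2Space X] [SecondCountableTopology X] [ChartedSpace (Cn n) X]
    [IsManifold 𝓘(ℂ, Cn n) ω X] (K : Set X) (hK : IsCompact K) (q : ℕ) (hq : q + 1 ≤ n - 1) :
    (IsStrictMap (dRealForm (n := n) (X := X) (q + 1)) →
      ((∃ Ω : RealForm n X (q + 1), dRealForm (q + 1) Ω = 0 ∧ ∀ x ∈ K, IsTransverse (Ω.1 x)) ↔
        ¬ ∃ T : Current n X (q + 1), T ≠ 0 ∧ IsStronglyPositive T ∧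
          InRangeTranspose (dRealForm (q + 1)) T ∧ T.support ⊆ K)) ∧
    (IsStrictMap (delBarAddDel (n := n) (X := X) q) →
      IsStrictMap (dRealForm (n := n) (X := X) (q + 1)) →
      Module.Finite ℝ (LinearMap.ker (iDelDelBar (n := n) (X := X) (q + 1)) ⧸
        (LinearMap.range (delBarAddDel (n := n) (X := X) q)).submoduleOf
          (LinearMap.ker (iDelDelBar (n := n) (X := X) (q + 1)))) →
      ((∃ Ω : RealForm n X (q + 1),
          Ω ∈ LinearMap.ker (dRealForm (n := n) (X := X) (q + 1)) ⊔
            LinearMap.range (delBarAddDel (n := n) (X := X) q) ∧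
          ∀ x ∈ K, IsTransverse (Ω.1 x)) ↔
        ¬ ∃ T : Current n X (q + 1), T ≠ 0 ∧ IsStronglyPositive T ∧
          InKerTranspose (delBarAddDel q) T ∧ InRangeTranspose (dRealForm (q + 1)) T ∧
          T.support ⊆ K)) ∧
    ((∃ Ψ : realForms n X (2 * (q + 1)), dReal n X (2 * (q + 1)) Ψ = 0 ∧
        ∀ x ∈ K, IsTransverse ((ppPart (q + 1) Ψ).1 x)) ↔
      ¬ ∃ T : Current n X (q + 1), T ≠ 0 ∧ IsStronglyPositive T ∧
        (∃ R : realForms n X (2 * (q + 1) + 1) →L[ℝ] ℝ,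
          ∀ Ψ, R (dReal n X (2 * (q + 1)) Ψ) = T (ppPart (q + 1) Ψ)) ∧
        T.support ⊆ K) ∧
    (IsStrictMap (iDelDelBar (n := n) (X := X) (q + 1)) →
      ((∃ Ω : RealForm n X (q + 1), iDelDelBar (q + 1) Ω = 0 ∧ ∀ x ∈ K, IsTransverse (Ω.1 x)) ↔
        ¬ ∃ T : Current n X (q + 1), T ≠ 0 ∧ IsStronglyPositive T ∧
          InRangeTranspose (iDelDelBar (q + 1)) T ∧ T.support ⊆ K)) := by
  refine ⟨fun hσ => ?_, fun _ hσ _ => ?_, ?_, fun hσ => ?_⟩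
  · refine (exists_transverse_iff hK (LinearMap.ker (dRealForm (q + 1)))).trans ?_
    simp only [inRangeTranspose_iff hσ]
  · refine (exists_transverse_iff hK (LinearMap.ker (dRealForm (q + 1)) ⊔
      LinearMap.range (delBarAddDel q))).trans (not_congr (exists_congr fun T => ?_))
    rw [inRangeTranspose_iff hσ]
    have h : (∀ Ω ∈ LinearMap.ker (dRealForm (n := n) (X := X) (q + 1)) ⊔
        LinearMap.range (delBarAddDel q), T Ω = 0) ↔ InKerTranspose (delBarAddDel q) T ∧
          ∀ Ω ∈ LinearMap.ker (dRealForm (n := n) (X := X) (q + 1)), T Ω = 0 := by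
      have h1 := sup_le_iff (a := LinearMap.ker (dRealForm (n := n) (X := X) (q + 1)))
        (b := LinearMap.range (delBarAddDel q)) (c := LinearMap.ker T.toLinearMap)
      refine h1.trans (and_comm.trans (and_congr ?_ Iff.rfl))
      rw [LinearMap.range_le_ker_iff, LinearMap.ext_iff]
      rfl
    rw [h, and_assoc]
  · have h1 : (∃ Ψ : realForms n X (2 * (q + 1)), dReal n X (2 * (q + 1)) Ψ = 0 ∧
        ∀ x ∈ K, IsTransverse ((ppPart (q + 1) Ψ).1 x)) ↔
        ∃ Ω ∈ (LinearMap.ker (dReal n X (2 * (q + 1)))).map (ppPart (q + 1)),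
          ∀ x ∈ K, IsTransverse (Ω.1 x) :=
      ⟨fun ⟨Ψ, h, h'⟩ => ⟨_, ⟨Ψ, h, rfl⟩, h'⟩, fun ⟨_, ⟨Ψ, h, rfl⟩, h'⟩ => ⟨Ψ, h, h'⟩⟩
    rw [h1, exists_transverse_iff hK]
    refine not_congr (exists_congr fun T => and_congr_right fun _ => and_congr_right fun _ =>
      and_congr_left fun _ => ⟨fun h => ?_, ?_⟩)
    · exact exists_eq_comp_dReal (T.comp ⟨ppPart (q + 1), continuous_ppPart⟩)
        fun Ψ hΨ => h _ ⟨Ψ, hΨ, rfl⟩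
    · rintro ⟨R, hR⟩ _ ⟨Ψ, hΨ, rfl⟩
      rw [← hR, LinearMap.mem_ker.1 hΨ, ContinuousLinearMap.map_zero]
  · refine (exists_transverse_iff hK (LinearMap.ker (iDelDelBar (q + 1)))).trans ?_
    simp only [inRangeTranspose_iff hσ]
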